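/- **Setting.** Let $d\ge 1$, $T>0$, and let $\Omega\subset\mathbb R^d$ be a bounded open polytopic set, i.e. nonempty, bounded, open, equal to the interior of its closure, with $\partial\Omega$ contained in finitely many hyperplanes (equivalently, the interior of a finite union of convex $d$-dimensional polytopes); polytopes below are meant in the same sense. Let $Q_T=\Omega\times(0,T)$, and let $\mathcal T_h$ be a finite partition of $Q_T$ into pairwise disjoint open prisms $K=K_{\mathbf x}\times K_t$, with $K_{\mathbf x}\subset\Omega$ a polytope and $K_t\subset(0,T)$ an open interval, whose closures cover $\overline{Q_T}$ (hanging nodes are allowed). Let $\partial\Omega$ be partitioned, up to sets of zero surface measure, into measurable parts $\Gamma_D,\Gamma_N,\Gamma_R$, and put $F_\ast=\Gamma_\ast\times(0,T)$ for $\ast\in\{D,N,R\}$, $F_0=\Omega\times\{0\}$, $F_T=\Omega\times\{T\}$. Let $F_{\rm space}$ and $F_{\rm time}$ be the unions of the internal space-like (horizontal) and time-like (vertical) mesh facets. On vertical facets and on $\partial\Omega\times(0,T)$ the surface measure $dS$ is the product of the $(d-1)$-dimensional surface measure and $dt$. **Coefficients.** $V:Q_T\to\mathbb R$ is such that $Vv|_K\in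 L^2(K)$ for all $v\in V(\mathcal T_h)$ (defined below) and $K\in\mathcal T_h$ (e.g. $V\in L^\infty(Q_T)$), and - $\alpha\in L^\infty(F_{\rm time}\cup F_D)$, $\beta\in L^\infty(F_{\rm time}\cup F_N)$, $\mu\in L^\infty(Q_T)$ are real, with positive essential infimum; - $\vartheta,\delta\in L^\infty(F_R)$ are real, $\vartheta>0$ and $0<\delta\le\frac12$ almost everywhere, and $\delta/\vartheta$ is essentially bounded on $F_R$ (e.g. $\operatorname{ess\,inf}\vartheta>0$). **Space, operator, traces.** Let $$V(\mathcal T_h)=\prod_{K\in\mathcal T_h} H^1(K_t;L^2(K_{\mathbf x}))\cap L^2(K_t;H^2(K_{\mathbf x}))$$ (complex valued functions) and, on each $K$, $\mathcal S w=i\partial_t w+\frac12\Delta_{\mathbf x}w-Vw$. The trace of a function on $\partial K$ from inside $K$ is the limit, as $r\to0$, of its mean values over $K\cap B(p,r)$. On a vertical facet shared by $K_1,K_2$, with outward unit space normals $\mathbf n_1,\mathbf n_2$, put $\{w\}=\frac12(w_1+w_2)$, $[w]_N=w_1\mathbf n_1+w_2\mathbf n_2$, $\{\nabla w\}=\frac12(\nabla_{\mathbf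 x} w_1+\nabla_{\mathbf x} w_2)$, $[\nabla w]_N=\nabla_{\mathbf x} w_1\cdot\mathbf n_1+\nabla_{\mathbf x} w_2\cdot\mathbf n_2$, in terms of traces. On horizontal facets $[w]_t=w^--w^+$, where $w^-$ and $w^+$ are the traces from below and from above in time; on $F_T$ (resp. $F_0$) $w$ denotes the trace from below (resp. above). On $\partial\Omega\times(0,T)$, $\partial_n w$ is the outward normal derivative in space. **Form and norm.** For $u,s\in V(\mathcal T_h)$ let $$\begin{aligned} \mathcal A(u,s)={}&\sum_{K}\int_K u\,\overline{\mathcal S s}+i\Big(\int_{F_{\rm space}}u^-\,\overline{[s]_t}\,dx+\int_{F_T}u\,\overline s\,dx\Big)\\ &+\frac12\int_{F_{\rm time}}\Big(\{\nabla u\}\cdot[\overline s]_N+i\alpha[u]_N\cdot[\overline s]_N-\{u\}[\nabla\overline s]_N+i\beta[\nabla u]_N[\nabla\overline s]_N\Big)dS\\ &+\frac12\int_{F_D}(\partial_nu+i\alpha u)\overline s\,dS+\frac12\int_{F_N}\big(-u\,\partial_n\overline s+i\beta\,\partial_nu\,\partial_n\overline s\big)dS\\ &+\frac12\int_{F_R}\big(\delta\,\partial_nu+(1-\delta)i\vartheta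 u\big)\Big(\overline s+\frac i\vartheta\partial_n\overline s\Big)dS+i\sum_K\int_K\mu\,\mathcal S u\,\overline{\mathcal S s}, \end{aligned}$$ where $a\cdot b=\sum_j a_jb_j$, and $$\begin{aligned} |||w|||_{DG}^2={}&\sum_K\|\mu^{1/2}\mathcal S w\|_{L^2(K)}^2+\frac12\Big(\|[w]_t\|^2_{L^2(F_{\rm space})}+\|w\|^2_{L^2(F_T\cup F_0)}\Big)\\ &+\frac12\Big(\|\alpha^{1/2}[w]_N\|^2_{L^2(F_{\rm time})^d}+\|\beta^{1/2}[\nabla w]_N\|^2_{L^2(F_{\rm time})}+\|\alpha^{1/2}w\|^2_{L^2(F_D)}+\|\beta^{1/2}\partial_nw\|^2_{L^2(F_N)}\\ &\qquad+\|(\vartheta(1-\delta))^{1/2}w\|^2_{L^2(F_R)}+\|(\delta\vartheta^{-1})^{1/2}\partial_nw\|^2_{L^2(F_R)}\Big). \end{aligned}$$ **Proposition (coercivity).** For every $w\in V(\mathcal T_h)$, the traces of $w$ and of $\nabla_{\mathbf x}w$ on the lateral boundary $\partial K_{\mathbf x}\times K_t$ of each element $K$, and those of $w$ on the top and bottom faces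 of $K$, exist almost everywhere and are square integrable, and $$\operatorname{Im}\,\mathcal A(w,w)=|||w|||_{DG}^2 .$$ -/

import Mathlib

open MeasureTheory Set Filter Topology
open scoped ContDiff ComplexConjugate

noncomputable section

/-! ### Space--time, polytopes and outward normals -/

/-- The space `ℝ^d` with its Euclidean norm. -/
abbrev Space (d : ℕ) : Type := EuclideanSpace ℝ (Fin d)

/-- Space--time points `(x, t)`. The volume of this type is the Lebesgue measure `dx dt`. -/
abbrev SpaceTime (d : ℕ) : Type := Space d × ℝ

/-- The unit vector of the `j`-th space coordinate, as a direction in space--time. -/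
def spaceDir {d : ℕ} (j : Fin d) : SpaceTime d := (EuclideanSpace.single j 1, 0)

/-- The unit vector of the time coordinate. -/
def timeDir (d : ℕ) : SpaceTime d := (0, 1)

/-- Open `d`-dimensional polytopes, not necessarily convex: nonempty bounded open sets that equal
the interior of their closure and whose boundary lies in finitely many hyperplanes `⟪h, x⟫ = c`.
Equivalently: interiors of finite unions of `d`-dimensional convex polytopes. -/
def IsPolytope {d : ℕ} (U : Set (Space d)) : Prop :=
  U.Nonempty ∧ IsOpen U ∧ Bornology.IsBounded U ∧ interior (closure U) = U ∧
    ∃ H : Finset (Space d × ℝ), (∀ h ∈ H, h.1 ≠ 0) ∧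
      frontier U ⊆ ⋃ h ∈ H, {x | inner ℝ h.1 x = h.2}

/-- `n` is the outward unit normal of `U` at a point `x` near which `U` is an open half-space. -/
def IsOutwardNormal {d : ℕ} (U : Set (Space d)) (x n : Space d) : Prop :=
  ‖n‖ = 1 ∧ ∃ r > 0, ∀ y ∈ Metric.ball x r, y ∈ U ↔ inner ℝ (y - x) n < 0

open Classical in
/-- The outward unit normal of `U` at a boundary point; for a polytope it is defined at almost
every boundary point (and set to `0` on the lower-dimensional faces). -/
def outwardNormal {d : ℕ} (U : Set (Space d)) (x : Space d) : Space d :=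
  if h : ∃ n, IsOutwardNormal U x n then h.choose else 0

/-! ### Weak derivatives and traces -/

/-- `g` is the weak derivative of `u` in the direction `v` on the open set `U`. -/
def IsWeakDeriv {d : ℕ} (U : Set (SpaceTime d)) (v : SpaceTime d) (u g : SpaceTime d → ℂ) : Prop :=
  ∀ φ : SpaceTime d → ℝ, ContDiff ℝ ∞ φ → HasCompactSupport φ → tsupport φ ⊆ U →
    ∫ p in U, u p * ((fderiv ℝ φ p v : ℝ) : ℂ) = -∫ p in U, g p * ((φ p : ℝ) : ℂ)

/-- `u` has a weak derivative in `L²(U)` in the direction `v`. -/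
def HasL2WeakDeriv {d : ℕ} (U : Set (SpaceTime d)) (v : SpaceTime d) (u : SpaceTime d → ℂ) :
    Prop :=
  ∃ g, MemLp g 2 (volume.restrict U) ∧ IsWeakDeriv U v u g

open Classical in
/-- The weak derivative in `L²(U)`, which is unique up to null sets in `U`. -/
def weakDeriv {d : ℕ} (U : Set (SpaceTime d)) (v : SpaceTime d) (u : SpaceTime d → ℂ) :
    SpaceTime d → ℂ :=
  if h : HasL2WeakDeriv U v u then h.choose else 0

/-- The mean value of `u` over the part of `U` at distance less than `r` from `p`. -/
def ballMean {d : ℕ} (U : Set (SpaceTime d)) (u : SpaceTime d → ℂ) (p : SpaceTime d) (r : ℝ) : ℂ :=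
  ⨍ q in U ∩ Metric.ball p r, u q

/-- The trace from inside `U` of `u` at a boundary point `p`, in its precise pointwise form: the
limit of the mean values of `u` over `U ∩ B(p, r)` as `r → 0`. It does not depend on the
representative of `u`. -/
def trace {d : ℕ} (U : Set (SpaceTime d)) (u : SpaceTime d → ℂ) (p : SpaceTime d) : ℂ :=
  limUnder (𝓝[>] (0 : ℝ)) (ballMean U u p)

/-- With respect to the surface measure `ν`, the trace of `u` exists almost everywhere and is
square integrable. -/
def HasL2Trace {d : ℕ} (U : Set (SpaceTime d)) (u : SpaceTime d → ℂ)
    (ν : Measure (SpaceTime d)) : Prop :=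
  (∀ᵐ p ∂ν, ∃ c, Tendsto (ballMean U u p) (𝓝[>] (0 : ℝ)) (𝓝 c)) ∧ MemLp (trace U u) 2 ν

/-- The local space `H¹(K_t; L²(K_x)) ∩ L²(K_t; H²(K_x))` on `K = K_x × K_t`: the functions
`u ∈ L²(K)` whose weak derivatives `∂_t u`, `∂_j u` and `∂_k ∂_j u` belong to `L²(K)`. -/
def MemLocalSpace {d : ℕ} (K : Set (SpaceTime d)) (u : SpaceTime d → ℂ) : Prop :=
  MemLp u 2 (volume.restrict K) ∧
    HasL2WeakDeriv K (timeDir d) u ∧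
    (∀ j, HasL2WeakDeriv K (spaceDir j) u) ∧
    ∀ j k, HasL2WeakDeriv K (spaceDir k) (weakDeriv K (spaceDir j) u)

/-- The Schrödinger operator `S u = i ∂_t u + ½ Δ_x u - V u` on `K`. -/
def schrodinger {d : ℕ} (V : SpaceTime d → ℝ) (K : Set (SpaceTime d)) (u : SpaceTime d → ℂ) :
    SpaceTime d → ℂ := fun p =>
  Complex.I * weakDeriv K (timeDir d) u p
    + (1 / 2) * ∑ j, weakDeriv K (spaceDir j) (weakDeriv K (spaceDir j) u) p
    - (V p : ℂ) * u p

/-! ### The mesh -/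

/-- A non-overlapping prismatic partition of `Q_T = Ω × (0, T)` into finitely many elements
`K_i = (Kx i) × (a i, b i)`, with `Kx i` a polytope. Hanging nodes are allowed. -/
structure PrismaticMesh {d : ℕ} (Ω : Set (Space d)) (T : ℝ) (ι : Type*) where
  Kx : ι → Set (Space d)
  a : ι → ℝ
  b : ι → ℝ
  polytope : ∀ i, IsPolytope (Kx i)
  lt : ∀ i, a i < b i
  subset_space : ∀ i, Kx i ⊆ Ω
  nonneg : ∀ i, 0 ≤ a i
  le : ∀ i, b i ≤ T
  disjoint : ∀ i j, i ≠ j → Disjoint (Kx i ×ˢ Ioo (a i) (b i)) (Kx j ×ˢ Ioo (a j) (b j))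
  cover : ⋃ i, closure (Kx i) ×ˢ Icc (a i) (b i) = closure Ω ×ˢ Icc 0 T

/-- A partition of `∂Ω`, up to null sets for the surface measure, into the Dirichlet, Neumann and
Robin parts. -/
structure BoundaryPartition {d : ℕ} (Ω : Set (Space d)) where
  D : Set (Space d)
  N : Set (Space d)
  R : Set (Space d)
  measurable_D : MeasurableSet D
  measurable_N : MeasurableSet N
  measurable_R : MeasurableSet R
  subset_D : D ⊆ frontier Ω
  subset_N : N ⊆ frontier Ω
  subset_R : R ⊆ frontier Ω
  null_DN : μHE[d - 1] (D ∩ N) = 0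
  null_DR : μHE[d - 1] (D ∩ R) = 0
  null_NR : μHE[d - 1] (N ∩ R) = 0
  cover : μHE[d - 1] (frontier Ω \ (D ∪ N ∪ R)) = 0

/-- Potential `V`, stabilization functions `α, β, δ`, volume penalty `μ` and impedance `θ`. -/
structure Coefficients (d : ℕ) where
  V : SpaceTime d → ℝ
  α : SpaceTime d → ℝ
  β : SpaceTime d → ℝ
  δ : SpaceTime d → ℝ
  μ : SpaceTime d → ℝ
  θ : SpaceTime d → ℝ

namespace PrismaticMesh

variable {d : ℕ} {Ω : Set (Space d)} {T : ℝ} {ι : Type*}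

/-- The (open) element `K_i`. -/
def elem (M : PrismaticMesh Ω T ι) (i : ι) : Set (SpaceTime d) := M.Kx i ×ˢ Ioo (M.a i) (M.b i)

/-- The lateral boundary `∂K_x × K_t` of an element. -/
def lateral (M : PrismaticMesh Ω T ι) (i : ι) : Set (SpaceTime d) :=
  frontier (M.Kx i) ×ˢ Ioo (M.a i) (M.b i)

/-- The top face `K_x × {b}` of an element. -/
def top (M : PrismaticMesh Ω T ι) (i : ι) : Set (SpaceTime d) := M.Kx i ×ˢ {M.b i}

/-- The bottom face `K_x × {a}` of an element. -/
def bottom (M : PrismaticMesh Ω T ι) (i : ι) : Set (SpaceTime d) := M.Kx i ×ˢ {M.a i}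

/-- Surface measure `dS` on the lateral part of the skeleton and of `∂Ω × (0, T)`: the product of
the `(d-1)`-dimensional Euclidean surface measure and of `dt`. -/
def lateralMeasure (M : PrismaticMesh Ω T ι) : Measure (SpaceTime d) :=
  ((μHE[d - 1] : Measure (Space d)).restrict (frontier Ω ∪ ⋃ i, frontier (M.Kx i))).prod volume

/-- Surface measure `dx` on the horizontal part of the skeleton: Lebesgue measure on each of the
time levels `0`, `T`, `a_i` and `b_i`. -/
def horizontalMeasure (M : PrismaticMesh Ω T ι) : Measure (SpaceTime d) :=
  (volume : Measure (Space d)).prod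
    ((Measure.count : Measure ℝ).restrict ({0, T} ∪ range M.a ∪ range M.b))

/-- The union of the internal time-like facets. -/
def Ftime (M : PrismaticMesh Ω T ι) : Set (SpaceTime d) :=
  {p | p ∈ Ω ×ˢ Ioo 0 T ∧ ∃ i j, i ≠ j ∧ p ∈ M.lateral i ∧ p ∈ M.lateral j}

/-- The union of the internal space-like facets: the points lying both on the top face of an
element and on the bottom face of another one. -/
def Fspace (M : PrismaticMesh Ω T ι) : Set (SpaceTime d) :=
  {p | p ∈ Ω ×ˢ Ioo 0 T ∧ ∃ i j, p ∈ M.top i ∧ p ∈ M.bottom j}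

/-- The broken space `V(T_h)`, the product of the local spaces. -/
def MemBroken (M : PrismaticMesh Ω T ι) (w : ι → SpaceTime d → ℂ) : Prop :=
  ∀ i, MemLocalSpace (M.elem i) (w i)

/-- The `j`-th component of the space gradient of `w` on the element `K_i`. -/
def grad (M : PrismaticMesh Ω T ι) (w : ι → SpaceTime d → ℂ) (i : ι) (j : Fin d) :
    SpaceTime d → ℂ :=
  weakDeriv (M.elem i) (spaceDir j) (w i)

/-- `S w` on the element `K_i`. -/
def schr (M : PrismaticMesh Ω T ι) (V : SpaceTime d → ℝ) (w : ι → SpaceTime d → ℂ) (i : ι) :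
    SpaceTime d → ℂ :=
  schrodinger V (M.elem i) (w i)

/-- All the traces that enter the DG form exist almost everywhere and are square integrable: those
of `w` and of its space gradient on the lateral boundaries, and those of `w` on the top and bottom
faces. -/
def TracesWellDefined (M : PrismaticMesh Ω T ι) (w : ι → SpaceTime d → ℂ) : Prop :=
  ∀ i, HasL2Trace (M.elem i) (w i) (M.lateralMeasure.restrict (M.lateral i)) ∧
    (∀ j, HasL2Trace (M.elem i) (M.grad w i j) (M.lateralMeasure.restrict (M.lateral i))) ∧
    HasL2Trace (M.elem i) (w i) (M.horizontalMeasure.restrict (M.top i)) ∧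
    HasL2Trace (M.elem i) (w i) (M.horizontalMeasure.restrict (M.bottom i))

/-- The conditions on the coefficients: `α, β, μ` are essentially bounded with positive essential
infimum; `δ` and the positive function `θ` are essentially bounded, `0 < δ ≤ 1/2`, and `δ / θ` is
essentially bounded; multiplication by the potential `V` maps the broken space to `L²`. -/
structure Admissible (M : PrismaticMesh Ω T ι) (B : BoundaryPartition Ω) (c : Coefficients d) :
    Prop where
  α_bdd : MemLp c.α ⊤ (M.lateralMeasure.restrict (M.Ftime ∪ B.D ×ˢ Ioo 0 T))
  α_pos : ∃ m > 0, ∀ᵐ p ∂(M.lateralMeasure.restrict (M.Ftime ∪ B.D ×ˢ Ioo 0 T)), m ≤ c.α p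
  β_bdd : MemLp c.β ⊤ (M.lateralMeasure.restrict (M.Ftime ∪ B.N ×ˢ Ioo 0 T))
  β_pos : ∃ m > 0, ∀ᵐ p ∂(M.lateralMeasure.restrict (M.Ftime ∪ B.N ×ˢ Ioo 0 T)), m ≤ c.β p
  δ_bdd : MemLp c.δ ⊤ (M.lateralMeasure.restrict (B.R ×ˢ Ioo 0 T))
  δ_mem : ∀ᵐ p ∂(M.lateralMeasure.restrict (B.R ×ˢ Ioo 0 T)), 0 < c.δ p ∧ c.δ p ≤ 1 / 2
  θ_bdd : MemLp c.θ ⊤ (M.lateralMeasure.restrict (B.R ×ˢ Ioo 0 T))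
  θ_pos : ∀ᵐ p ∂(M.lateralMeasure.restrict (B.R ×ˢ Ioo 0 T)), 0 < c.θ p
  δ_le : ∃ C, ∀ᵐ p ∂(M.lateralMeasure.restrict (B.R ×ˢ Ioo 0 T)), c.δ p ≤ C * c.θ p
  μ_bdd : MemLp c.μ ⊤ (volume.restrict (Ω ×ˢ Ioo 0 T))
  μ_pos : ∃ m > 0, ∀ᵐ p ∂(volume.restrict (Ω ×ˢ Ioo 0 T)), m ≤ c.μ p
  V_mul : ∀ v, M.MemBroken v → ∀ i,
    MemLp (fun p => (c.V p : ℂ) * v i p) 2 (volume.restrict (M.elem i))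

variable [Fintype ι]

/-! ### Averages, jumps and boundary values

At almost every point of the internal time-like facets exactly two elements meet, at almost every
point of `∂Ω × (0, T)` exactly one; the sums below run over these adjacent elements. -/

/-- The average of `w` on time-like facets. -/
def avg (M : PrismaticMesh Ω T ι) (w : ι → SpaceTime d → ℂ) (p : SpaceTime d) : ℂ :=
  (1 / 2) * ∑ i, (M.lateral i).indicator (trace (M.elem i) (w i)) p

/-- The `j`-th component of the average of `∇_x w` on time-like facets. -/
def avgGrad (M : PrismaticMesh Ω T ι) (w : ι → SpaceTime d → ℂ) (j : Fin d)
    (p : SpaceTime d) : ℂ :=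
  (1 / 2) * ∑ i, (M.lateral i).indicator (trace (M.elem i) (M.grad w i j)) p

/-- The `j`-th component of the space jump of `w` on time-like facets. -/
def jump (M : PrismaticMesh Ω T ι) (w : ι → SpaceTime d → ℂ) (j : Fin d) (p : SpaceTime d) : ℂ :=
  ∑ i, (M.lateral i).indicator
    (fun q => trace (M.elem i) (w i) q * ((outwardNormal (M.Kx i) q.1 j : ℝ) : ℂ)) p

/-- The space jump of `∇_x w` on time-like facets. -/
def jumpGrad (M : PrismaticMesh Ω T ι) (w : ι → SpaceTime d → ℂ) (p : SpaceTime d) : ℂ :=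
  ∑ i, (M.lateral i).indicator
    (fun q => ∑ j, trace (M.elem i) (M.grad w i j) q *
      ((outwardNormal (M.Kx i) q.1 j : ℝ) : ℂ)) p

/-- The value `w⁻` from the element before: the trace from the element below. -/
def before (M : PrismaticMesh Ω T ι) (w : ι → SpaceTime d → ℂ) (p : SpaceTime d) : ℂ :=
  ∑ i, (M.top i).indicator (trace (M.elem i) (w i)) p

/-- The value `w⁺` from the element after: the trace from the element above. -/
def after (M : PrismaticMesh Ω T ι) (w : ι → SpaceTime d → ℂ) (p : SpaceTime d) : ℂ :=
  ∑ i, (M.bottom i).indicator (trace (M.elem i) (w i)) p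

/-- The time jump `w⁻ - w⁺` on space-like facets. -/
def jumpTime (M : PrismaticMesh Ω T ι) (w : ι → SpaceTime d → ℂ) (p : SpaceTime d) : ℂ :=
  M.before w p - M.after w p

/-- The trace of `w` on `∂Ω × (0, T)`. -/
def bdry (M : PrismaticMesh Ω T ι) (w : ι → SpaceTime d → ℂ) (p : SpaceTime d) : ℂ :=
  ∑ i, (M.lateral i).indicator (trace (M.elem i) (w i)) p

/-- The normal derivative `∂_n w` on `∂Ω × (0, T)`. -/
def normalDeriv (M : PrismaticMesh Ω T ι) (w : ι → SpaceTime d → ℂ) (p : SpaceTime d) : ℂ :=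
  ∑ i, (M.lateral i).indicator
    (fun q => ∑ j, trace (M.elem i) (M.grad w i j) q * ((outwardNormal Ω q.1 j : ℝ) : ℂ)) p

/-! ### The DG form and the DG norm -/

/-- The DG sesquilinear form `A(u, s)`. -/
def form (M : PrismaticMesh Ω T ι) (B : BoundaryPartition Ω) (c : Coefficients d)
    (u s : ι → SpaceTime d → ℂ) : ℂ :=
  (∑ i, ∫ p in M.elem i, u i p * conj (M.schr c.V s i p))
  + Complex.I *
    ((∫ p in M.Fspace, M.before u p * conj (M.jumpTime s p) ∂M.horizontalMeasure)
      + ∫ p in Ω ×ˢ {T}, M.before u p * conj (M.before s p) ∂M.horizontalMeasure)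
  + (1 / 2) * (∫ p in M.Ftime,
      ((∑ j, M.avgGrad u j p * conj (M.jump s j p))
        + Complex.I * (c.α p : ℂ) * (∑ j, M.jump u j p * conj (M.jump s j p))
        - M.avg u p * conj (M.jumpGrad s p)
        + Complex.I * (c.β p : ℂ) * (M.jumpGrad u p * conj (M.jumpGrad s p))) ∂M.lateralMeasure)
  + (1 / 2) * (∫ p in B.D ×ˢ Ioo 0 T,
      (M.normalDeriv u p + Complex.I * (c.α p : ℂ) * M.bdry u p) * conj (M.bdry s p)
        ∂M.lateralMeasure)
  + (1 / 2) * (∫ p in B.N ×ˢ Ioo 0 T,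
      (-(M.bdry u p * conj (M.normalDeriv s p))
        + Complex.I * (c.β p : ℂ) * M.normalDeriv u p * conj (M.normalDeriv s p))
        ∂M.lateralMeasure)
  + (1 / 2) * (∫ p in B.R ×ˢ Ioo 0 T,
      ((c.δ p : ℂ) * M.normalDeriv u p
          + (1 - (c.δ p : ℂ)) * Complex.I * (c.θ p : ℂ) * M.bdry u p)
        * (conj (M.bdry s p) + Complex.I / (c.θ p : ℂ) * conj (M.normalDeriv s p))
        ∂M.lateralMeasure)
  + Complex.I * ∑ i, ∫ p in M.elem i,
      (c.μ p : ℂ) * (M.schr c.V u i p * conj (M.schr c.V s i p))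

/-- The DG norm; a weighted term `‖ω^{1/2} f‖²` is written as the integral of `ω |f|²`. -/
def dgNorm (M : PrismaticMesh Ω T ι) (B : BoundaryPartition Ω) (c : Coefficients d)
    (w : ι → SpaceTime d → ℂ) : ℝ :=
  Real.sqrt (
    (∑ i, ∫ p in M.elem i, c.μ p * ‖M.schr c.V w i p‖ ^ 2)
    + (1 / 2) *
      ((∫ p in M.Fspace, ‖M.jumpTime w p‖ ^ 2 ∂M.horizontalMeasure)
        + (∫ p in Ω ×ˢ {T}, ‖M.before w p‖ ^ 2 ∂M.horizontalMeasure)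
        + ∫ p in Ω ×ˢ {0}, ‖M.after w p‖ ^ 2 ∂M.horizontalMeasure)
    + (1 / 2) *
      ((∫ p in M.Ftime, c.α p * ∑ j, ‖M.jump w j p‖ ^ 2 ∂M.lateralMeasure)
        + (∫ p in M.Ftime, c.β p * ‖M.jumpGrad w p‖ ^ 2 ∂M.lateralMeasure)
        + (∫ p in B.D ×ˢ Ioo 0 T, c.α p * ‖M.bdry w p‖ ^ 2 ∂M.lateralMeasure)
        + (∫ p in B.N ×ˢ Ioo 0 T, c.β p * ‖M.normalDeriv w p‖ ^ 2 ∂M.lateralMeasure)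
        + (∫ p in B.R ×ˢ Ioo 0 T, c.θ p * (1 - c.δ p) * ‖M.bdry w p‖ ^ 2 ∂M.lateralMeasure)
        + ∫ p in B.R ×ˢ Ioo 0 T, c.δ p / c.θ p * ‖M.normalDeriv w p‖ ^ 2 ∂M.lateralMeasure))

end PrismaticMesh

end

noncomputable section

set_option linter.unusedSectionVars false

/-! The identity is an energy balance. On one element the imaginary part of `w * conj (S w)` is a
divergence: the potential term is real, the time term is `-½ ∂_t |w|²`, and the space term is `½ div
Im (w ∇ conj w)` because `∇w · ∇ conj w` is real. So the volume integral reduces to `|w|²` on the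
top and bottom faces and to the flux `Im (w ∂_n conj w)` on the lateral boundary
(`MemLocalSpace.im_setIntegral_mul_conj_schrodinger`).

After summation over the elements, the consistency terms of the form absorb these boundary terms. On
a horizontal facet, `Re (w⁻ conj (w⁻ - w⁺)) = ½ (|w⁻ - w⁺|² + |w⁻|² - |w⁺|²)`. On an internal
vertical facet, `{∇w}·[conj w] - {w}[∇ conj w]` has imaginary part exactly opposite to the sum of
the two fluxes, since the remaining products of values from different sides are real
(`ae_Ftime_identity`). On each boundary part the unpenalized terms also cancel the flux. Only the
penalty terms are left, and they are the squares in the norm.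

Most of the work is to justify the integrations by parts for weak derivatives on nonconvex
polytopes, with traces defined as limits of mean values. A function with an integrable weak
derivative in a direction satisfies the fundamental theorem of calculus on almost every line of that
direction (`IsWeakDeriv.ae_line`). Its boundary value along the line is an explicit integral over a
segment (`eq_integral_of_eq_add_primitive`), hence an integrable function of the line. At Lebesgue
points of this function, the mean values over `K ∩ B(p, r)` converge to it
(`ae_hasLineTrace_of_nhds`). The mean value does not know the direction of the line, so boundary
values along different transversal directions agree almost everywhere.

This freedom is used twice. Square integrability up to the edges follows from covering each face by
finitely many bases of cylinders of uniform height inside the polytope, in suitable oblique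
directions (`IsBoundedBy.exists_cylinders`). Green's formula (`IsBoundedBy.setIntegral_space`) uses
the coordinate directions: almost every line cuts the polytope in finitely many intervals, one
integrates by parts on each, and the projection of a face along the line has Jacobian `|n · v|`,
which produces the factor `n · v` of the surface integral.

The mesh contributes one more fact: at almost every lateral point exactly two elements with opposite
normals meet inside `Ω`, and at most one touches `∂Ω`, with the normal of `Ω`. Both hold because the
set of flat boundary points has full surface measure and disjoint half-spaces must be opposite. -/

/-! ### The fundamental theorem of calculus for weak derivatives. -/

instance spaceTimeVolume_isAddHaarMeasure {d : ℕ} :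
    (volume : Measure (SpaceTime d)).IsAddHaarMeasure :=
  Measure.prod.instIsAddHaarMeasure _ _

/-- The shear `(σ, x) ↦ (σ, x + σ v)` preserves the product measure. -/
theorem measurePreserving_shear {d : ℕ} (v : SpaceTime d) (ν : Measure ℝ) [SFinite ν] :
    MeasurePreserving (fun p : ℝ × SpaceTime d => (p.1, p.2 + p.1 • v))
      (ν.prod volume) (ν.prod volume) := by
  refine (MeasurePreserving.id ν).skew_product (g := fun σ x => x + σ • v) ?_ ?_
  · fun_prop
  · exact .of_forall fun σ => (measurePreserving_add_right volume (σ • v)).map_eq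

/-- The set of the starting points of the segments `[x, x + v]` contained in an open set. -/
theorem isOpen_segment_subset {X : Type*} [TopologicalSpace X] {α : Type*} [TopologicalSpace α]
    {K : Set X} (hK : IsOpen K) {f : α × ℝ → X} (hf : Continuous f) :
    IsOpen {x | ∀ σ ∈ Icc (0 : ℝ) 1, f (x, σ) ∈ K} := by
  rw [isOpen_iff_mem_nhds]
  intro x hx
  have := (isCompact_Icc (a := (0 : ℝ)) (b := 1)).eventually_forall_of_forall_eventually
    (x₀ := x) (P := fun x σ => f (x, σ) ∈ K) (fun σ hσ =>
      hf.continuousAt.eventually (hK.mem_nhds (hx σ hσ)))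
  exact this

section shift

variable {d : ℕ} {K : Set (SpaceTime d)} {v : SpaceTime d} {u g : SpaceTime d → ℂ}

/-- Only the smooth factor is translated, so `f` needs nothing but integrability: one differentiates
under the integral with the dominating function `‖f‖ * C`, where `C` bounds the directional
derivative of `φ`. -/
theorem hasDerivAt_integral_translate {f : SpaceTime d → ℂ} (hf : Integrable f)
    {φ : SpaceTime d → ℝ} (hφ : ContDiff ℝ ∞ φ) (hc : HasCompactSupport φ) (v : SpaceTime d)
    (σ : ℝ) :
    HasDerivAt (fun σ : ℝ => ∫ y, f y * ((φ (y - σ • v) : ℝ) : ℂ))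
      (-∫ y, f y * ((fderiv ℝ φ (y - σ • v) v : ℝ) : ℂ)) σ := by
  have hD : Continuous (fun y => fderiv ℝ φ y v) :=
    (hφ.continuous_fderiv (by simp)).clm_apply continuous_const
  have hDc : HasCompactSupport (fun y => fderiv ℝ φ y v) := hc.fderiv_apply ℝ v
  obtain ⟨C, hC⟩ := hD.bounded_above_of_compact_support hDc
  obtain ⟨C', hC'⟩ := hφ.continuous.bounded_above_of_compact_support hc
  have hmeas : ∀ σ : ℝ, ∀ {ψ : SpaceTime d → ℝ}, Continuous ψ →
      AEStronglyMeasurable (fun y => f y * ((ψ (y - σ • v) : ℝ) : ℂ)) volume := by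
    intro σ ψ hψ
    refine hf.aestronglyMeasurable.mul (Continuous.aestronglyMeasurable ?_)
    fun_prop
  have key := hasDerivAt_integral_of_dominated_loc_of_deriv_le (μ := volume)
    (F := fun (σ : ℝ) (y : SpaceTime d) => f y * ((φ (y - σ • v) : ℝ) : ℂ))
    (F' := fun (σ : ℝ) (y : SpaceTime d) => f y * ((-(fderiv ℝ φ (y - σ • v) v) : ℝ) : ℂ))
    (x₀ := σ) (s := univ) (bound := fun y => ‖f y‖ * C) univ_mem
    (.of_forall fun σ => hmeas σ hφ.continuous)
    ?_ ?_ ?_ ?_ ?_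
  · have := key.2
    simp only [Complex.ofReal_neg, mul_neg, integral_neg] at this
    exact this
  · refine (hf.norm.mul_const C').mono' (hmeas σ hφ.continuous) (.of_forall fun y => ?_)
    rw [norm_mul, Complex.norm_real]
    gcongr
    exact hC' _
  · exact hmeas σ hD.neg
  · refine .of_forall fun y σ _ => ?_
    rw [norm_mul, Complex.norm_real, norm_neg]
    gcongr
    exact hC _
  · exact hf.norm.mul_const C
  · refine .of_forall fun y σ _ => ?_
    refine HasDerivAt.const_mul _ (HasDerivAt.ofReal_comp ?_)
    have h1 : HasDerivAt (fun σ : ℝ => y - σ • v) (-v) σ := by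
      simpa using ((hasDerivAt_id σ).smul_const v).const_sub y
    have h2 := ((hφ.differentiable (by simp)) (y - σ • v)).hasFDerivAt.comp_hasDerivAt σ h1
    have h3 : fderiv ℝ φ (y - σ • v) (-v) = -(fderiv ℝ φ (y - σ • v) v) := map_neg _ _
    rw [h3] at h2
    exact h2

theorem continuous_integral_translate {f : SpaceTime d → ℂ} (hf : Integrable f)
    {φ : SpaceTime d → ℝ} (hφ : Continuous φ) (hc : HasCompactSupport φ) (v : SpaceTime d) :
    Continuous (fun σ : ℝ => ∫ y, f y * ((φ (y - σ • v) : ℝ) : ℂ)) := by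
  obtain ⟨C, hC⟩ := hφ.bounded_above_of_compact_support hc
  refine continuous_of_dominated (bound := fun y => ‖f y‖ * C) (fun σ => ?_) (fun σ => ?_)
    (hf.norm.mul_const C) (.of_forall fun y => ?_)
  · refine hf.aestronglyMeasurable.mul (Continuous.aestronglyMeasurable ?_)
    fun_prop
  · refine .of_forall fun y => ?_
    rw [norm_mul, Complex.norm_real]
    gcongr
    exact hC _
  · fun_prop

/-- The fundamental theorem of calculus along almost every translate of a segment. -/
theorem IsWeakDeriv.ae_sub_eq_integral (hK : IsOpen K) (hu : IntegrableOn u K)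
    (hg : IntegrableOn g K) (h : IsWeakDeriv K v u g) :
    ∀ᵐ x, (∀ σ ∈ Icc (0 : ℝ) 1, x + σ • v ∈ K) →
      u (x + v) - u x = ∫ σ in (0 : ℝ)..1, g (x + σ • v) := by
  set U := K.indicator u with hU
  set G := K.indicator g with hG
  have hUi : Integrable U := hu.integrable_indicator hK.measurableSet
  have hGi : Integrable G := hg.integrable_indicator hK.measurableSet
  set K' : Set (SpaceTime d) := {x | ∀ σ ∈ Icc (0 : ℝ) 1, x + σ • v ∈ K} with hK'
  have hK'o : IsOpen K' := isOpen_segment_subset hK (f := fun p : SpaceTime d × ℝ => p.1 + p.2 • v)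
    (by fun_prop)
  set ν : Measure ℝ := volume.restrict (Ioc 0 1) with hν
  have hP : Integrable (fun p : ℝ × SpaceTime d => G (p.2 + p.1 • v)) (ν.prod volume) :=
    (measurePreserving_shear v ν).integrable_comp_of_integrable (hGi.comp_snd ν)
  have hPi : Integrable (fun x => ∫ σ in (0 : ℝ)..1, G (x + σ • v)) := by
    simp_rw [intervalIntegral.integral_of_le zero_le_one]
    exact hP.integral_prod_right
  -- Tested against `φ` supported in `K'`, the difference `U (x + v) - U x` becomes the increment
  -- over `[0, 1]` of `σ ↦ ∫ U φ(· - σ v)`. Its derivative is given by the weak derivative, and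
  -- Fubini brings the integral in `σ` inside.
  have main : ∀ᵐ x, x ∈ K' → U (x + v) - U x - ∫ σ in (0 : ℝ)..1, G (x + σ • v) = 0 := by
    refine hK'o.ae_eq_zero_of_integral_contDiff_smul_eq_zero ?_ ?_
    · exact (((hUi.comp_add_right v).sub hUi).sub hPi).locallyIntegrable.locallyIntegrableOn _
    intro φ hφ hc hs
    obtain ⟨C, hC⟩ := hφ.continuous.bounded_above_of_compact_support hc
    have hmul : ∀ {f : SpaceTime d → ℂ}, Integrable f →
        Integrable (fun x => f x * ((φ x : ℝ) : ℂ)) := fun {f} hf =>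
      hf.mul_bdd (c := C)
        (Complex.continuous_ofReal.comp hφ.continuous).aestronglyMeasurable
        (.of_forall fun x => by rw [Complex.norm_real]; exact hC x)
    have e1 : ∫ x, U (x + v) * ((φ x : ℝ) : ℂ) = ∫ y, U y * ((φ (y - (1 : ℝ) • v) : ℝ) : ℂ) := by
      rw [← integral_add_right_eq_self (fun y => U y * ((φ (y - (1 : ℝ) • v) : ℝ) : ℂ)) v]
      simp
    have e2 : ∫ x, U x * ((φ x : ℝ) : ℂ) = ∫ y, U y * ((φ (y - (0 : ℝ) • v) : ℝ) : ℂ) := by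
      simp
    have hcont := hφ.continuous
    have hderiv := hasDerivAt_integral_translate hUi hφ hc v
    have hFTC := intervalIntegral.integral_eq_sub_of_hasDerivAt (a := 0) (b := 1)
      (fun σ _ => hderiv σ)
      ((continuous_integral_translate hUi (φ := fun y => fderiv ℝ φ y v)
        ((hφ.continuous_fderiv (by simp)).clm_apply continuous_const)
        (hc.fderiv_apply ℝ v) v).neg.intervalIntegrable 0 1)
    -- For these `σ` the translated test function is still supported in `K`, by the definition of
    -- `K'`, so it is admissible in the definition of the weak derivative.
    have hweak : ∀ σ ∈ Icc (0 : ℝ) 1,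
        -∫ y, U y * ((fderiv ℝ φ (y - σ • v) v : ℝ) : ℂ)
          = ∫ x, G (x + σ • v) * ((φ x : ℝ) : ℂ) := by
      intro σ hσ
      have hw := h (fun y => φ (y - σ • v)) (hφ.comp (contDiff_id.sub contDiff_const))
        (by simp_rw [sub_eq_add_neg]
            exact hc.comp_homeomorph (Homeomorph.addRight (-(σ • v)))) ?_
      · have e3 : ∀ y, fderiv ℝ (fun y => φ (y - σ • v)) y = fderiv ℝ φ (y - σ • v) := fun y =>
          by simp_rw [sub_eq_add_neg]; exact fderiv_comp_add_right _
        simp only [e3] at hw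
        have c1 : ∫ y, U y * ((fderiv ℝ φ (y - σ • v) v : ℝ) : ℂ)
            = ∫ p in K, u p * ((fderiv ℝ φ (p - σ • v) v : ℝ) : ℂ) := by
          rw [← integral_indicator hK.measurableSet]
          congr 1; ext y
          simp only [hU, indicator]; split_ifs <;> simp
        have c2 : ∫ x, G (x + σ • v) * ((φ x : ℝ) : ℂ)
            = ∫ p in K, g p * ((φ (p - σ • v) : ℝ) : ℂ) := by
          rw [← integral_indicator hK.measurableSet,
            ← integral_add_right_eq_self (K.indicator fun p => g p * ((φ (p - σ • v) : ℝ) : ℂ)) (σ • v)]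
          congr 1; ext y
          simp only [hG, indicator]; split_ifs <;> simp
        rw [c1, c2, hw, neg_neg]
      · intro y hy
        have : y - σ • v ∈ tsupport φ := by
          have h3 := tsupport_comp_eq_preimage φ (Homeomorph.addRight (-(σ • v)))
          have h4 : (φ ∘ (Homeomorph.addRight (-(σ • v)))) = fun y => φ (y - σ • v) := by
            ext y; simp [sub_eq_add_neg]
          rw [h4] at h3
          rw [h3] at hy
          simpa [sub_eq_add_neg] using hy
        have := hs this σ hσ
        simpa using this
    have e4 : ∫ x, (∫ σ in (0 : ℝ)..1, G (x + σ • v)) * ((φ x : ℝ) : ℂ)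
        = ∫ σ in (0 : ℝ)..1, ∫ x, G (x + σ • v) * ((φ x : ℝ) : ℂ) := by
      simp_rw [intervalIntegral.integral_of_le zero_le_one]
      rw [← hν]
      simp_rw [← integral_mul_const]
      refine (integral_integral_swap (f := fun σ x => G (x + σ • v) * ((φ x : ℝ) : ℂ)) ?_).symm
      refine hP.mul_bdd (c := C) (g := fun p : ℝ × SpaceTime d => ((φ p.2 : ℝ) : ℂ))
        (Complex.continuous_ofReal.comp (hcont.comp continuous_snd)).aestronglyMeasurable
        (.of_forall fun x => by rw [Complex.norm_real]; exact hC _)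
    have e5 : ∫ σ in (0 : ℝ)..1, ∫ x, G (x + σ • v) * ((φ x : ℝ) : ℂ)
        = (∫ x, U (x + v) * ((φ x : ℝ) : ℂ)) - ∫ x, U x * ((φ x : ℝ) : ℂ) := by
      rw [e1, e2, ← hFTC]
      refine intervalIntegral.integral_congr fun σ hσ => ?_
      rw [uIcc_of_le zero_le_one] at hσ
      exact (hweak σ hσ).symm
    have e6 : ∀ x, φ x • (U (x + v) - U x - ∫ σ in (0 : ℝ)..1, G (x + σ • v))
        = (U (x + v) * ((φ x : ℝ) : ℂ) - U x * ((φ x : ℝ) : ℂ))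
          - (∫ σ in (0 : ℝ)..1, G (x + σ • v)) * ((φ x : ℝ) : ℂ) := by
      intro x
      rw [Complex.real_smul]; ring
    simp_rw [e6]
    have i1 := hmul (hUi.comp_add_right v)
    rw [integral_sub (i1.sub' (hmul hUi)) (hmul hPi), integral_sub i1 (hmul hUi), e4, e5,
      sub_self]
  filter_upwards [main] with x hx hxK
  have := hx hxK
  rw [sub_eq_zero] at this
  have h0 : x ∈ K := by simpa using hxK 0 (by simp)
  have h1 : x + v ∈ K := by simpa using hxK 1 (by simp)
  rw [hU, indicator_of_mem h0, indicator_of_mem h1] at this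
  rw [this]
  refine intervalIntegral.integral_congr fun σ hσ => ?_
  rw [uIcc_of_le zero_le_one] at hσ
  exact indicator_of_mem (hxK σ hσ) g

end shift

/-- Rescaling the direction turns the statement about unit segments into one about segments of every
length, and `τ = -1` reverses the orientation. -/
theorem IsWeakDeriv.const_smul_dir {d : ℕ} {K : Set (SpaceTime d)} {v : SpaceTime d}
    {u g : SpaceTime d → ℂ} (h : IsWeakDeriv K v u g) (τ : ℝ) :
    IsWeakDeriv K (τ • v) u (fun p => (τ : ℂ) * g p) := by
  intro φ h1 h2 h3
  have := h φ h1 h2 h3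
  simp only [map_smul, smul_eq_mul, Complex.ofReal_mul]
  have e1 : ∀ p, u p * ((τ : ℂ) * (fderiv ℝ φ p v : ℝ)) = τ * (u p * (fderiv ℝ φ p v : ℝ)) :=
    fun p => by ring
  simp_rw [e1, mul_assoc]
  rw [integral_const_mul, integral_const_mul, this]; ring

theorem IsWeakDeriv.congr_ae {d : ℕ} {K : Set (SpaceTime d)} {v : SpaceTime d}
    {u g u' g' : SpaceTime d → ℂ} (h : IsWeakDeriv K v u g)
    (hu : u' =ᵐ[volume.restrict K] u) (hg : g' =ᵐ[volume.restrict K] g) :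
    IsWeakDeriv K v u' g' := by
  intro φ h1 h2 h3
  have e1 : ∫ p in K, u' p * ((fderiv ℝ φ p v : ℝ) : ℂ) = ∫ p in K, u p * (fderiv ℝ φ p v : ℝ) :=
    integral_congr_ae (hu.mono fun p hp => by simp only [hp])
  have e2 : ∫ p in K, g' p * ((φ p : ℝ) : ℂ) = ∫ p in K, g p * (φ p : ℝ) :=
    integral_congr_ae (hg.mono fun p hp => by simp only [hp])
  rw [e1, e2]
  exact h φ h1 h2 h3

theorem intervalIntegrable_of_integrableOn_Ioo {f : ℝ → ℂ} {α β a b : ℝ}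
    (hf : IntegrableOn f (Ioo α β)) (ha : a ∈ Icc α β) (hb : b ∈ Icc α β) :
    IntervalIntegrable f volume a b := by
  rw [intervalIntegrable_iff]
  refine ((integrableOn_Icc_iff_integrableOn_Ioo).mpr hf).mono_set ?_
  exact uIoc_subset_uIcc.trans (uIcc_subset_Icc ha hb)

/-! ### Affine coordinates and restriction to almost every line. -/

section chart

variable {d : ℕ} {Y : Type*} [NormedAddCommGroup Y] [NormedSpace ℝ Y] [FiniteDimensional ℝ Y]
  [MeasureSpace Y] [BorelSpace Y] [(volume : Measure Y).IsAddHaarMeasure]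

/-- The affine coordinates `(z, s) ↦ p₀ + A (z, s)` on space--time. -/
def chart (A : (Y × ℝ) ≃L[ℝ] SpaceTime d) (p₀ : SpaceTime d) (q : Y × ℝ) : SpaceTime d := p₀ + A q

variable (A : (Y × ℝ) ≃L[ℝ] SpaceTime d) (p₀ : SpaceTime d)

/-- `chart` as a homeomorphism. -/
def chartHomeomorph : (Y × ℝ) ≃ₜ SpaceTime d := A.toHomeomorph.trans (Homeomorph.addLeft p₀)

theorem continuous_chart : Continuous (chart A p₀) := (chartHomeomorph A p₀).continuous

theorem measurableEmbedding_chart : MeasurableEmbedding (chart A p₀) :=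
  (chartHomeomorph A p₀).measurableEmbedding

theorem chart_add_right (z : Y) (s τ : ℝ) :
    chart A p₀ (z, s + τ) = chart A p₀ (z, s) + τ • A (0, 1) := by
  have : ((z, s + τ) : Y × ℝ) = (z, s) + τ • (0, 1) := by simp
  rw [chart, this, map_add, map_smul, ← add_assoc, chart]

/-- Affine coordinates multiply the volume by a positive constant. -/
theorem exists_map_chart : ∃ κ : NNReal, κ ≠ 0 ∧
    Measure.map (chart A p₀) (volume.prod volume) = κ • (volume : Measure (SpaceTime d)) := by
  have : ((volume : Measure Y).prod (volume : Measure ℝ)).IsAddHaarMeasure := inferInstance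
  have := A.isAddHaarMeasure_map ((volume : Measure Y).prod (volume : Measure ℝ))
  set μ := Measure.map A ((volume : Measure Y).prod (volume : Measure ℝ)) with hμ
  refine ⟨μ.addHaarScalarFactor volume,
    (Measure.addHaarScalarFactor_pos_of_isAddHaarMeasure μ volume).ne', ?_⟩
  have h1 : Measure.map (chart A p₀) (volume.prod volume) = Measure.map (fun x => p₀ + x) μ := by
    rw [hμ, Measure.map_map (measurable_const_add p₀) A.continuous.measurable]
    rfl
  rw [h1, map_add_left_eq_self]
  exact Measure.isAddLeftInvariant_eq_smul μ volume

theorem quasiMeasurePreserving_chart :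
    Measure.QuasiMeasurePreserving (chart A p₀) (volume.prod volume) volume := by
  obtain ⟨κ, -, hκ⟩ := exists_map_chart A p₀
  refine ⟨(continuous_chart A p₀).measurable, ?_⟩
  rw [hκ]
  exact Measure.smul_absolutelyContinuous

theorem integrable_comp_chart {f : SpaceTime d → ℂ} (hf : Integrable f) :
    Integrable (fun q => f (chart A p₀ q)) (volume.prod volume) := by
  obtain ⟨κ, -, hκ⟩ := exists_map_chart A p₀
  have : Integrable f (Measure.map (chart A p₀) (volume.prod volume)) := by
    rw [hκ]; exact hf.smul_measure_nnreal
  exact (measurableEmbedding_chart A p₀).integrable_map_iff.mp this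

variable {K : Set (SpaceTime d)} {u g : SpaceTime d → ℂ}

/-- For each fixed length the increment formula holds for almost every starting point. Exchanging
the two quantifiers needs the set of good pairs to be measurable, which is why genuinely measurable
representatives are required here. -/
theorem IsWeakDeriv.ae_ae_sub_eq_integral {v : SpaceTime d} (hK : IsOpen K)
    (hu : IntegrableOn u K) (hg : IntegrableOn g K) (h : IsWeakDeriv K v u g)
    (hum : StronglyMeasurable u) (hgm : StronglyMeasurable g) :
    ∀ᵐ x, ∀ᵐ τ : ℝ, (∀ σ ∈ Icc (0 : ℝ) 1, x + σ • τ • v ∈ K) →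
      u (x + τ • v) - u x = ∫ σ in (0 : ℝ)..1, τ * g (x + σ • τ • v) := by
  have hmeas : MeasurableSet {p : SpaceTime d × ℝ | (∀ σ ∈ Icc (0 : ℝ) 1, p.1 + σ • p.2 • v ∈ K) →
      u (p.1 + p.2 • v) - u p.1 = ∫ σ in (0 : ℝ)..1, p.2 * g (p.1 + σ • p.2 • v)} := by
    refine MeasurableSet.imp (p := fun p : SpaceTime d × ℝ =>
      ∀ σ ∈ Icc (0 : ℝ) 1, p.1 + σ • p.2 • v ∈ K) ?_ ?_
    · exact (isOpen_segment_subset hK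
        (f := fun p : (SpaceTime d × ℝ) × ℝ => p.1.1 + p.2 • p.1.2 • v) (by fun_prop)).measurableSet
    · refine measurableSet_eq_fun ?_ ?_
      · exact (hum.measurable.comp (by fun_prop)).sub (hum.measurable.comp measurable_fst)
      · simp_rw [intervalIntegral.integral_of_le zero_le_one]
        refine StronglyMeasurable.measurable ?_
        refine StronglyMeasurable.integral_prod_right'
          (f := fun q : (SpaceTime d × ℝ) × ℝ => (q.1.2 : ℂ) * g (q.1.1 + q.2 • q.1.2 • v)) ?_
        refine StronglyMeasurable.mul ?_ (hgm.comp_measurable (by fun_prop))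
        exact (Continuous.stronglyMeasurable (by fun_prop))
  rw [Measure.ae_ae_comm hmeas]
  refine .of_forall fun τ => ?_
  exact (h.const_smul_dir τ).ae_sub_eq_integral hK hu (hg.const_mul _)

/-- The exceptional set of lines is chosen before the interval: a full-measure set of starting
points is good for almost all increments, so every interval inside `K` contains a good starting
point and `u` is a primitive from there. This uniformity in `α` and `β` matters because the
intervals cut out by `K` depend on the line. -/
theorem IsWeakDeriv.ae_line (hK : IsOpen K) (hu : IntegrableOn u K) (hg : IntegrableOn g K)
    (h : IsWeakDeriv K (A (0, 1)) u g) :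
    ∀ᵐ z : Y, Integrable (fun s => K.indicator u (chart A p₀ (z, s))) ∧
      Integrable (fun s => K.indicator g (chart A p₀ (z, s))) ∧
      ∀ α β, α < β → (∀ s ∈ Ioo α β, chart A p₀ (z, s) ∈ K) →
        ∃ c, ∀ᵐ s, s ∈ Ioo α β →
          u (chart A p₀ (z, s)) = c + ∫ σ in α..s, g (chart A p₀ (z, σ)) := by
  set v := A (0, 1) with hv
  have hUi := hu.integrable_indicator hK.measurableSet
  have hGi := hg.integrable_indicator hK.measurableSet
  -- Measurable representatives are needed only for the exchange of quantifiers; the conclusion is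
  -- transferred back to `u` and `g` along almost every line.
  obtain ⟨u0, hu0m, hu0⟩ := hUi.aestronglyMeasurable
  obtain ⟨g0, hg0m, hg0⟩ := hGi.aestronglyMeasurable
  have aux : ∀ {f f0 : SpaceTime d → ℂ}, K.indicator f =ᵐ[volume] f0 →
      ∀ᵐ x, x ∈ K → f0 x = f x := fun {f f0} hf => by
    filter_upwards [hf] with x hx hxK
    rw [← hx, indicator_of_mem hxK]
  have hu0' := aux hu0
  have hg0' := aux hg0
  have hu0r : u0 =ᵐ[volume.restrict K] u := (ae_restrict_iff' hK.measurableSet).mpr hu0'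
  have hg0r : g0 =ᵐ[volume.restrict K] g := (ae_restrict_iff' hK.measurableSet).mpr hg0'
  have key := (h.congr_ae hu0r hg0r).ae_ae_sub_eq_integral hK (hu.congr_fun_ae hu0r.symm)
    (hg.congr_fun_ae hg0r.symm) hu0m hg0m
  have hq := quasiMeasurePreserving_chart A p₀
  filter_upwards [Measure.ae_ae_of_ae_prod (hq.ae key), Measure.ae_ae_of_ae_prod (hq.ae hu0'),
    Measure.ae_ae_of_ae_prod (hq.ae hg0'), (integrable_comp_chart A p₀ hUi).prod_right_ae,
    (integrable_comp_chart A p₀ hGi).prod_right_ae] with z hz hzu hzg hiu hig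
  refine ⟨hiu, hig, fun α β hαβ hin => ?_⟩
  obtain ⟨s0, hs0, hs0good⟩ := (Measure.dense_of_ae hz).exists_mem_open isOpen_Ioo
    (nonempty_Ioo.mpr hαβ)
  have hgint : ∀ a b, a ∈ Icc α β → b ∈ Icc α β →
      IntervalIntegrable (fun σ => g (chart A p₀ (z, σ))) volume a b := by
    intro a b ha hb
    refine intervalIntegrable_of_integrableOn_Ioo ?_ ha hb
    refine (hig.integrableOn (s := Ioo α β)).congr_fun (fun s hs => ?_) measurableSet_Ioo
    exact indicator_of_mem (hin s hs) g
  refine ⟨u0 (chart A p₀ (z, s0)) - ∫ σ in α..s0, g (chart A p₀ (z, σ)), ?_⟩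
  have hshift := (measurePreserving_sub_right volume s0).quasiMeasurePreserving.ae hs0
  filter_upwards [hshift, hzu] with s hs hsu hsI
  have hmem : ∀ σ ∈ Icc (0 : ℝ) 1, chart A p₀ (z, s0) + σ • (s - s0) • v ∈ K := by
    intro σ hσ
    rw [smul_smul, hv, ← chart_add_right]
    apply hin
    have := (convex_Ioo α β).add_smul_sub_mem hs0good hsI hσ
    simpa using this
  have e1 := hs hmem
  have e2 : chart A p₀ (z, s0) + (s - s0) • v = chart A p₀ (z, s) := by
    rw [hv, ← chart_add_right]; simp
  rw [e2, hsu (hin s hsI)] at e1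
  have e3 : ∫ σ in (0 : ℝ)..1, ((s - s0 : ℝ) : ℂ) * g0 (chart A p₀ (z, s0) + σ • (s - s0) • v)
      = ∫ σ in s0..s, g0 (chart A p₀ (z, σ)) := by
    have := intervalIntegral.smul_integral_comp_add_mul (a := 0) (b := 1)
      (fun σ => g0 (chart A p₀ (z, σ))) (s - s0) s0
    simp only [mul_zero, add_zero, mul_one, add_sub_cancel] at this
    rw [← this, intervalIntegral.integral_const_mul, Complex.real_smul]
    congr 2
    ext σ
    rw [smul_smul, hv, ← chart_add_right, mul_comm]
  have e4 : ∫ σ in s0..s, g0 (chart A p₀ (z, σ)) = ∫ σ in s0..s, g (chart A p₀ (z, σ)) := by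
    refine intervalIntegral.integral_congr_ae ?_
    filter_upwards [hzg] with σ hσ hσI
    refine hσ (hin σ ?_)
    rcases le_total s0 s with hle | hle
    · rw [uIoc_of_le hle] at hσI
      exact ⟨hs0good.1.trans hσI.1, hσI.2.trans_lt hsI.2⟩
    · rw [uIoc_of_ge hle] at hσI
      exact ⟨hsI.1.trans hσI.1, hσI.2.trans_lt hs0good.2⟩
  rw [e3, e4] at e1
  have e5 := intervalIntegral.integral_add_adjacent_intervals
    (hgint α s0 ⟨le_rfl, hαβ.le⟩ (Ioo_subset_Icc_self hs0good))
    (hgint s0 s (Ioo_subset_Icc_self hs0good) (Ioo_subset_Icc_self hsI))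
  rw [← e5, ← e1]; ring

end chart

/-- Integration by parts for primitives of integrable functions. -/
theorem integral_primitive_mul_add_mul_primitive {f k : ℝ → ℂ} {a b : ℝ} (hab : a ≤ b)
    (hf : IntervalIntegrable f volume a b) (hk : IntervalIntegrable k volume a b) :
    (∫ s in a..b, (∫ σ in a..s, f σ) * k s) + ∫ s in a..b, f s * ∫ σ in a..s, k σ
      = (∫ s in a..b, f s) * ∫ s in a..b, k s := by
  set μ : Measure ℝ := volume.restrict (Ioc a b) with hμ
  have hf' : Integrable f μ := (intervalIntegrable_iff_integrableOn_Ioc_of_le hab).mp hf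
  have hk' : Integrable k μ := (intervalIntegrable_iff_integrableOn_Ioc_of_le hab).mp hk
  have hP : Integrable (fun p : ℝ × ℝ => f p.1 * k p.2) (μ.prod μ) := hf'.mul_prod hk'
  have hS : MeasurableSet {p : ℝ × ℝ | p.1 ≤ p.2} := measurableSet_le measurable_fst measurable_snd
  -- The square is cut along its diagonal: Fubini on each of the two triangles gives one of the two
  -- integrals, and the whole square gives the product.
  have hsplit := integral_add_compl hS hP
  have htot : ∫ p, f p.1 * k p.2 ∂(μ.prod μ) = (∫ s, f s ∂μ) * ∫ s, k s ∂μ := integral_prod_mul f k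
  have h1 : ∫ p in {p : ℝ × ℝ | p.1 ≤ p.2}, f p.1 * k p.2 ∂(μ.prod μ)
      = ∫ s, (∫ σ in a..s, f σ) * k s ∂μ := by
    rw [← integral_indicator hS, integral_prod_symm _ (hP.indicator hS)]
    refine setIntegral_congr_fun measurableSet_Ioc fun s hs => ?_
    have : ∀ σ, {p : ℝ × ℝ | p.1 ≤ p.2}.indicator (fun p => f p.1 * k p.2) (σ, s)
        = (Iic s).indicator f σ * k s := by
      intro σ
      by_cases h : σ ≤ s <;> simp [indicator, h]
    simp_rw [this]
    rw [integral_mul_const, integral_indicator measurableSet_Iic, hμ,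
      Measure.restrict_restrict measurableSet_Iic, intervalIntegral.integral_of_le hs.1.le]
    congr 3
    ext σ
    simp only [mem_inter_iff, mem_Iic, mem_Ioc]
    exact ⟨fun h => ⟨h.2.1, h.1⟩, fun h => ⟨h.2, h.1, h.2.trans hs.2⟩⟩
  have h2 : ∫ p in {p : ℝ × ℝ | p.1 ≤ p.2}ᶜ, f p.1 * k p.2 ∂(μ.prod μ)
      = ∫ s, f s * (∫ σ in a..s, k σ) ∂μ := by
    rw [← integral_indicator hS.compl, integral_prod _ (hP.indicator hS.compl)]
    refine setIntegral_congr_fun measurableSet_Ioc fun s hs => ?_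
    have : ∀ σ, ({p : ℝ × ℝ | p.1 ≤ p.2}ᶜ).indicator (fun p => f p.1 * k p.2) (s, σ)
        = f s * (Iio s).indicator k σ := by
      intro σ
      by_cases h : σ < s <;> simp [indicator, h]
    simp_rw [this]
    rw [integral_const_mul, integral_indicator measurableSet_Iio, hμ,
      Measure.restrict_restrict measurableSet_Iio, intervalIntegral.integral_of_le hs.1.le,
      integral_Ioc_eq_integral_Ioo]
    congr 3
    ext σ
    simp only [mem_inter_iff, mem_Iio, mem_Ioc, mem_Ioo]
    exact ⟨fun h => ⟨h.2.1, h.1⟩, fun h => ⟨h.2, h.1, h.2.le.trans hs.2⟩⟩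
  simp_rw [intervalIntegral.integral_of_le hab]
  rw [← hμ, ← h1, ← h2, hsplit, htot]

/-- The value at the left end point of a primitive, as an integral over the interval. -/
theorem eq_integral_of_eq_add_primitive {u g : ℝ → ℂ} {c : ℂ} {ℓ : ℝ} (hℓ : 0 < ℓ)
    (hg : IntervalIntegrable g volume 0 ℓ)
    (h : ∀ᵐ s, s ∈ Ioo 0 ℓ → u s = c + ∫ σ in (0 : ℝ)..s, g σ) :
    c = ∫ s in (0 : ℝ)..ℓ, ((ℓ⁻¹ : ℝ) : ℂ) * u s - ((1 - s / ℓ : ℝ) : ℂ) * g s := by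
  have hℓ' : (ℓ : ℂ) ≠ 0 := by exact_mod_cast hℓ.ne'
  -- Taking the constant `1` as second factor evaluates the integral of the primitive as that of `(ℓ
  -- - s) g s`, which explains the weight `1 - s / ℓ`.
  have hbp := integral_primitive_mul_add_mul_primitive hℓ.le hg
    (k := fun _ => (1 : ℂ)) intervalIntegrable_const
  simp only [mul_one, intervalIntegral.integral_const, sub_zero] at hbp
  have hprim : IntervalIntegrable (fun s => ∫ σ in (0 : ℝ)..s, g σ) volume 0 ℓ :=
    (intervalIntegral.continuousOn_primitive_interval' hg left_mem_uIcc).intervalIntegrable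
  have hgs : IntervalIntegrable (fun s => g s * (s : ℂ)) volume 0 ℓ :=
    hg.mul_continuousOn (Complex.continuous_ofReal.continuousOn)
  have e1 : ∫ s in (0 : ℝ)..ℓ, ((ℓ⁻¹ : ℝ) : ℂ) * u s - ((1 - s / ℓ : ℝ) : ℂ) * g s
      = ∫ s in (0 : ℝ)..ℓ, ((ℓ⁻¹ : ℝ) : ℂ) *
        (c + ((∫ σ in (0 : ℝ)..s, g σ) + g s * (s : ℂ) - (ℓ : ℂ) * g s)) := by
    refine intervalIntegral.integral_congr_ae' ?_ (.of_forall fun s hs => ?_)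
    · have : ∀ᵐ s : ℝ, s ≠ ℓ := by simp [ae_iff]
      filter_upwards [h, this] with s hs hne hsI
      rw [hs ⟨hsI.1, lt_of_le_of_ne hsI.2 hne⟩]
      push_cast
      field_simp
      ring
    · exact absurd (hs.1.trans_le hs.2) hℓ.le.not_gt
  rw [e1, intervalIntegral.integral_const_mul,
    intervalIntegral.integral_add intervalIntegrable_const ((hprim.add hgs).sub (hg.const_mul _)),
    intervalIntegral.integral_sub (hprim.add hgs) (hg.const_mul _),
    intervalIntegral.integral_add hprim hgs, intervalIntegral.integral_const,
    intervalIntegral.integral_const_mul]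
  have e2 : ∀ s : ℝ, s • (1 : ℂ) = s := fun s => by simp
  simp only [e2] at hbp
  rw [hbp]
  simp only [sub_zero, Complex.real_smul, Complex.ofReal_inv]
  field_simp
  ring

/-! ### Existence of the trace as a limit of mean values. -/

section ballMean

variable {d : ℕ} {Y : Type*} [NormedAddCommGroup Y] [NormedSpace ℝ Y] [FiniteDimensional ℝ Y]
  [MeasureSpace Y] [BorelSpace Y] [(volume : Measure Y).IsAddHaarMeasure]
  (A : (Y × ℝ) ≃L[ℝ] SpaceTime d) (p₀ : SpaceTime d) {K : Set (SpaceTime d)}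
  {u g : SpaceTime d → ℂ}

theorem exists_norm_bounds :
    ∃ C : ℝ, 1 ≤ C ∧ ∀ q, ‖A q‖ ≤ C * ‖q‖ ∧ ‖q‖ ≤ C * ‖A q‖ := by
  obtain ⟨C₁, -, h₁⟩ := A.toContinuousLinearMap.isBoundedLinearMap.bound
  obtain ⟨C₂, -, h₂⟩ := A.symm.toContinuousLinearMap.isBoundedLinearMap.bound
  refine ⟨max 1 (max C₁ C₂), le_max_left _ _, fun q => ⟨(h₁ q).trans ?_, ?_⟩⟩
  · gcongr; exact (le_max_left _ _).trans (le_max_right _ _)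
  · have := h₂ (A q)
    simp only [ContinuousLinearEquiv.coe_coe, ContinuousLinearEquiv.symm_apply_apply] at this
    refine this.trans ?_
    gcongr; exact (le_max_right _ _).trans (le_max_right _ _)

theorem setIntegral_comp_chart {F : Type*} [NormedAddCommGroup F] [NormedSpace ℝ F] {κ : NNReal}
    (hκ : Measure.map (chart A p₀) (volume.prod volume) = κ • (volume : Measure (SpaceTime d)))
    (f : SpaceTime d → F) (S : Set (SpaceTime d)) :
    ∫ q in chart A p₀ ⁻¹' S, f (chart A p₀ q) ∂(volume.prod volume) = (κ : ℝ) • ∫ x in S, f x := by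
  rw [← (measurableEmbedding_chart A p₀).setIntegral_map, hκ, Measure.restrict_smul,
    integral_smul_nnreal_measure]
  rfl

/-- The constant `κ` by which the chart scales volume cancels in an average, so its value is never
needed. -/
theorem setAverage_comp_chart {F : Type*} [NormedAddCommGroup F] [NormedSpace ℝ F]
    (f : SpaceTime d → F) (S : Set (SpaceTime d)) :
    ⨍ q in chart A p₀ ⁻¹' S, f (chart A p₀ q) ∂(volume.prod volume) = ⨍ x in S, f x := by
  obtain ⟨κ, hκ0, hκ⟩ := exists_map_chart A p₀
  have hκ0' : (κ : ℝ) ≠ 0 := by exact_mod_cast hκ0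
  have hm : (volume.prod volume : Measure (Y × ℝ)).real (chart A p₀ ⁻¹' S)
      = κ * (volume : Measure (SpaceTime d)).real S := by
    rw [measureReal_def, ← (measurableEmbedding_chart A p₀).map_apply, hκ]
    rw [Measure.smul_apply, ENNReal.toReal_smul]
    rfl
  rw [setAverage_eq, setAverage_eq, setIntegral_comp_chart A p₀ hκ, hm, smul_smul]
  congr 1
  by_cases h : (volume : Measure (SpaceTime d)).real S = 0
  · simp [h]
  · field_simp

/-- A set comparable to a cylinder: its averages are controlled by those over the cylinder. -/
theorem setAverage_le_of_cylinder {C r : ℝ} (hC : 1 ≤ C) (hr : 0 < r) {z : Y} {S : Set (Y × ℝ)}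
    (hS : Metric.ball z (r / C) ×ˢ Ioo 0 (r / C) ⊆ S)
    (hS' : S ⊆ Metric.closedBall z (C * r) ×ˢ Ioo 0 (C * r)) {f : Y × ℝ → ℝ} (hf0 : ∀ q, 0 ≤ f q)
    (hf : IntegrableOn f (Metric.closedBall z (C * r) ×ˢ Ioo 0 (C * r)) (volume.prod volume)) :
    ⨍ q in S, f q ∂(volume.prod volume) ≤ C ^ 2 * (C ^ 2) ^ Module.finrank ℝ Y *
      ((C * r)⁻¹ * ⨍ y in Metric.closedBall z (C * r), ∫ s in Ioo 0 (C * r), f (y, s)) := by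
  set m := Module.finrank ℝ Y
  have hC0 : 0 < C := by linarith
  set b : ℝ := (volume : Measure Y).real (Metric.ball 0 1) with hb
  have hb0 : 0 < b := by
    rw [hb, measureReal_def]
    exact ENNReal.toReal_pos (Metric.measure_ball_pos _ _ one_pos).ne' measure_ball_lt_top.ne
  have m1 : (volume : Measure Y).real (Metric.closedBall z (C * r)) = (C * r) ^ m * b := by
    rw [measureReal_def, Measure.addHaar_closedBall _ _ (by positivity), ENNReal.toReal_mul,
      ENNReal.toReal_ofReal (by positivity)]; rfl
  have m2 : (volume : Measure Y).real (Metric.ball z (r / C)) = (r / C) ^ m * b := by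
    rw [measureReal_def, Measure.addHaar_ball_of_pos _ _ (by positivity), ENNReal.toReal_mul,
      ENNReal.toReal_ofReal (by positivity)]; rfl
  have m3 : (r / C) ^ m * b * (r / C) ≤ (volume.prod volume : Measure (Y × ℝ)).real S := by
    have : (volume.prod volume : Measure (Y × ℝ)).real (Metric.ball z (r / C) ×ˢ Ioo 0 (r / C))
        = (r / C) ^ m * b * (r / C) := by
      rw [measureReal_prod_prod, m2, Real.volume_real_Ioo_of_le (by positivity), sub_zero]
    rw [← this]
    refine measureReal_mono hS (ne_top_of_le_ne_top ?_ (measure_mono hS'))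
    rw [Measure.prod_prod]
    exact ENNReal.mul_ne_top (measure_closedBall_lt_top.ne) (by simp)
  have i1 : ∫ q in S, f q ∂(volume.prod volume)
      ≤ ∫ q in Metric.closedBall z (C * r) ×ˢ Ioo 0 (C * r), f q ∂(volume.prod volume) :=
    setIntegral_mono_set hf (.of_forall hf0) (LE.le.eventuallyLE hS')
  rw [setIntegral_prod _ hf] at i1
  rw [setAverage_eq, setAverage_eq, m1, smul_eq_mul, smul_eq_mul]
  set J := ∫ y in Metric.closedBall z (C * r), ∫ s in Ioo 0 (C * r), f (y, s) with hJ
  have hJ0 : 0 ≤ J := setIntegral_nonneg measurableSet_closedBall fun y _ =>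
    integral_nonneg fun s => hf0 _
  have hpos : 0 < (r / C) ^ m * b * (r / C) := by positivity
  calc ((volume.prod volume : Measure (Y × ℝ)).real S)⁻¹ * ∫ q in S, f q ∂(volume.prod volume)
      ≤ ((r / C) ^ m * b * (r / C))⁻¹ * J := by
        gcongr
        exact integral_nonneg fun q => hf0 q
    _ = _ := by
      -- The inner and outer cylinders have radii in ratio `C ^ 2`; their volume ratio is the
      -- constant in the statement, independent of `r`.
      have e : (C * r) ^ m = (C ^ 2) ^ m * (r / C) ^ m := by
        rw [← mul_pow]; congr 1; field_simp
      rw [e]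
      have h1 : (r / C) ^ m ≠ 0 := by positivity
      have h2 : (C ^ 2) ^ m ≠ 0 := by positivity
      field_simp

/-- The boundary of `K` is flat near `chart (z, 0)`, with `K` on the side of the positive `s`. -/
def IsRegularPoint (K : Set (SpaceTime d)) (z : Y) : Prop :=
  ∃ D ∈ 𝓝 z, ∃ ℓ > 0, (∀ y ∈ D, ∀ s ∈ Ioo (0 : ℝ) ℓ, chart A p₀ (y, s) ∈ K) ∧
    ∀ y ∈ D, ∀ s ∈ Ioc (-ℓ) 0, chart A p₀ (y, s) ∉ K

/-- `c` is the boundary value at `s = 0` of `u` along the line `s ↦ chart (z, s)`, where `g` is the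
derivative of `u` along the line. -/
def HasLineTrace (K : Set (SpaceTime d)) (u g : SpaceTime d → ℂ) (z : Y) (c : ℂ) : Prop :=
  ∀ β > 0, (∀ s ∈ Ioo 0 β, chart A p₀ (z, s) ∈ K) → ∀ᵐ s, s ∈ Ioo 0 β →
    u (chart A p₀ (z, s)) = c + ∫ σ in (0 : ℝ)..s, g (chart A p₀ (z, σ))

/-- Two primitives of the same function that agree at one common point have the same constant, so a
boundary value found on one short segment serves every longer one. -/
theorem hasLineTrace_of_Ioo {z : Y} {c : ℂ} {ℓ : ℝ} (hℓ : 0 < ℓ)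
    (hz : ∀ α β, α < β → (∀ s ∈ Ioo α β, chart A p₀ (z, s) ∈ K) →
        ∃ c, ∀ᵐ s, s ∈ Ioo α β →
          u (chart A p₀ (z, s)) = c + ∫ σ in α..s, g (chart A p₀ (z, σ)))
    (hc : ∀ᵐ s, s ∈ Ioo 0 ℓ →
      u (chart A p₀ (z, s)) = c + ∫ σ in (0 : ℝ)..s, g (chart A p₀ (z, σ))) :
    HasLineTrace A p₀ K u g z c := by
  intro β hβ hin
  obtain ⟨c', hc'⟩ := hz 0 β hβ hin
  obtain ⟨s, ⟨hs1, hs2⟩, hs⟩ := (Measure.dense_of_ae (hc.and hc')).exists_mem_open isOpen_Ioo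
    (nonempty_Ioo.mpr (lt_min hβ hℓ))
  have e : c = c' := by
    have h1 := hs1 ⟨hs.1, hs.2.trans_le (min_le_right _ _)⟩
    rw [hs2 ⟨hs.1, hs.2.trans_le (min_le_left _ _)⟩] at h1
    exact (add_right_cancel h1).symm
  rw [e]; exact hc'

theorem ae_closedBall_average {F : Type*} [NormedAddCommGroup F] {f : Y → F}
    (hf : Integrable f) {C : ℝ} (hC : 0 < C) : ∀ᵐ z : Y,
      Tendsto (fun r => ⨍ y in Metric.closedBall z (C * r), ‖f y - f z‖) (𝓝[>] 0) (𝓝 0) := by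
  filter_upwards [IsUnifLocDoublingMeasure.ae_tendsto_average_norm_sub (volume : Measure Y)
    hf.locallyIntegrable 1] with z hz
  refine hz (fun _ => z) (fun r => C * r) ?_ ?_
  · refine tendsto_nhdsWithin_iff.mpr ⟨?_, ?_⟩
    · exact (by simpa using (continuous_const_mul C).tendsto (0 : ℝ) :
        Tendsto (fun r => C * r) (𝓝 0) (𝓝 0)).mono_left nhdsWithin_le_nhds
    · filter_upwards [self_mem_nhdsWithin] with r hr using mul_pos hC hr
  · filter_upwards [self_mem_nhdsWithin] with r hr
    have : 0 < C * r := mul_pos hC hr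
    simp [this.le]

theorem integrable_prod_restrict {F : Type*} [NormedAddCommGroup F] {f : Y × ℝ → F}
    (hf : Integrable f (volume.prod volume)) (I : Set ℝ) :
    Integrable f ((volume : Measure Y).prod (volume.restrict I)) := by
  have : (volume : Measure Y).prod (volume.restrict I)
      = (volume.prod volume).restrict (univ ×ˢ I) := by
    rw [← Measure.prod_restrict, Measure.restrict_univ]
  rw [this]
  exact hf.restrict

theorem norm_setAverage_sub_le {X : Type*} [MeasurableSpace X] {μ : Measure X} {S : Set X}
    {f : X → ℂ} (hf : IntegrableOn f S μ) (hS0 : μ S ≠ 0) (hS : μ S ≠ ⊤) (c : ℂ) :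
    ‖(⨍ x in S, f x ∂μ) - c‖ ≤ ⨍ x in S, ‖f x - c‖ ∂μ := by
  have h0 : μ.real S ≠ 0 := (ENNReal.toReal_pos hS0 hS).ne'
  have e : (⨍ x in S, f x ∂μ) - c = ⨍ x in S, (f x - c) ∂μ := by
    rw [setAverage_eq, setAverage_eq, integral_sub hf (integrableOn_const hS), setIntegral_const,
      smul_sub, smul_smul, inv_mul_cancel₀ h0, one_smul]
  rw [e, setAverage_eq, setAverage_eq, norm_smul, norm_inv, Real.norm_of_nonneg measureReal_nonneg,
    smul_eq_mul]
  gcongr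
  exact norm_integral_le_integral_norm _

theorem dist_chart (q q' : Y × ℝ) : dist (chart A p₀ q) (chart A p₀ q') = ‖A (q - q')‖ := by
  rw [dist_eq_norm, chart, chart, map_sub, add_sub_add_left_eq_sub]

/-- The candidate `c z` is the boundary value along the line, written as an integral over a segment
and hence integrable in `z`. On a nearby line, `|u - c z|` is at most `|c y - c z|` plus the
variation `V n y` of `u` close to the boundary. Averaging, the first term vanishes at Lebesgue
points of `c`, and the second tends to `V n z` at Lebesgue points of `V n`, which is small for large
`n`. -/
theorem ae_hasLineTrace_of_nhds (hK : IsOpen K) (hu : IntegrableOn u K) (hg : IntegrableOn g K)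
    (h : IsWeakDeriv K (A (0, 1)) u g) {D : Set Y} (hD : IsOpen D) {ℓ : ℝ} (hℓ : 0 < ℓ)
    (hin : ∀ y ∈ D, ∀ s ∈ Ioo (0 : ℝ) ℓ, chart A p₀ (y, s) ∈ K)
    (hout : ∀ y ∈ D, ∀ s ∈ Ioc (-ℓ) 0, chart A p₀ (y, s) ∉ K) :
    ∀ᵐ z, z ∈ D → ∃ c, Tendsto (ballMean K u (chart A p₀ (z, 0))) (𝓝[>] 0) (𝓝 c) ∧
      HasLineTrace A p₀ K u g z c := by
  have hUi := hu.integrable_indicator hK.measurableSet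
  have hGi := hg.integrable_indicator hK.measurableSet
  set U := K.indicator u with hU
  set G := K.indicator g with hG
  have hUc := integrable_comp_chart A p₀ hUi
  have hGc := integrable_comp_chart A p₀ hGi
  obtain ⟨C, hC, hAC⟩ := exists_norm_bounds A
  have hC0 : 0 < C := by linarith
  have hline := h.ae_line A p₀ hK hu hg
  -- the trace, as an integral over the line
  set c : Y → ℂ := fun z => ∫ s in Ioc 0 ℓ, ((ℓ⁻¹ : ℝ) : ℂ) * U (chart A p₀ (z, s))
    - ((1 - s / ℓ : ℝ) : ℂ) * G (chart A p₀ (z, s)) with hcdef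
  have hcint : Integrable c := by
    refine Integrable.integral_prod_left (μ := volume) (ν := volume.restrict (Ioc 0 ℓ))
      (f := fun q : Y × ℝ => ((ℓ⁻¹ : ℝ) : ℂ) * U (chart A p₀ q)
        - ((1 - q.2 / ℓ : ℝ) : ℂ) * G (chart A p₀ q)) ?_
    refine ((integrable_prod_restrict hUc _).const_mul _).sub ?_
    refine (integrable_prod_restrict hGc _).bdd_mul (c := 1)
      (Continuous.aestronglyMeasurable (by fun_prop)) ?_
    have hsnd : Measure.QuasiMeasurePreserving Prod.snd
      ((volume : Measure Y).prod (volume.restrict (Ioc 0 ℓ))) (volume.restrict (Ioc 0 ℓ)) :=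
      Measure.quasiMeasurePreserving_snd
    filter_upwards [hsnd.ae (ae_restrict_mem measurableSet_Ioc)] with q hq
    rw [Complex.norm_real, Real.norm_eq_abs, abs_le]
    have h1 : 0 < q.2 / ℓ := div_pos hq.1 hℓ
    have h2 : q.2 / ℓ ≤ 1 := (div_le_one hℓ).mpr hq.2
    constructor <;> linarith
  have hline' : ∀ᵐ z, z ∈ D → ∀ᵐ s, s ∈ Ioo 0 ℓ →
      u (chart A p₀ (z, s)) = c z + ∫ σ in (0 : ℝ)..s, g (chart A p₀ (z, σ)) := by
    filter_upwards [hline] with z ⟨hz1, hz2, hz3⟩ hzD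
    obtain ⟨c', hc'⟩ := hz3 0 ℓ hℓ (hin z hzD)
    have hgi : IntervalIntegrable (fun s => g (chart A p₀ (z, s))) volume 0 ℓ := by
      refine intervalIntegrable_of_integrableOn_Ioo (α := 0) (β := ℓ) ?_ ⟨le_rfl, hℓ.le⟩
        ⟨hℓ.le, le_rfl⟩
      refine (hz2.integrableOn (s := Ioo 0 ℓ)).congr_fun (fun s hs => ?_) measurableSet_Ioo
      exact indicator_of_mem (hin z hzD s hs) g
    have e := eq_integral_of_eq_add_primitive hℓ hgi hc'
    have : c z = c' := by
      rw [e, intervalIntegral.integral_of_le hℓ.le, integral_Ioc_eq_integral_Ioo]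
      change ∫ s in Ioc 0 ℓ, _ = _
      rw [integral_Ioc_eq_integral_Ioo]
      refine setIntegral_congr_fun measurableSet_Ioo fun s hs => ?_
      simp only [hU, hG, indicator_of_mem (hin z hzD s hs)]
    rw [this]; exact hc'
  -- the variation along the line
  set V : ℕ → Y → ℝ := fun n z => ∫ s in Ioc (0 : ℝ) (1 / (n + 1)), ‖G (chart A p₀ (z, s))‖
    with hV
  have hVint : ∀ n, Integrable (V n) := by
    intro n
    exact (integrable_prod_restrict hGc _).norm.integral_prod_left
  have hVavg : ∀ᵐ z, ∀ n, Tendsto (fun r => ⨍ y in Metric.closedBall z (C * r), ‖V n y - V n z‖)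
      (𝓝[>] 0) (𝓝 0) := ae_all_iff.mpr fun n => ae_closedBall_average (hVint n) hC0
  filter_upwards [hline', hline, ae_closedBall_average hcint hC0, hVavg]
    with z hz hzl hzc hzV hzD
  refine ⟨c z, ?_, hasLineTrace_of_Ioo A p₀ hℓ hzl.2.2 (hz hzD)⟩
  -- This is the continuity at `0` of the primitive of the integrable function `‖G‖` on the fixed
  -- line.
  have hV0 : Tendsto (fun n => V n z) atTop (𝓝 0) := by
    have h1 := (intervalIntegral.continuous_primitive
      (fun a b => (hzl.2.1.norm.intervalIntegrable (a := a) (b := b))) 0).tendsto 0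
    rw [intervalIntegral.integral_same] at h1
    refine (h1.comp tendsto_one_div_add_atTop_nhds_zero_nat).congr fun n => ?_
    rw [Function.comp_apply, intervalIntegral.integral_of_le (by positivity)]
  set m := Module.finrank ℝ Y
  set M : ℝ := C ^ 2 * (C ^ 2) ^ m with hM
  have hM0 : 0 < M := by positivity
  obtain ⟨ρ, hρ, hρD⟩ := Metric.isOpen_iff.mp hD z hzD
  have bound : ∀ n : ℕ, ∀ᶠ r in 𝓝[>] (0 : ℝ), ‖ballMean K u (chart A p₀ (z, 0)) r - c z‖
      ≤ M * ((⨍ y in Metric.closedBall z (C * r), ‖c y - c z‖)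
        + (⨍ y in Metric.closedBall z (C * r), ‖V n y - V n z‖) + V n z) := by
    intro n
    have hsmall : ∀ᶠ r in 𝓝[>] (0 : ℝ), C * r < min ρ (min ℓ (1 / (n + 1))) := by
      have : Tendsto (fun r : ℝ => C * r) (𝓝[>] 0) (𝓝 0) :=
        (by simpa using (continuous_const_mul C).tendsto (0 : ℝ) :
          Tendsto (fun r => C * r) (𝓝 0) (𝓝 0)).mono_left nhdsWithin_le_nhds
      exact (tendsto_order.1 this).2 _ (by positivity)
    filter_upwards [hsmall, self_mem_nhdsWithin] with r hr (hr0 : 0 < r)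
    have hrρ : C * r < ρ := hr.trans_le (min_le_left _ _)
    have hrℓ : C * r < ℓ := hr.trans_le ((min_le_right _ _).trans (min_le_left _ _))
    have hrn : C * r < 1 / (n + 1) := hr.trans_le ((min_le_right _ _).trans (min_le_right _ _))
    have hCr : 0 < C * r := by positivity
    have hrC : r / C ≤ C * r :=
      (div_le_self hr0.le hC).trans (le_mul_of_one_le_left hr0.le hC)
    have hballD : Metric.closedBall z (C * r) ⊆ D :=
      (Metric.closedBall_subset_ball hrρ).trans hρD
    set S := K ∩ Metric.ball (chart A p₀ (z, 0)) r with hS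
    -- In the chart, `K ∩ B(p, r)` lies between two cylinders whose sizes are comparable to `r`, by
    -- the bi-Lipschitz constant `C`. Points with `s ≤ 0` are excluded by `hout`, so only the upper
    -- halves occur.
    have hcyl1 : Metric.ball z (r / C) ×ˢ Ioo 0 (r / C) ⊆ chart A p₀ ⁻¹' S := by
      rintro ⟨y, s⟩ ⟨hy, hs⟩
      have hy' : dist y z < r / C := hy
      refine ⟨hin y (hballD (hy'.le.trans hrC)) s ⟨hs.1, hs.2.trans_le (hrC.trans hrℓ.le)⟩, ?_⟩
      rw [Metric.mem_ball, dist_chart]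
      refine (hAC _).1.trans_lt ?_
      rw [← lt_div_iff₀' hC0, Prod.norm_def]
      refine max_lt ?_ ?_
      · simpa [dist_eq_norm] using hy'
      · simpa [abs_of_pos hs.1] using hs.2
    have hcyl2 : chart A p₀ ⁻¹' S ⊆ Metric.closedBall z (C * r) ×ˢ Ioo 0 (C * r) := by
      rintro ⟨y, s⟩ ⟨hyK, hyB⟩
      rw [Metric.mem_ball, dist_chart] at hyB
      have h1 := (hAC ((y, s) - (z, 0))).2.trans_lt (mul_lt_mul_of_pos_left hyB hC0)
      rw [Prod.norm_def, max_lt_iff] at h1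
      simp only [Prod.fst_sub, Prod.snd_sub, sub_zero, Real.norm_eq_abs, abs_lt] at h1
      have hy : y ∈ Metric.closedBall z (C * r) := by
        rw [Metric.mem_closedBall, dist_eq_norm]; exact h1.1.le
      refine ⟨hy, ?_, h1.2.2⟩
      by_contra hs
      exact hout y (hballD hy) s ⟨by linarith, not_lt.mp hs⟩ hyK
    have hSne : S.Nonempty := ⟨chart A p₀ (z, r / C / 2), hcyl1 ⟨Metric.mem_ball_self (by positivity),
      by simp only [mem_Ioo]; constructor; positivity; exact half_lt_self (by positivity)⟩⟩
    have hSpos : volume S ≠ 0 := ((hK.inter Metric.isOpen_ball).measure_pos volume hSne).ne'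
    have hSfin : volume S ≠ ⊤ := ne_top_of_le_ne_top (measure_ball_lt_top.ne)
      (measure_mono inter_subset_right)
    have hSm : MeasurableSet S := (hK.inter Metric.isOpen_ball).measurableSet
    have hfin : (volume.prod volume : Measure (Y × ℝ))
        (Metric.closedBall z (C * r) ×ˢ Ioo 0 (C * r)) ≠ ⊤ := by
      rw [Measure.prod_prod]
      exact ENNReal.mul_ne_top (measure_closedBall_lt_top.ne) (by simp)
    have step1 : ‖ballMean K u (chart A p₀ (z, 0)) r - c z‖ ≤ ⨍ x in S, ‖u x - c z‖ :=
      norm_setAverage_sub_le (hu.mono_set inter_subset_left) hSpos hSfin (c z)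
    have step2 : ⨍ x in S, ‖u x - c z‖ = ⨍ q in chart A p₀ ⁻¹' S, ‖U (chart A p₀ q) - c z‖
        ∂(volume.prod volume) := by
      rw [setAverage_comp_chart A p₀ (fun x => ‖U x - c z‖) S, setAverage_eq, setAverage_eq]
      congr 1
      refine setIntegral_congr_fun hSm fun x hx => ?_
      simp only [hU, indicator_of_mem hx.1]
    have hfint : IntegrableOn (fun q => ‖U (chart A p₀ q) - c z‖)
        (Metric.closedBall z (C * r) ×ˢ Ioo 0 (C * r)) (volume.prod volume) :=
      (hUc.integrableOn.sub (integrableOn_const hfin)).norm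
    have step3 := setAverage_le_of_cylinder hC hr0 hcyl1 hcyl2 (fun q => norm_nonneg _) hfint
    refine step1.trans (step2.trans_le (step3.trans ?_))
    rw [← hM]
    refine mul_le_mul_of_nonneg_left ?_ hM0.le
    set R := Metric.closedBall z (C * r) with hR
    have hR0 : (volume : Measure Y).real R ≠ 0 :=
      (ENNReal.toReal_pos (Metric.measure_closedBall_pos _ _ hCr).ne'
        measure_closedBall_lt_top.ne).ne'
    have hRfin : (volume : Measure Y) R ≠ ⊤ := measure_closedBall_lt_top.ne
    have ic : IntegrableOn (fun y => ‖c y - c z‖) R :=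
      (hcint.integrableOn.sub (integrableOn_const hRfin)).norm
    have iV : IntegrableOn (fun y => ‖V n y - V n z‖) R :=
      ((hVint n).integrableOn.sub (integrableOn_const hRfin)).norm
    -- The inner integral has length `C * r`, which cancels the factor `(C * r)⁻¹` of the cylinder
    -- estimate. Splitting `V n y` into its value at `z` and a difference prepares the use of the
    -- Lebesgue point.
    have hmono : ∫ y in R, ∫ s in Ioo 0 (C * r), ‖U (chart A p₀ (y, s)) - c z‖
        ≤ ∫ y in R, C * r * (‖c y - c z‖ + ‖V n y - V n z‖ + V n z) := by
      refine setIntegral_mono_ae_restrict ?_ ?_ ?_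
      · rw [IntegrableOn, ← Measure.prod_restrict] at hfint
        exact hfint.integral_prod_left
      · exact ((ic.add iV).add (integrableOn_const hRfin)).const_mul _
      · rw [EventuallyLE, ae_restrict_iff' measurableSet_closedBall]
        filter_upwards [hline', hline] with y hy hyl hyR
        have hyD := hballD hyR
        have hpt : ∀ᵐ s, s ∈ Ioo 0 (C * r) →
            ‖U (chart A p₀ (y, s)) - c z‖ ≤ ‖c y - c z‖ + V n y := by
          filter_upwards [hy hyD] with s hs hsI
          have hsℓ : s < ℓ := hsI.2.trans hrℓ
          rw [hU, indicator_of_mem (hin y hyD s ⟨hsI.1, hsℓ⟩), hs ⟨hsI.1, hsℓ⟩, add_sub_right_comm]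
          refine (norm_add_le _ _).trans (add_le_add_right ?_ _)
          have e : ∫ σ in (0 : ℝ)..s, g (chart A p₀ (y, σ))
              = ∫ σ in Ioc 0 s, G (chart A p₀ (y, σ)) := by
            rw [intervalIntegral.integral_of_le hsI.1.le]
            refine setIntegral_congr_fun measurableSet_Ioc fun σ hσ => ?_
            simp only [hG, indicator_of_mem (hin y hyD σ ⟨hσ.1, hσ.2.trans_lt hsℓ⟩)]
          rw [e]
          refine (norm_integral_le_integral_norm _).trans ?_
          refine setIntegral_mono_set hyl.2.1.norm.integrableOn (.of_forall fun _ => norm_nonneg _)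
            (LE.le.eventuallyLE (Ioc_subset_Ioc_right (hsI.2.trans hrn).le))
        have hconst : IntegrableOn (fun _ : ℝ => ‖c y - c z‖ + V n y) (Ioo 0 (C * r)) :=
          integrableOn_const (by simp)
        calc ∫ s in Ioo 0 (C * r), ‖U (chart A p₀ (y, s)) - c z‖
            ≤ ∫ s in Ioo 0 (C * r), (‖c y - c z‖ + V n y) := by
              refine setIntegral_mono_ae_restrict ?_ hconst ?_
              · exact (hyl.1.integrableOn.sub (integrableOn_const (by simp))).norm
              · exact (ae_restrict_iff' measurableSet_Ioo).mpr hpt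
          _ = C * r * (‖c y - c z‖ + V n y) := by
              rw [setIntegral_const, Real.volume_real_Ioo_of_le hCr.le, sub_zero, smul_eq_mul]
          _ ≤ _ := by
              have := le_abs_self (V n y - V n z)
              rw [Real.norm_eq_abs (V n y - V n z)]
              refine mul_le_mul_of_nonneg_left ?_ hCr.le
              linarith
    have icV : IntegrableOn (fun y => ‖c y - c z‖ + ‖V n y - V n z‖) R := ic.add iV
    rw [integral_const_mul, integral_add icV (integrableOn_const hRfin),
      integral_add ic iV, setIntegral_const] at hmono
    rw [setAverage_eq, setAverage_eq, setAverage_eq]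
    simp only [smul_eq_mul] at hmono ⊢
    have hRpos : 0 < (volume : Measure Y).real R := lt_of_le_of_ne measureReal_nonneg hR0.symm
    rw [← mul_le_mul_iff_right₀ (mul_pos hCr hRpos)]
    refine (le_of_eq ?_).trans (hmono.trans (le_of_eq ?_))
    · field_simp
    · field_simp
  rw [Metric.tendsto_nhds]
  intro ε hε
  -- The height index `n` is fixed first, so that `V n z` is small; only then is `r` sent to zero.
  obtain ⟨n, hn⟩ := ((tendsto_order.1 hV0).2 (ε / (3 * M)) (by positivity)).exists
  filter_upwards [bound n, (tendsto_order.1 hzc).2 (ε / (3 * M)) (by positivity),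
    (tendsto_order.1 (hzV n)).2 (ε / (3 * M)) (by positivity)] with r h1 h2 h3
  rw [dist_eq_norm]
  refine h1.trans_lt ?_
  calc _ < M * (ε / (3 * M) + ε / (3 * M) + ε / (3 * M)) := by gcongr
    _ = ε := by field_simp; norm_num

end ballMean

/-! ### Square integrability of traces. -/

/-- The variance about the mean `a` is nonnegative; expanding it gives the inequality. -/
theorem sq_integral_le_of_finite {X : Type*} [MeasurableSpace X] {μ : Measure X}
    [IsFiniteMeasure μ] {F : X → ℝ} (hF : MemLp F 2 μ) :
    (∫ x, F x ∂μ) ^ 2 ≤ μ.real univ * ∫ x, F x ^ 2 ∂μ := by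
  have h1 : Integrable F μ := hF.integrable one_le_two
  have h2 : Integrable (fun x => F x ^ 2) μ := hF.integrable_sq
  rcases eq_or_ne (μ.real univ) 0 with h0 | h0
  · have : μ = 0 := by
      rw [measureReal_eq_zero_iff] at h0
      exact Measure.measure_univ_eq_zero.mp h0
    simp [this]
  have hm : 0 < μ.real univ := lt_of_le_of_ne measureReal_nonneg h0.symm
  set a := (∫ x, F x ∂μ) / μ.real univ with ha
  have h3 : 0 ≤ ∫ x, (F x - a) ^ 2 ∂μ := integral_nonneg fun x => sq_nonneg _
  have h4 : ∀ x, (F x - a) ^ 2 = F x ^ 2 - 2 * a * F x + a ^ 2 := fun x => by ring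
  simp_rw [h4] at h3
  rw [integral_add (h2.sub' (h1.const_mul _)) (integrable_const _),
    integral_sub h2 (h1.const_mul _), integral_const_mul, integral_const, smul_eq_mul] at h3
  have h5 : a * μ.real univ = ∫ x, F x ∂μ := by rw [ha]; field_simp
  rw [← h5] at h3 ⊢
  nlinarith

theorem memLp_two_integral_right {Y : Type*} [MeasurableSpace Y] {ρ : Measure Y} [SFinite ρ]
    {ν : Measure ℝ} [IsFiniteMeasure ν] {f : Y × ℝ → ℂ} (hf : MemLp f 2 (ρ.prod ν)) :
    MemLp (fun z => ∫ s, f (z, s) ∂ν) 2 ρ := by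
  have hm := hf.aestronglyMeasurable.integral_prod_right'
  have hsq := (memLp_two_iff_integrable_sq_norm hf.aestronglyMeasurable).mp hf
  refine (memLp_two_iff_integrable_sq_norm hm).mpr ?_
  refine (hsq.integral_prod_left.const_mul (ν.real univ)).mono' (hm.norm.pow 2) ?_
  filter_upwards [hsq.prod_right_ae, hf.aestronglyMeasurable.prodMk_left] with z hz hzm
  have hz2 : MemLp (fun s => f (z, s)) 2 ν := (memLp_two_iff_integrable_sq_norm hzm).mpr hz
  rw [Real.norm_eq_abs, abs_of_nonneg (sq_nonneg _)]
  calc ‖∫ s, f (z, s) ∂ν‖ ^ 2 ≤ (∫ s, ‖f (z, s)‖ ∂ν) ^ 2 := by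
        gcongr; exact norm_integral_le_integral_norm _
    _ ≤ _ := sq_integral_le_of_finite hz2.norm

section traces

variable {d : ℕ} {Y : Type*} [NormedAddCommGroup Y] [NormedSpace ℝ Y] [FiniteDimensional ℝ Y]
  [MeasureSpace Y] [BorelSpace Y] [(volume : Measure Y).IsAddHaarMeasure]
  (A : (Y × ℝ) ≃L[ℝ] SpaceTime d) (p₀ : SpaceTime d) {K : Set (SpaceTime d)}
  {u g : SpaceTime d → ℂ}

/-- At almost every regular boundary point the trace exists, and it is the boundary value along the
line through the point. -/
theorem IsWeakDeriv.ae_hasLineTrace (hK : IsOpen K) (hu : IntegrableOn u K)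
    (hg : IntegrableOn g K) (h : IsWeakDeriv K (A (0, 1)) u g) :
    ∀ᵐ z, IsRegularPoint A p₀ K z →
      Tendsto (ballMean K u (chart A p₀ (z, 0))) (𝓝[>] 0) (𝓝 (trace K u (chart A p₀ (z, 0)))) ∧
      HasLineTrace A p₀ K u g z (trace K u (chart A p₀ (z, 0))) := by
  have key : ∀ᵐ z, IsRegularPoint A p₀ K z →
      ∃ c, Tendsto (ballMean K u (chart A p₀ (z, 0))) (𝓝[>] 0) (𝓝 c) ∧
        HasLineTrace A p₀ K u g z c := by
    rw [ae_iff]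
    -- The height of the cylinder varies with the regular point, but null sets can be detected
    -- locally, and near one point a single height works.
    refine measure_null_of_locally_null _ fun z hz => ?_
    simp only [mem_ofPred_eq, Classical.not_imp] at hz
    obtain ⟨⟨D, hD, ℓ, hℓ, hin, hout⟩, -⟩ := hz
    obtain ⟨D', hD', hD'o, hzD'⟩ := mem_nhds_iff.mp hD
    have := ae_hasLineTrace_of_nhds A p₀ hK hu hg h hD'o hℓ (fun y hy => hin y (hD' hy))
      (fun y hy => hout y (hD' hy))
    refine ⟨_, inter_mem_nhdsWithin _ (hD'o.mem_nhds hzD'), measure_mono_null ?_ (ae_iff.mp this)⟩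
    rintro y ⟨hy, hyD⟩
    simp only [mem_ofPred_eq, Classical.not_imp] at hy ⊢
    exact ⟨hyD, hy.2⟩
  filter_upwards [key] with z hz hreg
  obtain ⟨c, hc, hl⟩ := hz hreg
  have : trace K u (chart A p₀ (z, 0)) = c := hc.limUnder_eq
  rw [this]
  exact ⟨hc, hl⟩

theorem memLp_comp_chart {f : SpaceTime d → ℂ} (hf : MemLp f 2) :
    MemLp (fun q => f (chart A p₀ q)) 2 ((volume : Measure Y).prod volume) := by
  obtain ⟨κ, -, hκ⟩ := exists_map_chart A p₀
  have : MemLp f 2 (Measure.map (chart A p₀) (volume.prod volume)) := by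
    rw [hκ]; exact hf.smul_measure ENNReal.coe_ne_top
  exact (measurableEmbedding_chart A p₀).memLp_map_measure_iff.mp this

/-- Traces are square integrable over the base of a cylinder contained in `K`. -/
theorem IsWeakDeriv.memLp_trace_comp_chart (hK : IsOpen K) (hKfin : volume K ≠ ⊤)
    (hu : MemLp u 2 (volume.restrict K)) (hg : MemLp g 2 (volume.restrict K))
    (h : IsWeakDeriv K (A (0, 1)) u g) {D : Set Y} (hD : MeasurableSet D) {ℓ : ℝ} (hℓ : 0 < ℓ)
    (hin : ∀ y ∈ D, ∀ s ∈ Ioo (0 : ℝ) ℓ, chart A p₀ (y, s) ∈ K)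
    (hreg : ∀ᵐ y, y ∈ D → IsRegularPoint A p₀ K y) :
    MemLp (fun z => trace K u (chart A p₀ (z, 0))) 2 (volume.restrict D) := by
  have : IsFiniteMeasure (volume.restrict K) := ⟨by simpa using hKfin.lt_top⟩
  have hui : IntegrableOn u K := hu.integrable one_le_two
  have hgi : IntegrableOn g K := hg.integrable one_le_two
  have hU := memLp_comp_chart A p₀ ((memLp_indicator_iff_restrict hK.measurableSet).mpr hu)
  have hG := memLp_comp_chart A p₀ ((memLp_indicator_iff_restrict hK.measurableSet).mpr hg)
  have hle : (volume : Measure Y).prod ((volume : Measure ℝ).restrict (Ioc 0 ℓ))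
      ≤ volume.prod volume := by
    have : (volume : Measure Y).prod ((volume : Measure ℝ).restrict (Ioc 0 ℓ))
        = (volume.prod volume).restrict (univ ×ˢ Ioc 0 ℓ) := by
      rw [← Measure.prod_restrict, Measure.restrict_univ]
    rw [this]; exact Measure.restrict_le_self
  have hmem : MemLp (fun q : Y × ℝ => ((ℓ⁻¹ : ℝ) : ℂ) * K.indicator u (chart A p₀ q)
      - ((1 - q.2 / ℓ : ℝ) : ℂ) * K.indicator g (chart A p₀ q)) 2
      ((volume : Measure Y).prod (volume.restrict (Ioc 0 ℓ))) := by
    refine ((hU.mono_measure hle).const_mul _).sub ?_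
    refine (hG.mono_measure hle).of_le ?_ ?_
    · exact (Continuous.aestronglyMeasurable (by fun_prop)).mul
        (hG.mono_measure hle).aestronglyMeasurable
    have hsnd : Measure.QuasiMeasurePreserving Prod.snd
      ((volume : Measure Y).prod ((volume : Measure ℝ).restrict (Ioc 0 ℓ)))
      (volume.restrict (Ioc 0 ℓ)) := Measure.quasiMeasurePreserving_snd
    filter_upwards [hsnd.ae (ae_restrict_mem measurableSet_Ioc)] with q hq
    rw [norm_mul, Complex.norm_real, Real.norm_eq_abs]
    have h1 : 0 < q.2 / ℓ := div_pos hq.1 hℓ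
    have h2 : q.2 / ℓ ≤ 1 := (div_le_one hℓ).mpr hq.2
    refine mul_le_of_le_one_left (norm_nonneg _) (abs_le.mpr ?_)
    constructor <;> linarith
  -- Flatness serves only to identify the trace with the line integral. The bound comes from the
  -- uniform height `ℓ` and does not degenerate where the flat neighbourhoods shrink, that is, near
  -- the edges.
  refine ((memLp_two_integral_right hmem).restrict D).ae_eq ?_
  rw [EventuallyEq, ae_restrict_iff' hD]
  filter_upwards [h.ae_hasLineTrace A p₀ hK hui hgi, h.ae_line A p₀ hK hui hgi, hreg]
    with z hz ⟨_, hz2, _⟩ hzreg hzD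
  have hc := (hz (hzreg hzD)).2 ℓ hℓ (hin z hzD)
  have hgl : IntervalIntegrable (fun s => g (chart A p₀ (z, s))) volume 0 ℓ := by
    refine intervalIntegrable_of_integrableOn_Ioo (α := 0) (β := ℓ) ?_ ⟨le_rfl, hℓ.le⟩
      ⟨hℓ.le, le_rfl⟩
    refine (hz2.integrableOn (s := Ioo 0 ℓ)).congr_fun (fun s hs => ?_) measurableSet_Ioo
    exact indicator_of_mem (hin z hzD s hs) g
  rw [eq_integral_of_eq_add_primitive hℓ hgl hc, intervalIntegral.integral_of_le hℓ.le,
    integral_Ioc_eq_integral_Ioo, integral_Ioc_eq_integral_Ioo]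
  refine setIntegral_congr_fun measurableSet_Ioo fun s hs => ?_
  simp only [indicator_of_mem (hin z hzD s hs)]

end traces

/-! ### Integration by parts on open subsets of the line. -/

/-- `c` is the limit of `u` at `q` from the right, `g` being the derivative of `u` in `O`. -/
def HasRightValue (O : Set ℝ) (u g : ℝ → ℂ) (q : ℝ) (c : ℂ) : Prop :=
  ∀ β > 0, (∀ s ∈ Ioo 0 β, q + s ∈ O) → ∀ᵐ s, s ∈ Ioo 0 β →
    u (q + s) = c + ∫ σ in (0 : ℝ)..s, g (q + σ)

/-- `c` is the limit of `u` at `q` from the left, `g` being the derivative of `u` in `O`. -/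
def HasLeftValue (O : Set ℝ) (u g : ℝ → ℂ) (q : ℝ) (c : ℂ) : Prop :=
  ∀ β > 0, (∀ s ∈ Ioo 0 β, q - s ∈ O) → ∀ᵐ s, s ∈ Ioo 0 β →
    u (q - s) = c + ∫ σ in (0 : ℝ)..s, -g (q - σ)

theorem HasRightValue.ae_eq {O : Set ℝ} {u g : ℝ → ℂ} {α β : ℝ} {c : ℂ}
    (h : HasRightValue O u g α c) (hαβ : α < β) (hO : Ioo α β ⊆ O) :
    ∀ᵐ s, s ∈ Ioo α β → u s = c + ∫ σ in α..s, g σ := by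
  have h1 := h (β - α) (by linarith) (fun s hs => hO ⟨by linarith [hs.1], by linarith [hs.2]⟩)
  filter_upwards [(measurePreserving_sub_right volume α).quasiMeasurePreserving.ae h1] with s hs hsI
  have := hs ⟨by linarith [hsI.1], by linarith [hsI.2]⟩
  rw [intervalIntegral.integral_comp_add_left] at this
  simpa using this

theorem HasLeftValue.ae_eq {O : Set ℝ} {u g : ℝ → ℂ} {α β : ℝ} {c : ℂ}
    (h : HasLeftValue O u g β c) (hαβ : α < β) (hO : Ioo α β ⊆ O) :
    ∀ᵐ s, s ∈ Ioo α β → u s = c - ∫ σ in s..β, g σ := by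
  have h1 := h (β - α) (by linarith) (fun s hs => hO ⟨by linarith [hs.2], by linarith [hs.1]⟩)
  filter_upwards [(Measure.measurePreserving_sub_left volume β).quasiMeasurePreserving.ae h1] with s hs hsI
  have := hs ⟨by linarith [hsI.2], by linarith [hsI.1]⟩
  rw [intervalIntegral.integral_comp_sub_left (fun σ => -g σ), intervalIntegral.integral_neg] at this
  simpa [sub_eq_add_neg] using this

/-- The representations from the two ends both hold almost everywhere, so they can be compared at
one common point. -/
theorem end_values {O : Set ℝ} {u g : ℝ → ℂ} {α β : ℝ} {c c' : ℂ} (hαβ : α < β)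
    (hO : Ioo α β ⊆ O) (hg : IntegrableOn g (Ioo α β)) (hα : HasRightValue O u g α c)
    (hβ : HasLeftValue O u g β c') : c' = c + ∫ σ in α..β, g σ := by
  obtain ⟨s, ⟨hs1, hs2⟩, hs⟩ := (Measure.dense_of_ae ((hα.ae_eq hαβ hO).and
    (hβ.ae_eq hαβ hO))).exists_mem_open isOpen_Ioo (nonempty_Ioo.mpr hαβ)
  have h1 := hs1 hs
  rw [hs2 hs] at h1
  have e := intervalIntegral.integral_add_adjacent_intervals
    (intervalIntegrable_of_integrableOn_Ioo hg ⟨le_rfl, hαβ.le⟩ (Ioo_subset_Icc_self hs))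
    (intervalIntegrable_of_integrableOn_Ioo hg (Ioo_subset_Icc_self hs) ⟨hαβ.le, le_rfl⟩)
  rw [← e]
  linear_combination h1

theorem setIntegral_Ioo_by_parts {O : Set ℝ} {u g h k : ℝ → ℂ} {α β : ℝ} {c c' e e' : ℂ}
    (hαβ : α < β) (hO : Ioo α β ⊆ O) (hg : IntegrableOn g (Ioo α β))
    (hk : IntegrableOn k (Ioo α β)) (hu : HasRightValue O u g α c) (hu' : HasLeftValue O u g β c')
    (hh : HasRightValue O h k α e) (hh' : HasLeftValue O h k β e') :
    ∫ s in Ioo α β, (u s * conj (k s) + g s * conj (h s)) = c' * conj e' - c * conj e := by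
  have hgi := intervalIntegrable_of_integrableOn_Ioo hg ⟨le_rfl, hαβ.le⟩ ⟨hαβ.le, le_rfl⟩
  have hki := intervalIntegrable_of_integrableOn_Ioo hk ⟨le_rfl, hαβ.le⟩ ⟨hαβ.le, le_rfl⟩
  have hki' : IntervalIntegrable (fun s => conj (k s)) volume α β := by
    rw [intervalIntegrable_iff] at hki ⊢
    exact hki.congr' (Complex.continuous_conj.comp_aestronglyMeasurable hki.aestronglyMeasurable)
      (.of_forall fun s => by simp)
  have hconj : ∀ s, conj (∫ σ in α..s, k σ) = ∫ σ in α..s, conj (k σ) := fun s =>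
    (intervalIntegral.intervalIntegral_conj).symm
  rw [end_values hαβ hO hg hu hu', end_values hαβ hO hk hh hh', map_add, hconj]
  have bp := integral_primitive_mul_add_mul_primitive hαβ.le hgi hki'
  have e1 : ∫ s in Ioo α β, (u s * conj (k s) + g s * conj (h s))
      = ∫ s in α..β, (c * conj (k s) + conj e * g s
        + (((∫ σ in α..s, g σ) * conj (k s)) + g s * ∫ σ in α..s, conj (k σ))) := by
    rw [intervalIntegral.integral_of_le hαβ.le, integral_Ioc_eq_integral_Ioo]
    refine setIntegral_congr_ae measurableSet_Ioo ?_
    filter_upwards [hu.ae_eq hαβ hO, hh.ae_eq hαβ hO] with s h1 h2 hs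
    rw [h1 hs, h2 hs, map_add, hconj]
    ring
  have i1 : IntervalIntegrable (fun s => (∫ σ in α..s, g σ) * conj (k s)) volume α β :=
    hki'.continuousOn_mul (intervalIntegral.continuousOn_primitive_interval' hgi left_mem_uIcc)
  have i2 : IntervalIntegrable (fun s => g s * ∫ σ in α..s, conj (k σ)) volume α β :=
    hgi.mul_continuousOn (intervalIntegral.continuousOn_primitive_interval' hki' left_mem_uIcc)
  rw [e1, intervalIntegral.integral_add ((hki'.const_mul _).add (hgi.const_mul _)) (i1.add i2),
    intervalIntegral.integral_add (hki'.const_mul _) (hgi.const_mul _),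
    intervalIntegral.integral_add i1 i2, bp, intervalIntegral.integral_const_mul,
    intervalIntegral.integral_const_mul]
  ring

/-- Away from the frontier, `C` is covered by the disjoint open sets `interior U` and `(closure
U)ᶜ`, and it meets the first one. -/
theorem subset_of_isPreconnected_of_disjoint_frontier {X : Type*} [TopologicalSpace X]
    {C U : Set X} (hC : IsPreconnected C) (h : Disjoint C (frontier U)) (hne : (C ∩ U).Nonempty) :
    C ⊆ U := by
  have hcov : C ⊆ interior U ∪ (closure U)ᶜ := fun x hx => by
    by_cases hxU : x ∈ interior U
    · exact Or.inl hxU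
    · exact Or.inr fun hxc => disjoint_left.mp h hx ⟨hxc, hxU⟩
  obtain ⟨y, hyC, hyU⟩ := hne
  have hy : y ∈ interior U := (hcov hyC).resolve_right fun h' => h' (subset_closure hyU)
  exact (hC.subset_left_of_subset_union isOpen_interior isClosed_closure.isOpen_compl
    (disjoint_left.mpr fun z hz hz' => hz' (subset_closure (interior_subset hz))) hcov
    ⟨y, hyC, hy⟩).trans interior_subset

/-- The boundary point `q` of `O` with the boundary values of `u` and `h`; the sign is `1` if `O`
lies to the left of `q`, and `-1` if `O` lies to the right. -/
def IsEndPoint (O : Set ℝ) (u g h k : ℝ → ℂ) (q sg : ℝ) (c e : ℂ) : Prop :=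
  (sg = -1 ∧ (∃ ε > 0, Ioo q (q + ε) ⊆ O ∧ Disjoint (Ioo (q - ε) q) O) ∧
      HasRightValue O u g q c ∧ HasRightValue O h k q e) ∨
    (sg = 1 ∧ (∃ ε > 0, Ioo (q - ε) q ⊆ O ∧ Disjoint (Ioo q (q + ε)) O) ∧
      HasLeftValue O u g q c ∧ HasLeftValue O h k q e)

/-- Integration by parts over a bounded open set of the line with finitely many end points. -/
theorem setIntegral_by_parts_of_finite_frontier {u g h k : ℝ → ℂ} {sg : ℝ → ℝ} {c e : ℝ → ℂ}
    (n : ℕ) : ∀ (Q : Finset ℝ) (O : Set ℝ), Q.card = n → IsOpen O → Bornology.IsBounded O →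
    IntegrableOn g O → IntegrableOn k O →
    IntegrableOn (fun s => u s * conj (k s) + g s * conj (h s)) O → frontier O ⊆ Q →
    (∀ q ∈ Q, IsEndPoint O u g h k q (sg q) (c q) (e q)) →
    ∫ s in O, (u s * conj (k s) + g s * conj (h s)) = ∑ q ∈ Q, (sg q : ℂ) * (c q * conj (e q)) := by
  induction n using Nat.strong_induction_on with
  | _ n ih =>
  intro Q O hn hO hb hg hk hF hQ hend
  have hright : ∀ a, ¬ Ioi a ⊆ O := fun a hsub => by
    obtain ⟨M, hM⟩ := hb.bddAbove
    have := hM (hsub (show max a M + 1 ∈ Ioi a from by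
      have := le_max_left a M; exact lt_of_le_of_lt this (by linarith)))
    have := le_max_right a M
    linarith
  have hleft : ∀ a, ¬ Iio a ⊆ O := fun a hsub => by
    obtain ⟨M, hM⟩ := hb.bddBelow
    have := hM (hsub (show min a M - 1 ∈ Iio a from by
      have := min_le_left a M; exact lt_of_lt_of_le (by linarith) this))
    have := min_le_right a M
    linarith
  have hnot : ∀ q ∈ Q, q ∉ O := fun q hq hqO => by
    obtain ⟨r, hr, hball⟩ := Metric.isOpen_iff.mp hO q hqO
    rcases hend q hq with ⟨-, ⟨ε, hε, -, hd⟩, -⟩ | ⟨-, ⟨ε, hε, -, hd⟩, -⟩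
    · have hm : 0 < min r ε := lt_min hr hε
      have h1 := min_le_left r ε
      have h2 := min_le_right r ε
      refine disjoint_left.mp hd (show q - min r ε / 2 ∈ Ioo (q - ε) q from
        ⟨by linarith, by linarith⟩) (hball ?_)
      rw [Metric.mem_ball, Real.dist_eq, abs_lt]; constructor <;> linarith
    · have hm : 0 < min r ε := lt_min hr hε
      have h1 := min_le_left r ε
      have h2 := min_le_right r ε
      refine disjoint_left.mp hd (show q + min r ε / 2 ∈ Ioo q (q + ε) from
        ⟨by linarith, by linarith⟩) (hball ?_)
      rw [Metric.mem_ball, Real.dist_eq, abs_lt]; constructor <;> linarith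
  rcases Q.eq_empty_or_nonempty with rfl | hne
  · have hF0 : frontier O = ∅ := by simpa using hQ
    have hOe : O = ∅ := by
      rcases isClopen_iff.mp (isClopen_iff_frontier_eq_empty.mpr hF0) with h | h
      · exact h
      · exact absurd (h ▸ subset_univ _) (hright 0)
    simp [hOe]
  set m := Q.max' hne with hm
  have hmQ : m ∈ Q := Q.max'_mem hne
  have hmmax : ∀ q ∈ Q, q ≤ m := fun q hq => Q.le_max' q hq
  -- The half-line beyond the largest end point contains no frontier point, so it lies entirely
  -- inside or outside `O`, and boundedness excludes the former. Hence `m` closes an interval of `O`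
  -- from the right.
  have hIoi : Disjoint (Ioi m) O := by
    rw [disjoint_left]
    intro x hx hxO
    refine hright m (subset_of_isPreconnected_of_disjoint_frontier isPreconnected_Ioi ?_
      ⟨x, hx, hxO⟩)
    exact disjoint_left.mpr fun y hy hyF => (hmmax y (hQ hyF)).not_gt hy
  obtain ⟨hsg, ⟨ε, hε, hεO, -⟩, hLu, hLh⟩ : sg m = 1 ∧ (∃ ε > 0, Ioo (m - ε) m ⊆ O ∧
      Disjoint (Ioo m (m + ε)) O) ∧ HasLeftValue O u g m (c m) ∧ HasLeftValue O h k m (e m) := by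
    rcases hend m hmQ with ⟨-, ⟨ε, hε, hεO, -⟩, -⟩ | hr
    · exact absurd (hεO ⟨by linarith, by linarith⟩ : m + ε / 2 ∈ O)
        (disjoint_left.mp hIoi (by simp only [mem_Ioi]; linarith))
    · exact hr
  have hne' : (Q.erase m).Nonempty := by
    by_contra hcon
    rw [Finset.not_nonempty_iff_eq_empty] at hcon
    refine hleft m (subset_of_isPreconnected_of_disjoint_frontier isPreconnected_Iio ?_
      ⟨m - ε / 2, by simp only [mem_Iio]; linarith, hεO ⟨by linarith, by linarith⟩⟩)
    refine disjoint_left.mpr fun y hy hyF => ?_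
    have : y ∈ Q.erase m := Finset.mem_erase.mpr ⟨(ne_of_lt hy), hQ hyF⟩
    simp [hcon] at this
  set l := (Q.erase m).max' hne' with hl
  have hlQ' : l ∈ Q.erase m := Finset.max'_mem _ hne'
  have hlQ : l ∈ Q := Finset.mem_of_mem_erase hlQ'
  have hlm : l < m := lt_of_le_of_ne (hmmax l hlQ) (Finset.ne_of_mem_erase hlQ')
  have hlmax : ∀ q ∈ Q, q ≠ m → q ≤ l := fun q hq hqm =>
    Finset.le_max' _ q (Finset.mem_erase.mpr ⟨hqm, hq⟩)
  -- No frontier point lies strictly between the two largest end points, and `O` is present just to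
  -- the left of `m`; so `(l, m)` is the last component of `O`. The induction removes it together
  -- with both of its ends.
  have hgap : Ioo l m ⊆ O := by
    have h1 := le_max_left (m - ε) l
    have h2 := le_max_right (m - ε) l
    have h3 : max (m - ε) l < m := max_lt (by linarith) hlm
    refine subset_of_isPreconnected_of_disjoint_frontier isPreconnected_Ioo ?_
      ⟨(max (m - ε) l + m) / 2, ⟨by linarith, by linarith⟩, hεO ⟨by linarith, by linarith⟩⟩
    exact disjoint_left.mpr fun y hy hyF => (hlmax y (hQ hyF) hy.2.ne).not_gt hy.1
  obtain ⟨hsgl, ⟨δ, hδ, -, hδO⟩, hRu, hRh⟩ : sg l = -1 ∧ (∃ ε > 0, Ioo l (l + ε) ⊆ O ∧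
      Disjoint (Ioo (l - ε) l) O) ∧ HasRightValue O u g l (c l) ∧ HasRightValue O h k l (e l) := by
    rcases hend l hlQ with hr | ⟨-, ⟨δ, hδ, -, hd⟩, -⟩
    · exact hr
    · have h1 := min_le_left m (l + δ)
      have h2 := min_le_right m (l + δ)
      have h3 : l < min m (l + δ) := lt_min hlm (by linarith)
      exact absurd (hgap ⟨by linarith, by linarith⟩ : (l + min m (l + δ)) / 2 ∈ O)
        (disjoint_left.mp hd ⟨by linarith, by linarith⟩)
  set O' := O ∩ Iio l with hO'
  set Q' := (Q.erase m).erase l with hQ'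
  have hO'O : O' ⊆ O := inter_subset_left
  have hsplit : O = O' ∪ Ioo l m := by
    ext x
    constructor
    · intro hx
      rcases lt_trichotomy x l with h1 | h1 | h1
      · exact Or.inl ⟨hx, h1⟩
      · exact absurd (h1 ▸ hx) (hnot l hlQ)
      · rcases lt_trichotomy x m with h2 | h2 | h2
        · exact Or.inr ⟨h1, h2⟩
        · exact absurd (h2 ▸ hx) (hnot m hmQ)
        · exact absurd hx (disjoint_left.mp hIoi h2)
    · rintro (hx | hx)
      · exact hO'O hx
      · exact hgap hx
  have hdis : Disjoint O' (Ioo l m) := disjoint_left.mpr fun x hx hx' => lt_asymm hx.2 hx'.1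
  have hO'o : IsOpen O' := hO.inter isOpen_Iio
  have hfr : frontier O' ⊆ Q' := by
    intro x hx
    have hxc : x ∈ closure O' := frontier_subset_closure hx
    have hxl : x ≤ l := by
      have := closure_mono (inter_subset_right : O' ⊆ Iio l) hxc
      rwa [closure_Iio] at this
    -- The set `O` is absent just to the left of `l`, so the truncation creates no new frontier
    -- point there.
    have hxnel : x ≠ l := by
      rintro rfl
      rw [Metric.mem_closure_iff] at hxc
      obtain ⟨y, hy, hdist⟩ := hxc δ hδ
      rw [Real.dist_eq, abs_lt] at hdist
      have hyl : y < l := hy.2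
      exact disjoint_left.mp hδO ⟨by linarith, hyl⟩ hy.1
    have hxlt : x < l := lt_of_le_of_ne hxl hxnel
    have hxO : x ∉ O := fun hxO => (hO'o.frontier_eq ▸ hx).2 ⟨hxO, hxlt⟩
    have hxF : x ∈ frontier O := by
      rw [hO.frontier_eq]; exact ⟨closure_mono hO'O hxc, hxO⟩
    simp only [hQ', Finset.coe_erase, Set.mem_sdiff, mem_singleton_iff]
    exact ⟨⟨hQ hxF, (hxlt.trans hlm).ne⟩, hxnel⟩
  have hcard : Q'.card < n := by
    rw [← hn]
    exact (Finset.card_erase_le).trans_lt (Finset.card_erase_lt_of_mem hmQ)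
  have hend' : ∀ q ∈ Q', IsEndPoint O' u g h k q (sg q) (c q) (e q) := by
    intro q hq
    have hql : q ≠ l := Finset.ne_of_mem_erase hq
    have hq1 := Finset.mem_of_mem_erase hq
    have hqm : q ≠ m := Finset.ne_of_mem_erase hq1
    have hqQ := Finset.mem_of_mem_erase hq1
    have hqlt : q < l := lt_of_le_of_ne (hlmax q hqQ hqm) hql
    rcases hend q hqQ with ⟨h1, ⟨η, hη, h2, h3⟩, h4, h5⟩ | ⟨h1, ⟨η, hη, h2, h3⟩, h4, h5⟩
    · refine Or.inl ⟨h1, ⟨min η (l - q), lt_min hη (by linarith), ?_, ?_⟩,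
        fun β hβ hs => h4 β hβ fun s hs' => hO'O (hs s hs'),
        fun β hβ hs => h5 β hβ fun s hs' => hO'O (hs s hs')⟩
      · intro x hx
        have h6 := min_le_left η (l - q)
        have h7 := min_le_right η (l - q)
        exact ⟨h2 ⟨hx.1, by linarith [hx.2]⟩, by simp only [mem_Iio]; linarith [hx.2]⟩
      · have h6 := min_le_left η (l - q)
        exact h3.mono (Ioo_subset_Ioo_left (by linarith)) hO'O
    · refine Or.inr ⟨h1, ⟨η, hη, ?_, h3.mono_right hO'O⟩,
        fun β hβ hs => h4 β hβ fun s hs' => hO'O (hs s hs'),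
        fun β hβ hs => h5 β hβ fun s hs' => hO'O (hs s hs')⟩
      exact fun x hx => ⟨h2 hx, hx.2.trans hqlt⟩
  have hrec := ih Q'.card hcard Q' O' rfl hO'o (hb.subset hO'O) (hg.mono_set hO'O)
    (hk.mono_set hO'O) (hF.mono_set hO'O) hfr hend'
  conv_lhs => rw [hsplit]
  rw [setIntegral_union hdis measurableSet_Ioo (hF.mono_set hO'O) (hF.mono_set hgap), hrec,
    setIntegral_Ioo_by_parts hlm hgap (hg.mono_set hgap) (hk.mono_set hgap) hRu hLu hRh hLh,
    ← Finset.add_sum_erase Q _ hmQ, ← Finset.add_sum_erase (Q.erase m) _ hlQ', hsg, hsgl]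
  push_cast
  ring

/-! ### Hyperplanes, surface measure and oblique coordinates. -/

section hyperplanes

variable {d : ℕ}

/-- The hyperplane `⟪h, x⟫ = c`. -/
def hyperplane (n : Space d) (c : ℝ) : Set (Space d) := {x | inner ℝ n x = c}

theorem isClosed_hyperplane (n : Space d) (c : ℝ) : IsClosed (hyperplane n c) :=
  isClosed_eq (by fun_prop) continuous_const

/-- `L` parametrizes isometrically the directions orthogonal to the unit vector `n`. -/
structure IsNormalFrame (n : Space d) (L : Space (d - 1) →ₗᵢ[ℝ] Space d) : Prop where
  norm_eq : ‖n‖ = 1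
  inner_eq : ∀ y, inner ℝ n (L y) = 0

theorem exists_isNormalFrame (hd : 0 < d) {n : Space d} (hn : ‖n‖ = 1) :
    ∃ L, IsNormalFrame n L := by
  have : Fact (Module.finrank ℝ (Space d) = (d - 1) + 1) := ⟨by
    rw [finrank_euclideanSpace_fin]; omega⟩
  have hn0 : n ≠ 0 := by
    rintro rfl; simp at hn
  let b := OrthonormalBasis.fromOrthogonalSpanSingleton (𝕜 := ℝ) (d - 1) hn0
  refine ⟨(Submodule.subtypeₗᵢ _).comp b.repr.symm.toLinearIsometry, hn, fun y => ?_⟩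
  exact Submodule.mem_orthogonal_singleton_iff_inner_right.mp (b.repr.symm y).2

namespace IsNormalFrame

variable {n : Space d} {L : Space (d - 1) →ₗᵢ[ℝ] Space d}

theorem inner_self (hL : IsNormalFrame n L) : inner ℝ n n = 1 := by
  rw [real_inner_self_eq_norm_sq, hL.norm_eq, one_pow]

theorem pos (hL : IsNormalFrame n L) : 0 < d := by
  rcases Nat.eq_zero_or_pos d with rfl | h
  · have := hL.norm_eq
    rw [Subsingleton.elim n 0] at this
    simp at this
  · exact h

/-- Linear coordinates on the space given by a hyperplane and a direction transversal to it. -/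
def spaceCoord (L : Space (d - 1) →ₗᵢ[ℝ] Space d) (v : Space d) :
    (Space (d - 1) × ℝ) →ₗ[ℝ] Space d :=
  L.toLinearMap.coprod (LinearMap.toSpanSingleton ℝ (Space d) v)

theorem spaceCoord_apply (L : Space (d - 1) →ₗᵢ[ℝ] Space d) (v : Space d)
    (q : Space (d - 1) × ℝ) : spaceCoord L v q = L q.1 + q.2 • v := by
  simp [spaceCoord, LinearMap.coprod_apply]

theorem spaceCoord_injective (hL : IsNormalFrame n L) {v : Space d} (hv : inner ℝ n v ≠ 0) :
    Function.Injective (spaceCoord L v) := by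
  rw [injective_iff_map_eq_zero]
  rintro ⟨y, s⟩ h
  rw [spaceCoord_apply] at h
  have h1 : inner ℝ n (L y + s • v) = 0 := by rw [h, inner_zero_right]
  rw [inner_add_right, hL.inner_eq, inner_smul_right, zero_add] at h1
  have hs : s = 0 := (mul_eq_zero.mp h1).resolve_right hv
  subst hs
  have hy : L y = 0 := by simpa using h
  have : y = 0 := by rw [← norm_eq_zero, ← L.norm_map, hy, norm_zero]
  simp [this]

theorem spaceCoord_surjective (hL : IsNormalFrame n L) {v : Space d} (hv : inner ℝ n v ≠ 0) :
    Function.Surjective (spaceCoord L v) := by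
  refine (LinearMap.injective_iff_surjective_of_finrank_eq_finrank ?_).mp
    (hL.spaceCoord_injective hv)
  have := hL.pos
  rw [Module.finrank_prod, finrank_euclideanSpace_fin, finrank_euclideanSpace_fin,
    Module.finrank_self]
  omega

theorem exists_eq (hL : IsNormalFrame n L) (x : Space d) :
    ∃ y, x = L y + (inner ℝ n x) • n := by
  obtain ⟨⟨y, s⟩, h⟩ := hL.spaceCoord_surjective (v := n) (by rw [hL.inner_self]; norm_num) x
  rw [spaceCoord_apply] at h
  refine ⟨y, ?_⟩
  rw [← h, inner_add_right, hL.inner_eq, inner_smul_right, hL.inner_self]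
  simp

/-- The isometric parametrization of the hyperplane `⟪n, x⟫ = c`. -/
def param (n : Space d) (L : Space (d - 1) →ₗᵢ[ℝ] Space d) (c : ℝ) (y : Space (d - 1)) : Space d :=
  c • n + L y

theorem isometry_param (c : ℝ) : Isometry (param n L c) := by
  refine Isometry.of_dist_eq fun x y => ?_
  rw [param, param, dist_add_left, L.dist_map]

theorem inner_param (hL : IsNormalFrame n L) (c : ℝ) (y : Space (d - 1)) :
    inner ℝ n (param n L c y) = c := by
  rw [param, inner_add_right, hL.inner_eq, inner_smul_right, hL.inner_self]; simp

theorem range_param (hL : IsNormalFrame n L) (c : ℝ) : range (param n L c) = hyperplane n c := by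
  ext x
  constructor
  · rintro ⟨y, rfl⟩; exact hL.inner_param c y
  · intro hx
    obtain ⟨y, hy⟩ := hL.exists_eq x
    refine ⟨y, ?_⟩
    rw [param, hy, add_comm]
    congr 2
    exact hx.symm

theorem map_param (hL : IsNormalFrame n L) (c : ℝ) :
    Measure.map (param n L c) volume = (μHE[d - 1] : Measure (Space d)).restrict (hyperplane n c) := by
  rw [← hL.range_param, ← (isometry_param c).map_euclideanHausdorffMeasure,
    EuclideanSpace.euclideanHausdorffMeasure_eq_volume]

theorem mk'_eq_hyperplane (hL : IsNormalFrame n L) (s : ℝ) :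
    (AffineSubspace.mk' (s • n +ᵥ (0 : Space d)) (ℝ ∙ n)ᗮ : Set (Space d)) = hyperplane n s := by
  ext x
  simp only [SetLike.mem_coe, AffineSubspace.mem_mk', vsub_eq_sub, vadd_eq_add, add_zero,
    Submodule.mem_orthogonal_singleton_iff_inner_right, inner_sub_right, inner_smul_right,
    hL.inner_self, mul_one, hyperplane, sub_eq_zero]
  rfl

/-- Volume is the integral over `s` of the surface measures of the slices `⟪n, x⟫ = s`, and each
slice is an isometric copy of `ℝ^(d-1)`. -/
theorem map_spaceCoord_self (hL : IsNormalFrame n L) :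
    Measure.map (spaceCoord L n) (volume.prod volume) = volume := by
  have hcont : Continuous (spaceCoord L n) := LinearMap.continuous_of_finiteDimensional _
  ext t ht
  rw [Measure.map_apply hcont.measurable ht, Measure.prod_apply_symm (hcont.measurable ht)]
  have h := EuclideanGeometry.euclideanHausdorffMeasure_eq_lintegral (V := Space d) (0 : Space d)
    (v := n) (by rintro rfl; simpa using hL.norm_eq) ht
  rw [InnerProductSpace.euclideanHausdorffMeasure_eq_volume, finrank_euclideanSpace_fin] at h
  rw [h, enorm_eq_nnnorm, show ‖n‖₊ = 1 from NNReal.eq hL.norm_eq, ENNReal.coe_one, one_mul]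
  refine lintegral_congr fun s => ?_
  rw [hL.mk'_eq_hyperplane, ← Measure.restrict_apply ht, ← hL.map_param,
    Measure.map_apply (isometry_param s).continuous.measurable ht]
  congr 1
  ext y
  simp [spaceCoord_apply, param, add_comm]

/-- Writing `v = L w + a n`, the oblique coordinates are the orthogonal ones preceded by a scaling
of the last coordinate by `a` and a shear along `w`; the shear preserves volume, so `|a| = |⟪n, v⟫|`
is the Jacobian. -/
theorem map_spaceCoord (hL : IsNormalFrame n L) {v : Space d} (hv : inner ℝ n v ≠ 0) :
    ENNReal.ofReal |inner ℝ n v| • Measure.map (spaceCoord L v) (volume.prod volume) = volume := by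
  set a : ℝ := inner ℝ n v with ha
  obtain ⟨w, hw⟩ := hL.exists_eq v
  have hshear : MeasurePreserving (fun q : Space (d - 1) × ℝ => (q.1 + q.2 • w, q.2))
      (volume.prod volume) (volume.prod volume) := by
    have h1 : MeasurePreserving (fun p : ℝ × Space (d - 1) => (p.1, p.2 + p.1 • w))
        (volume.prod volume) (volume.prod volume) := by
      refine (MeasurePreserving.id volume).skew_product (g := fun σ x => x + σ • w) (by fun_prop) ?_
      exact .of_forall fun σ => (measurePreserving_add_right volume (σ • w)).map_eq
    exact (Measure.measurePreserving_swap.comp h1).comp Measure.measurePreserving_swap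
  have hscale : ENNReal.ofReal |a| • Measure.map (Prod.map id (a * ·))
      ((volume : Measure (Space (d - 1))).prod volume) = volume.prod volume := by
    rw [← Measure.map_prod_map _ _ measurable_id (measurable_const_mul a), Measure.map_id,
      ← Measure.prod_smul_right, Real.smul_map_volume_mul_left hv]
  have hcont : Continuous (spaceCoord L n) := LinearMap.continuous_of_finiteDimensional _
  have hcomp : ⇑(spaceCoord L v) = spaceCoord L n ∘ Prod.map id (a * ·) ∘
      fun q : Space (d - 1) × ℝ => (q.1 + q.2 • w, q.2) := by
    ext1 q
    simp only [Function.comp_apply, Prod.map_apply, id, spaceCoord_apply]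
    conv_lhs => rw [hw]
    rw [map_add, map_smul, smul_add, smul_smul, ← ha, mul_comm a, add_assoc]
  have hm : Measurable (Prod.map id (a * ·) : Space (d - 1) × ℝ → Space (d - 1) × ℝ) :=
    measurable_id.prodMap (measurable_const_mul a)
  rw [hcomp, ← Measure.map_map hcont.measurable (hm.comp hshear.measurable),
    ← Measure.map_map hm hshear.measurable, hshear.map_eq, ← Measure.map_smul, hscale,
    hL.map_spaceCoord_self]

/-- The projection onto the hyperplane `⟪n, x⟫ = c` along `v`. -/
def proj (n : Space d) (c : ℝ) (v x : Space d) : Space d := x + ((c - inner ℝ n x) / inner ℝ n v) • v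

theorem proj_add_smul {c : ℝ} {v : Space d} (hv : inner ℝ n v ≠ 0) (x : Space d) (s : ℝ) :
    proj n c v (x + s • v) = proj n c v x := by
  rw [proj, proj, add_assoc, ← add_smul, inner_add_right, inner_smul_right]
  congr 2
  field_simp
  ring

theorem proj_eq_self {c : ℝ} {v : Space d} {x : Space d} (hx : inner ℝ n x = c) :
    proj n c v x = x := by
  rw [proj, hx]; simp

theorem inner_proj {c : ℝ} {v : Space d} (hv : inner ℝ n v ≠ 0) (x : Space d) :
    inner ℝ n (proj n c v x) = c := by
  rw [proj, inner_add_right, inner_smul_right]; field_simp; ring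

theorem continuous_proj (c : ℝ) (v : Space d) : Continuous (proj n c v) := by
  unfold proj; fun_prop

/-- The projection along the unit vector `v` from `v^⟂` to a hyperplane: the surface measure is
multiplied by the cosine of the angle between the normals. -/
theorem map_proj (hL : IsNormalFrame n L) (c : ℝ) {v : Space d}
    {L' : Space (d - 1) →ₗᵢ[ℝ] Space d} (hL' : IsNormalFrame v L') (hv : inner ℝ n v ≠ 0) :
    Measure.map (fun y => proj n c v (L' y)) volume =
      ENNReal.ofReal |inner ℝ n v| • (μHE[d - 1] : Measure (Space d)).restrict (hyperplane n c) := by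
  have hcp := continuous_proj (n := n) c v
  have hvol1 : (volume : Measure ℝ) (Ioo 0 1) = 1 := by simp
  have hshift : ∀ b : ℝ, (volume : Measure ℝ) {s | b + s ∈ Ioo (0 : ℝ) 1} = 1 := fun b => by
    have : {s : ℝ | b + s ∈ Ioo (0 : ℝ) 1} = (fun s => b + s) ⁻¹' Ioo 0 1 := rfl
    rw [this, measure_preimage_add, hvol1]
  ext B hB
  -- The volume of the oblique cylinder `W` over `B`, cut between `⟪v, x⟫ = 0` and `⟪v, x⟫ = 1`, is
  -- computed twice. Over the base `v^⟂` it is a product of height one; over the base `B` every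
  -- fibre along `v` still has length one, and the Jacobian is `|⟪n, v⟫|`.
  set W : Set (Space d) := {x | proj n c v x ∈ B ∧ inner ℝ v x ∈ Ioo (0 : ℝ) 1} with hW
  have hWm : MeasurableSet W := (hcp.measurable hB).inter
    ((by fun_prop : Measurable fun x : Space d => inner ℝ v x) measurableSet_Ioo)
  have e1 : volume W = Measure.map (fun y => proj n c v (L' y)) volume B := by
    have hcont : Continuous (spaceCoord L' v) := LinearMap.continuous_of_finiteDimensional _
    have hm1 : Measurable fun y => proj n c v (L' y) := (hcp.comp L'.continuous).measurable
    rw [← hL'.map_spaceCoord_self, Measure.map_apply hcont.measurable hWm,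
      Measure.map_apply hm1 hB]
    have : spaceCoord L' v ⁻¹' W = ((fun y => proj n c v (L' y)) ⁻¹' B) ×ˢ Ioo (0 : ℝ) 1 := by
      ext ⟨y, s⟩
      simp [hW, spaceCoord_apply, proj_add_smul hv, inner_add_right, hL'.inner_eq,
        inner_smul_right, hL'.norm_eq]
    rw [this, Measure.prod_prod, hvol1, mul_one]
  have e2 : volume W = ENNReal.ofReal |inner ℝ n v| *
      (μHE[d - 1] : Measure (Space d)).restrict (hyperplane n c) B := by
    have hcont : Continuous (fun q => c • n + spaceCoord L v q) :=
      continuous_const.add (LinearMap.continuous_of_finiteDimensional _)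
    have hmap : (volume : Measure (Space d)) = ENNReal.ofReal |inner ℝ n v| •
        Measure.map (fun q => c • n + spaceCoord L v q) (volume.prod volume) := by
      have h2 := Measure.map_map (μ := (volume.prod volume : Measure (Space (d - 1) × ℝ)))
        (measurable_const_add (c • n))
        (LinearMap.continuous_of_finiteDimensional (spaceCoord L v)).measurable
      have h3 : (fun q => c • n + spaceCoord L v q) = (fun x => c • n + x) ∘ spaceCoord L v := rfl
      rw [h3, ← h2, ← Measure.map_smul, hL.map_spaceCoord hv, map_add_left_eq_self]
    conv_lhs => rw [hmap]
    rw [Measure.smul_apply, smul_eq_mul, Measure.map_apply hcont.measurable hWm, ← hL.map_param,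
      Measure.map_apply (isometry_param c).continuous.measurable hB,
      Measure.prod_apply (hcont.measurable hWm)]
    congr 1
    have hsl : ∀ y, volume (Prod.mk y ⁻¹' ((fun q => c • n + spaceCoord L v q) ⁻¹' W))
        = (param n L c ⁻¹' B).indicator (fun _ => 1) y := by
      intro y
      have : Prod.mk y ⁻¹' ((fun q => c • n + spaceCoord L v q) ⁻¹' W)
          = {s | param n L c y ∈ B ∧ inner ℝ v (param n L c y) + s ∈ Ioo (0 : ℝ) 1} := by
        ext s
        simp only [hW, mem_preimage, spaceCoord_apply, mem_ofPred_eq, ← add_assoc]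
        change (proj n c v (param n L c y + s • v) ∈ B ∧
          inner ℝ v (param n L c y + s • v) ∈ Ioo (0 : ℝ) 1) ↔ _
        rw [proj_add_smul hv, proj_eq_self (hL.inner_param c y), inner_add_right,
          inner_smul_right, hL'.inner_self, mul_one]
      rw [this]
      by_cases hy : param n L c y ∈ B
      · simp only [hy, true_and, indicator, mem_preimage, if_true]
        exact hshift _
      · simp [hy, indicator]
    simp_rw [hsl]
    rw [lintegral_indicator ((isometry_param c).continuous.measurable hB)]
    simp
  rw [← e1, e2, Measure.smul_apply, smul_eq_mul]

end IsNormalFrame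

end hyperplanes

/-! ### Flat boundary points of polytopes. -/

section polytopes

variable {d : ℕ} {U : Set (Space d)}

/-- A small step in the direction `m' - m` would be inside `U` according to `m` and outside
according to `m'`. -/
theorem IsOutwardNormal.unique {x m m' : Space d} (h : IsOutwardNormal U x m)
    (h' : IsOutwardNormal U x m') : m = m' := by
  obtain ⟨hm, r, hr, hU⟩ := h
  obtain ⟨hm', r', hr', hU'⟩ := h'
  by_contra hne
  have hlt : inner ℝ m m' < 1 := inner_lt_one_iff_real_of_norm_eq_one hm hm' |>.mpr hne
  set ε := min r r' / 4 with hε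
  have hεpos : 0 < ε := by positivity
  have h1 := min_le_left r r'
  have h2 := min_le_right r r'
  have hz : ‖ε • (m' - m)‖ < min r r' := by
    rw [norm_smul, Real.norm_of_nonneg hεpos.le]
    have : ‖m' - m‖ ≤ 2 := (norm_sub_le _ _).trans (by rw [hm, hm']; norm_num)
    nlinarith
  have e1 := hU (x + ε • (m' - m)) (by simpa using hz.trans_le h1)
  have e2 := hU' (x + ε • (m' - m)) (by simpa using hz.trans_le h2)
  rw [e1, add_sub_cancel_left, real_inner_smul_left, real_inner_smul_left, inner_sub_left,
    inner_sub_left, real_inner_self_eq_norm_sq, real_inner_self_eq_norm_sq, hm, hm',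
    real_inner_comm m m'] at e2
  have : ε * (inner ℝ m m' - 1 ^ 2) < 0 := by nlinarith
  have := e2.mp this
  nlinarith

theorem IsOutwardNormal.outwardNormal_eq {x m : Space d} (h : IsOutwardNormal U x m) :
    outwardNormal U x = m := by
  have hex : ∃ n, IsOutwardNormal U x n := ⟨m, h⟩
  rw [outwardNormal, dif_pos hex]
  exact hex.choose_spec.unique h

theorem IsOutwardNormal.mem_frontier {x m : Space d} (h : IsOutwardNormal U x m) :
    x ∈ frontier U := by
  obtain ⟨hm, r, hr, hU⟩ := h
  constructor
  · rw [Metric.mem_closure_iff]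
    intro ε hε
    have hlt : 0 < min ε r / 2 := by positivity
    have h1 := min_le_left ε r
    have h2 := min_le_right ε r
    have hd : dist (x - (min ε r / 2) • m) x = min ε r / 2 := by
      rw [dist_eq_norm, sub_sub_cancel_left, norm_neg, norm_smul, hm, mul_one,
        Real.norm_of_nonneg hlt.le]
    refine ⟨x - (min ε r / 2) • m, (hU _ ?_).mpr ?_, ?_⟩
    · rw [Metric.mem_ball, hd]; linarith
    · rw [sub_sub_cancel_left, inner_neg_left, real_inner_smul_left, real_inner_self_eq_norm_sq, hm]
      linarith
    · rw [dist_comm, hd]; linarith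
  · intro hx
    have := (hU x (Metric.mem_ball_self hr)).mp (interior_subset hx)
    simp at this

/-- Near a flat boundary point, the other boundary points are flat with the same normal. -/
theorem IsOutwardNormal.eventually {x m : Space d} (h : IsOutwardNormal U x m) :
    ∃ r > 0, ∀ y ∈ Metric.ball x r, y ∈ frontier U → IsOutwardNormal U y m := by
  obtain ⟨hm, r, hr, hU⟩ := h
  refine ⟨r, hr, fun y hy hyF => ?_⟩
  have hcont : Continuous fun z : Space d => inner ℝ (z - x) m := by fun_prop
  have hy0 : inner ℝ (y - x) m = 0 := by
    rcases lt_trichotomy (inner ℝ (y - x) m) 0 with h1 | h1 | h1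
    · have : U ∈ 𝓝 y := by
        filter_upwards [Metric.isOpen_ball.mem_nhds hy,
          hcont.continuousAt.eventually (gt_mem_nhds h1)] with z hz hz'
        exact (hU z hz).mpr hz'
      exact absurd (mem_interior_iff_mem_nhds.mpr this) hyF.2
    · exact h1
    · have : Uᶜ ∈ 𝓝 y := by
        filter_upwards [Metric.isOpen_ball.mem_nhds hy,
          hcont.continuousAt.eventually (lt_mem_nhds h1)] with z hz hz'
        exact fun hzU => lt_asymm hz' ((hU z hz).mp hzU)
      have h2 : y ∈ interior Uᶜ := mem_interior_iff_mem_nhds.mpr this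
      rw [interior_compl] at h2
      exact absurd hyF.1 h2
  refine ⟨hm, r - dist y x, by simpa using hy, fun z hz => ?_⟩
  have hzx : z ∈ Metric.ball x r := by
    rw [Metric.mem_ball] at hz ⊢
    linarith [dist_triangle z y x]
  rw [hU z hzx]
  have : inner ℝ (z - x) m = inner ℝ (z - y) m + inner ℝ (y - x) m := by
    rw [← inner_add_left]; simp
  rw [this, hy0, add_zero]

/-- Only the two open half-balls need to be known: a point of the hyperplane in the open set `U`
would bring points of the upper half-ball into `U`. -/
theorem isOutwardNormal_of_half {y m : Space d} {c r : ℝ} (hU : IsOpen U) (hm : ‖m‖ = 1)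
    (hr : 0 < r) (hy : inner ℝ m y = c)
    (h1 : ∀ x ∈ Metric.ball y r, inner ℝ m x < c → x ∈ U)
    (h2 : ∀ x ∈ Metric.ball y r, c < inner ℝ m x → x ∉ U) : IsOutwardNormal U y m := by
  refine ⟨hm, r, hr, fun x hx => ?_⟩
  rw [real_inner_comm, inner_sub_right, hy, sub_neg]
  refine ⟨fun hxU => ?_, h1 x hx⟩
  by_contra hle
  rcases (not_lt.mp hle).lt_or_eq with hlt | heq
  · exact h2 x hx hlt hxU
  · have hcont : Continuous fun ε : ℝ => x + ε • m := by fun_prop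
    have hmem : ∀ᶠ ε in 𝓝[>] (0 : ℝ), x + ε • m ∈ U ∩ Metric.ball y r := by
      refine (hcont.tendsto 0).mono_left nhdsWithin_le_nhds
        ((hU.inter Metric.isOpen_ball).mem_nhds ?_)
      simpa using ⟨hxU, hx⟩
    obtain ⟨ε, hε, hε0⟩ := (hmem.and self_mem_nhdsWithin).exists
    refine h2 _ hε.2 ?_ hε.1
    rw [inner_add_right, inner_smul_right, real_inner_self_eq_norm_sq, hm, ← heq]
    have : 0 < ε := hε0
    linarith

/-- A polytope whose boundary lies in the given finite family of distinct hyperplanes. -/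
structure IsBoundedBy (U : Set (Space d)) (H : Finset (Space d × ℝ)) : Prop where
  isOpen : IsOpen U
  isBounded : Bornology.IsBounded U
  regular : interior (closure U) = U
  unit : ∀ h ∈ H, ‖h.1‖ = 1
  distinct : ∀ h ∈ H, ∀ h' ∈ H, h ≠ h' → hyperplane h.1 h.2 ≠ hyperplane h'.1 h'.2
  subset : frontier U ⊆ ⋃ h ∈ H, hyperplane h.1 h.2

theorem IsPolytope.exists_isBoundedBy (hU : IsPolytope U) : ∃ H, IsBoundedBy U H := by
  classical
  obtain ⟨-, ho, hb, hreg, H, hH0, hsub⟩ := hU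
  let N : Space d × ℝ → Space d × ℝ := fun h => (‖h.1‖⁻¹ • h.1, ‖h.1‖⁻¹ * h.2)
  have hN : ∀ h : Space d × ℝ, h.1 ≠ 0 →
      hyperplane (N h).1 (N h).2 = {x | inner ℝ h.1 x = h.2} := by
    intro h h0
    have : ‖h.1‖⁻¹ ≠ 0 := inv_ne_zero (norm_ne_zero_iff.mpr h0)
    ext x
    simp only [N, hyperplane, mem_ofPred_eq, real_inner_smul_left]
    exact mul_right_inj' this
  let f : Space d × ℝ → Set (Space d) := fun h => hyperplane h.1 h.2
  -- Passing to hyperplanes as sets and choosing one equation for each removes duplicates;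
  -- normalization alone would still leave both `(n, c)` and `(-n, -c)`.
  let S : Finset (Set (Space d)) := (H.image N).image f
  have hS : ∀ P ∈ S, ∃ h ∈ H.image N, f h = P := fun P hP => Finset.mem_image.mp hP
  choose! r hrN hrf using hS
  refine ⟨S.image r, ho, hb, hreg, ?_, ?_, ?_⟩
  · intro h hh
    obtain ⟨P, hP, rfl⟩ := Finset.mem_image.mp hh
    obtain ⟨h', hh', he⟩ := Finset.mem_image.mp (hrN P hP)
    rw [← he]
    have : ‖h'.1‖ ≠ 0 := norm_ne_zero_iff.mpr (hH0 h' hh')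
    simp [N, norm_smul, this]
  · intro h hh h' hh' hne heq
    obtain ⟨P, hP, rfl⟩ := Finset.mem_image.mp hh
    obtain ⟨P', hP', rfl⟩ := Finset.mem_image.mp hh'
    have e : f (r P) = f (r P') := heq
    rw [hrf P hP, hrf P' hP'] at e
    exact hne (by rw [e])
  · intro x hx
    obtain ⟨h, hh, hxh⟩ := mem_iUnion₂.mp (hsub hx)
    have hP : f (N h) ∈ S := Finset.mem_image_of_mem _ (Finset.mem_image_of_mem _ hh)
    refine mem_iUnion₂.mpr ⟨r (f (N h)), Finset.mem_image_of_mem _ hP, ?_⟩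
    have : x ∈ f (N h) := by
      change x ∈ hyperplane (N h).1 (N h).2
      rw [hN h (hH0 h hh)]; exact hxh
    rw [← hrf _ hP] at this
    exact this

/-- The intersection of two distinct hyperplanes is negligible for the surface measure. -/
theorem surface_hyperplane_inter (hd : 0 < d) {n n' : Space d} {c c' : ℝ} (hn : ‖n‖ = 1)
    (hn' : ‖n'‖ = 1) (hne : hyperplane n c ≠ hyperplane n' c') :
    (μHE[d - 1] : Measure (Space d)) (hyperplane n c ∩ hyperplane n' c') = 0 := by
  obtain ⟨L, hL⟩ := exists_isNormalFrame hd hn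
  have hm := (isClosed_hyperplane n' c').measurableSet
  rw [inter_comm, ← Measure.restrict_apply hm, ← hL.map_param,
    Measure.map_apply (IsNormalFrame.isometry_param c).continuous.measurable hm]
  -- In the isometric parameters the second hyperplane becomes an affine subspace. It is null unless
  -- it is everything, and then the two normals are proportional and the hyperplanes coincide.
  let S : AffineSubspace ℝ (Space (d - 1)) :=
    { carrier := IsNormalFrame.param n L c ⁻¹' hyperplane n' c'
      smul_vsub_vadd_mem' := by
        intro t p₁ p₂ p₃ h₁ h₂ h₃
        simp only [mem_preimage, hyperplane, IsNormalFrame.param, mem_ofPred_eq, inner_add_right,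
          inner_smul_right] at h₁ h₂ h₃ ⊢
        simp only [vsub_eq_sub, vadd_eq_add, map_add, map_smul, map_sub, inner_add_right,
          inner_smul_right, inner_sub_right]
        linear_combination t * h₁ - t * h₂ + h₃ }
  have hS : S ≠ ⊤ := by
    intro htop
    have hall : ∀ y, inner ℝ n' (IsNormalFrame.param n L c y) = c' := fun y => by
      have : y ∈ S := htop ▸ AffineSubspace.mem_top ℝ _ y
      exact this
    have h0 : ∀ y, inner ℝ n' (L y) = 0 := fun y => by
      have h1 := hall y
      have h2 := hall 0
      simp only [IsNormalFrame.param, inner_add_right, map_zero, inner_zero_right] at h1 h2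
      linarith
    obtain ⟨y, hy⟩ := hL.exists_eq n'
    have hLy : L y = 0 := by
      have h1 := h0 y
      have h2 : inner ℝ n' (L y) = inner ℝ (L y) (L y) := by
        conv_lhs => rw [hy]
        rw [inner_add_left, real_inner_smul_left, hL.inner_eq]; simp
      rw [h2] at h1
      exact inner_self_eq_zero.mp h1
    rw [hLy, zero_add] at hy
    set a : ℝ := inner ℝ n n' with ha
    have ha0 : a ≠ 0 := by
      intro h; rw [h, zero_smul] at hy; rw [hy] at hn'; simp at hn'
    have hc : a * c = c' := by
      have := hall 0
      rw [hy, real_inner_smul_left, hL.inner_param] at this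
      exact this
    refine hne (Set.ext fun x => ?_)
    simp only [hyperplane, mem_ofPred_eq]
    rw [hy, real_inner_smul_left, ← hc]
    exact (mul_right_inj' ha0).symm
  exact Measure.addHaar_affineSubspace volume S hS

theorem surface_lt_top_of_isBounded (hd : 0 < d) {n : Space d} (c : ℝ) (hn : ‖n‖ = 1)
    {S : Set (Space d)} (hS : Bornology.IsBounded S) :
    (μHE[d - 1] : Measure (Space d)) (S ∩ hyperplane n c) < ⊤ := by
  obtain ⟨L, hL⟩ := exists_isNormalFrame hd hn
  obtain ⟨R, hR⟩ := hS.subset_closedBall 0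
  refine (measure_mono (inter_subset_inter_left _ hR)).trans_lt ?_
  have hm : MeasurableSet (Metric.closedBall (0 : Space d) R) := measurableSet_closedBall
  rw [← Measure.restrict_apply hm, ← hL.map_param,
    Measure.map_apply (IsNormalFrame.isometry_param c).continuous.measurable hm]
  exact ((IsNormalFrame.isometry_param c).antilipschitz.isBounded_preimage
    Metric.isBounded_closedBall).measure_lt_top

namespace IsBoundedBy

variable {H : Finset (Space d × ℝ)}

theorem isBounded_frontier (hU : IsBoundedBy U H) : Bornology.IsBounded (frontier U) :=
  hU.isBounded.closure.subset frontier_subset_closure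

theorem surface_frontier_lt_top (hU : IsBoundedBy U H) (hd : 0 < d) :
    (μHE[d - 1] : Measure (Space d)) (frontier U) < ⊤ := by
  have : frontier U ⊆ ⋃ h ∈ H, frontier U ∩ hyperplane h.1 h.2 := fun x hx => by
    obtain ⟨h, hh, hxh⟩ := mem_iUnion₂.mp (hU.subset hx)
    exact mem_iUnion₂.mpr ⟨h, hh, hx, hxh⟩
  refine (measure_mono this).trans_lt ((measure_biUnion_finset_le _ _).trans_lt ?_)
  exact ENNReal.sum_lt_top.mpr fun h hh =>
    surface_lt_top_of_isBounded hd h.2 (hU.unit h hh) hU.isBounded_frontier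

/-- The boundary points on a single hyperplane are flat. -/
theorem exists_isOutwardNormal (hU : IsBoundedBy U H) {h : Space d × ℝ} (hh : h ∈ H) {y : Space d}
    (hy : y ∈ frontier U) (hyh : y ∈ hyperplane h.1 h.2)
    (hgen : ∀ h' ∈ H, h' ≠ h → y ∉ hyperplane h'.1 h'.2) :
    IsOutwardNormal U y h.1 ∨ IsOutwardNormal U y (-h.1) := by
  classical
  set O : Set (Space d) := ⋂ h' ∈ H.erase h, (hyperplane h'.1 h'.2)ᶜ with hO
  have hOo : IsOpen O := isOpen_biInter_finset fun h' _ => (isClosed_hyperplane _ _).isOpen_compl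
  have hyO : y ∈ O := mem_iInter₂.mpr fun h' hh' =>
    hgen h' (Finset.mem_of_mem_erase hh') (Finset.ne_of_mem_erase hh')
  obtain ⟨r, hr, hball⟩ := Metric.isOpen_iff.mp hOo y hyO
  have hfr : ∀ x ∈ Metric.ball y r, x ∈ frontier U → inner ℝ h.1 x = h.2 := by
    intro x hx hxF
    obtain ⟨h', hh', hxh'⟩ := mem_iUnion₂.mp (hU.subset hxF)
    by_cases he : h' = h
    · rw [he] at hxh'; exact hxh'
    · exact absurd hxh' (mem_iInter₂.mp (hball hx) h' (Finset.mem_erase.mpr ⟨he, hh'⟩))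
  have hlin : IsLinearMap ℝ fun x : Space d => inner ℝ h.1 x :=
    ⟨fun x z => inner_add_right _ _ _, fun a x => inner_smul_right _ _ _⟩
  -- Near `y` the frontier is contained in one hyperplane, so each open half-ball lies wholly inside
  -- or wholly outside `U`. The two mixed cases give the two possible normals.
  set P := Metric.ball y r ∩ {x | h.2 < inner ℝ h.1 x} with hP
  set N := Metric.ball y r ∩ {x | inner ℝ h.1 x < h.2} with hN
  have hPc : IsPreconnected P := ((convex_ball y r).inter (convex_halfSpace_gt hlin _)).isPreconnected
  have hNc : IsPreconnected N := ((convex_ball y r).inter (convex_halfSpace_lt hlin _)).isPreconnected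
  have hPF : Disjoint P (frontier U) := disjoint_left.mpr fun x hx hxF =>
    (ne_of_gt hx.2) (hfr x hx.1 hxF)
  have hNF : Disjoint N (frontier U) := disjoint_left.mpr fun x hx hxF =>
    (ne_of_lt hx.2) (hfr x hx.1 hxF)
  have hnear : ∀ x ∈ Metric.ball y r, ∀ s : ℝ, ∀ᶠ ε in 𝓝[>] (0 : ℝ),
      x + ε • s • h.1 ∈ Metric.ball y r := fun x hx s => by
    have hcont : Continuous fun ε : ℝ => x + ε • s • h.1 := by fun_prop
    refine (hcont.tendsto 0).mono_left nhdsWithin_le_nhds (Metric.isOpen_ball.mem_nhds ?_)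
    simpa using hx
  have hinner : ∀ x (ε s : ℝ), inner ℝ h.1 (x + ε • s • h.1) = inner ℝ h.1 x + ε * s := by
    intro x ε s
    rw [inner_add_right, inner_smul_right, inner_smul_right, real_inner_self_eq_norm_sq,
      hU.unit h hh]; ring
  by_cases h1 : (P ∩ U).Nonempty
  · have hPU := subset_of_isPreconnected_of_disjoint_frontier hPc hPF h1
    by_cases h2 : (N ∩ U).Nonempty
    · have hNU := subset_of_isPreconnected_of_disjoint_frontier hNc hNF h2
      -- With both halves inside, `y` would lie on a slit; this is excluded by `U` being the
      -- interior of its closure.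
      have hcl : Metric.ball y r ⊆ closure U := by
        intro x hx
        rcases lt_trichotomy (inner ℝ h.1 x) h.2 with h3 | h3 | h3
        · exact subset_closure (hNU ⟨hx, h3⟩)
        · have hcont : Continuous fun ε : ℝ => x + ε • (1 : ℝ) • h.1 := by fun_prop
          have ht : Tendsto (fun ε : ℝ => x + ε • (1 : ℝ) • h.1) (𝓝[>] 0) (𝓝 x) :=
            (by simpa using hcont.tendsto 0 :
              Tendsto (fun ε : ℝ => x + ε • (1 : ℝ) • h.1) (𝓝 0) (𝓝 x)).mono_left nhdsWithin_le_nhds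
          refine mem_closure_of_tendsto ht ?_
          filter_upwards [hnear x hx 1, self_mem_nhdsWithin] with ε hε hε0
          refine hPU ⟨hε, ?_⟩
          have : 0 < ε := hε0
          simp only [mem_ofPred_eq, hinner, h3]; linarith
        · exact subset_closure (hPU ⟨hx, h3⟩)
      have : y ∈ interior (closure U) :=
        mem_interior.mpr ⟨_, hcl, Metric.isOpen_ball, Metric.mem_ball_self hr⟩
      rw [hU.regular] at this
      exact absurd this (hU.isOpen.frontier_eq ▸ hy).2
    · right
      refine isOutwardNormal_of_half (c := -h.2) hU.isOpen (by rw [norm_neg, hU.unit h hh]) hr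
        (by rw [inner_neg_left]; exact congrArg _ hyh) (fun x hx hlt => hPU ⟨hx, ?_⟩)
        (fun x hx hlt hxU => h2 ⟨x, ⟨hx, ?_⟩, hxU⟩)
      · rw [inner_neg_left] at hlt; simp only [mem_ofPred_eq]; linarith
      · rw [inner_neg_left] at hlt; simp only [mem_ofPred_eq]; linarith
  · by_cases h2 : (N ∩ U).Nonempty
    · have hNU := subset_of_isPreconnected_of_disjoint_frontier hNc hNF h2
      left
      exact isOutwardNormal_of_half hU.isOpen (hU.unit h hh) hr hyh
        (fun x hx hlt => hNU ⟨hx, hlt⟩) (fun x hx hlt hxU => h1 ⟨x, ⟨hx, hlt⟩, hxU⟩)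
    -- With both halves outside, `y` could not be approached from `U`: a point of `U` on the
    -- hyperplane itself would force nearby points of the upper half into the open set `U`.
    · exfalso
      obtain ⟨x, hxU, hdist⟩ := Metric.mem_closure_iff.mp hy.1 r hr
      have hx : x ∈ Metric.ball y r := by rwa [Metric.mem_ball, dist_comm]
      rcases lt_trichotomy (inner ℝ h.1 x) h.2 with h3 | h3 | h3
      · exact h2 ⟨x, ⟨hx, h3⟩, hxU⟩
      · have hcont : Continuous fun ε : ℝ => x + ε • (1 : ℝ) • h.1 := by fun_prop
        have hmem : ∀ᶠ ε in 𝓝[>] (0 : ℝ), x + ε • (1 : ℝ) • h.1 ∈ U := by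
          refine (hcont.tendsto 0).mono_left nhdsWithin_le_nhds (hU.isOpen.mem_nhds ?_)
          simpa using hxU
        obtain ⟨ε, ⟨hε1, hε2⟩, hε0⟩ := ((hmem.and (hnear x hx 1)).and self_mem_nhdsWithin).exists
        refine h1 ⟨_, ⟨hε2, ?_⟩, hε1⟩
        have : 0 < ε := hε0
        simp only [mem_ofPred_eq, hinner, h3]; linarith
      · exact h1 ⟨x, ⟨hx, h3⟩, hxU⟩

/-- Almost every boundary point lies on a single hyperplane of the family. -/
theorem ae_generic (hU : IsBoundedBy U H) (hd : 0 < d) :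
    ∀ᵐ y ∂(μHE[d - 1] : Measure (Space d)), ∀ h ∈ H, y ∈ hyperplane h.1 h.2 →
      ∀ h' ∈ H, h' ≠ h → y ∉ hyperplane h'.1 h'.2 := by
  refine (eventually_all_finset H).mpr fun h hh => ?_
  have : ∀ h' ∈ H, ∀ᵐ y ∂(μHE[d - 1] : Measure (Space d)),
      y ∈ hyperplane h.1 h.2 → h' ≠ h → y ∉ hyperplane h'.1 h'.2 := by
    intro h' hh'
    by_cases he : h' = h
    · exact .of_forall fun y _ hne => absurd he hne
    · rw [ae_iff]
      refine measure_mono_null ?_ (surface_hyperplane_inter hd (hU.unit h hh) (hU.unit h' hh')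
        (hU.distinct h hh h' hh' (Ne.symm he)))
      intro y hy
      simp only [mem_ofPred_eq, Classical.not_imp, not_not] at hy
      exact ⟨hy.1, hy.2.2⟩
  filter_upwards [(eventually_all_finset H).mpr this] with y hy hyh h' hh' hne
  exact hy h' hh' hyh hne

theorem ae_exists_isOutwardNormal (hU : IsBoundedBy U H) (hd : 0 < d) :
    ∀ᵐ y ∂(μHE[d - 1] : Measure (Space d)), y ∈ frontier U → ∃ m, IsOutwardNormal U y m := by
  filter_upwards [hU.ae_generic hd] with y hy hyF
  obtain ⟨h, hh, hyh⟩ := mem_iUnion₂.mp (hU.subset hyF)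
  rcases hU.exists_isOutwardNormal hh hyF hyh (hy h hh hyh) with h1 | h1
  · exact ⟨_, h1⟩
  · exact ⟨_, h1⟩

end IsBoundedBy

end polytopes

/-! ### Covering the faces by cylinders of uniform height. -/

section cylinders

variable {d : ℕ} {U : Set (Space d)} {H : Finset (Space d × ℝ)}

theorem IsNormalFrame.volume_hyperplane {n : Space d} {L : Space (d - 1) →ₗᵢ[ℝ] Space d}
    (hL : IsNormalFrame n L) (c : ℝ) : (volume : Measure (Space d)) (hyperplane n c) = 0 := by
  have hcont : Continuous (spaceCoord L n) := LinearMap.continuous_of_finiteDimensional _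
  rw [← hL.map_spaceCoord_self, Measure.map_apply hcont.measurable
    (isClosed_hyperplane n c).measurableSet]
  have : spaceCoord L n ⁻¹' hyperplane n c = univ ×ˢ {c} := by
    ext ⟨y, s⟩
    simp [hyperplane, spaceCoord_apply, inner_add_right, hL.inner_eq, inner_smul_right, hL.norm_eq]
  rw [this, Measure.prod_prod, Real.volume_singleton, mul_zero]

/-- Around each `y₀` of a finite net of `S`, the direction `x₀ - y₀` carries every nearby point of
`closure C` into the ball about `x₀`. By convexity the half-open segment from a point of the closure
to an interior point stays in `C`. -/
theorem exists_cylinders_of_convex {C : Set (Space d)} (hCne : C.Nonempty) (hCo : IsOpen C)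
    (hCc : Convex ℝ C) {S : Set (Space d)} (hS : IsCompact S) (hSC : S ⊆ closure C) :
    ∃ I : Set (Space d × Set (Space d)), I.Finite ∧
      (∀ p ∈ I, (∃ y ∈ S, y + p.1 ∈ C) ∧ MeasurableSet p.2 ∧
        ∀ y ∈ p.2, ∀ s ∈ Ioc (0 : ℝ) 1, y + s • p.1 ∈ C) ∧ S ⊆ ⋃ p ∈ I, p.2 := by
  obtain ⟨x₀, hx₀⟩ := hCne
  obtain ⟨ρ, hρ, hball⟩ := Metric.isOpen_iff.mp hCo x₀ hx₀
  obtain ⟨t, htS, htfin, htcov⟩ := hS.finite_cover_balls hρ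
  refine ⟨(fun y => (x₀ - y, Metric.ball y ρ ∩ closure C)) '' t, htfin.image _, ?_, ?_⟩
  · rintro p ⟨y₀, hy₀, rfl⟩
    refine ⟨⟨y₀, htS hy₀, by simpa using hx₀⟩,
      measurableSet_ball.inter isClosed_closure.measurableSet, fun y hy s hs => ?_⟩
    have hw : x₀ + (y - y₀) ∈ interior C := by
      rw [hCo.interior_eq]
      refine hball ?_
      have := hy.1
      rw [Metric.mem_ball, dist_eq_norm] at this ⊢
      simpa using this
    have := hCc.combo_interior_closure_mem_interior hw hy.2 hs.1 (sub_nonneg.mpr hs.2)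
      (by ring : s + (1 - s) = 1)
    rw [hCo.interior_eq] at this
    convert this using 1
    module
  · intro y hy
    obtain ⟨y₀, hy₀, hyy⟩ := mem_iUnion₂.mp (htcov hy)
    exact mem_iUnion₂.mpr ⟨_, ⟨y₀, hy₀, rfl⟩, hyy, hSC hy⟩

namespace IsBoundedBy

/-- The hyperplanes cut the polytope into finitely many convex cells. -/
theorem exists_cells (hU : IsBoundedBy U H) (hd : 0 < d) :
    ∃ 𝒞 : Set (Set (Space d)), 𝒞.Finite ∧
      (∀ C ∈ 𝒞, C.Nonempty ∧ IsOpen C ∧ Convex ℝ C ∧ C ⊆ U ∧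
        ∀ h ∈ H, Disjoint C (hyperplane h.1 h.2)) ∧ closure U ⊆ ⋃ C ∈ 𝒞, closure C := by
  classical
  let cell : Finset (Space d × ℝ) → Set (Space d) := fun S =>
    ⋂ h ∈ H, if h ∈ S then {x | h.2 < inner ℝ h.1 x} else {x | inner ℝ h.1 x < h.2}
  have hlin : ∀ n : Space d, IsLinearMap ℝ fun x : Space d => inner ℝ n x := fun n =>
    ⟨fun x z => inner_add_right _ _ _, fun a x => inner_smul_right _ _ _⟩
  have hopen : ∀ S, IsOpen (cell S) := fun S => isOpen_biInter_finset fun h _ => by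
    split_ifs
    · exact isOpen_lt continuous_const (by fun_prop)
    · exact isOpen_lt (by fun_prop) continuous_const
  have hconv : ∀ S, Convex ℝ (cell S) := fun S => convex_iInter₂ fun h _ => by
    split_ifs
    · exact convex_halfSpace_gt (hlin _) _
    · exact convex_halfSpace_lt (hlin _) _
  have hdisj : ∀ S, ∀ h ∈ H, Disjoint (cell S) (hyperplane h.1 h.2) := fun S h hh =>
    disjoint_left.mpr fun x hx hxh => by
      have h1 := mem_iInter₂.mp hx h hh
      have h2 : inner ℝ h.1 x = h.2 := hxh
      split_ifs at h1
      · exact (ne_of_gt h1) h2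
      · exact (ne_of_lt h1) h2
  refine ⟨{C | C ∈ cell '' (H.powerset : Set (Finset (Space d × ℝ))) ∧ C.Nonempty ∧ C ⊆ U},
    ((Finset.finite_toSet _).image cell).subset fun C hC => hC.1, ?_, ?_⟩
  · rintro C ⟨⟨S, -, rfl⟩, hne, hsub⟩
    exact ⟨hne, hopen S, hconv S, hsub, hdisj S⟩
  · have hfin : {C | C ∈ cell '' (H.powerset : Set (Finset (Space d × ℝ))) ∧ C.Nonempty ∧
        C ⊆ U}.Finite := ((Finset.finite_toSet _).image cell).subset fun C hC => hC.1
    -- The hyperplanes are null, so the points off all of them are dense. Such a point of `U` lies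
    -- in the cell of its signs, and the closures of finitely many cells then cover `closure U`.
    have hae : ∀ᵐ x : Space d, ∀ h ∈ H, x ∉ hyperplane h.1 h.2 :=
      (eventually_all_finset H).mpr fun h hh => by
        obtain ⟨L, hL⟩ := exists_isNormalFrame hd (hU.unit h hh)
        exact measure_eq_zero_iff_ae_notMem.mp (hL.volume_hyperplane h.2)
    have hdense := Measure.dense_of_ae hae
    rw [← hfin.closure_biUnion]
    refine closure_minimal ((hdense.open_subset_closure_inter hU.isOpen).trans
      (closure_mono fun x hx => ?_)) isClosed_closure
    have hxS : x ∈ cell (H.filter fun h => h.2 < inner ℝ h.1 x) := by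
      refine mem_iInter₂.mpr fun h hh => ?_
      by_cases hlt : h.2 < inner ℝ h.1 x
      · rw [if_pos (Finset.mem_filter.mpr ⟨hh, hlt⟩)]; exact hlt
      · have hnmem : h ∉ H.filter fun h => h.2 < inner ℝ h.1 x := fun hmem =>
          hlt (Finset.mem_filter.mp hmem).2
        rw [if_neg hnmem]
        exact lt_of_le_of_ne (not_lt.mp hlt) (hx.2 h hh)
    refine mem_iUnion₂.mpr ⟨_, ⟨⟨_, Finset.mem_coe.mpr (Finset.mem_powerset.mpr
      (Finset.filter_subset _ H)), rfl⟩, ⟨x, hxS⟩, ?_⟩, hxS⟩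
    refine subset_of_isPreconnected_of_disjoint_frontier (hconv _).isPreconnected ?_ ⟨x, hxS, hx.1⟩
    refine disjoint_left.mpr fun y hy hyF => ?_
    obtain ⟨h, hh, hyh⟩ := mem_iUnion₂.mp (hU.subset hyF)
    exact disjoint_left.mp (hdisj _ h hh) hy hyh

/-- The faces on a hyperplane are covered by finitely many bases of cylinders contained in the
polytope, with directions transversal to the hyperplane. -/
theorem exists_cylinders (hU : IsBoundedBy U H) (hd : 0 < d) {h : Space d × ℝ} (hh : h ∈ H) :
    ∃ I : Set (Space d × Set (Space d)), I.Finite ∧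
      (∀ p ∈ I, inner ℝ h.1 p.1 ≠ 0 ∧ MeasurableSet p.2 ∧
        ∀ y ∈ p.2, ∀ s ∈ Ioc (0 : ℝ) 1, y + s • p.1 ∈ U) ∧
      frontier U ∩ hyperplane h.1 h.2 ⊆ ⋃ p ∈ I, p.2 := by
  obtain ⟨𝒞, hfin, h𝒞, hcov⟩ := hU.exists_cells hd
  have hcomp : ∀ C : Set (Space d), IsCompact (frontier U ∩ hyperplane h.1 h.2 ∩ closure C) :=
    fun C => ((Metric.isCompact_of_isClosed_isBounded isClosed_frontier
      hU.isBounded_frontier).inter_right (isClosed_hyperplane _ _)).inter_right isClosed_closure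
  have key : ∀ C ∈ 𝒞, ∃ I : Set (Space d × Set (Space d)), I.Finite ∧
      (∀ p ∈ I, (∃ y ∈ frontier U ∩ hyperplane h.1 h.2 ∩ closure C, y + p.1 ∈ C) ∧
        MeasurableSet p.2 ∧ ∀ y ∈ p.2, ∀ s ∈ Ioc (0 : ℝ) 1, y + s • p.1 ∈ C) ∧
      frontier U ∩ hyperplane h.1 h.2 ∩ closure C ⊆ ⋃ p ∈ I, p.2 := fun C hC =>
    exists_cylinders_of_convex (h𝒞 C hC).1 (h𝒞 C hC).2.1 (h𝒞 C hC).2.2.1 (hcomp C)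
      inter_subset_right
  choose! I hI1 hI2 hI3 using key
  refine ⟨⋃ C ∈ 𝒞, I C, hfin.biUnion hI1, ?_, ?_⟩
  · intro p hp
    obtain ⟨C, hC, hpC⟩ := mem_iUnion₂.mp hp
    obtain ⟨⟨y, hy, hyC⟩, hm, hseg⟩ := hI2 C hC p hpC
    -- A direction parallel to the hyperplane would keep the base point `y` on it, whereas `y + p.1`
    -- lies in a cell disjoint from it.
    refine ⟨fun h0 => ?_, hm, fun y hy s hs => (h𝒞 C hC).2.2.2.1 (hseg y hy s hs)⟩
    refine disjoint_left.mp ((h𝒞 C hC).2.2.2.2 h hh) hyC ?_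
    have : inner ℝ h.1 y = h.2 := hy.1.2
    change inner ℝ h.1 (y + p.1) = h.2
    rw [inner_add_right, h0, this, add_zero]
  · intro y hy
    obtain ⟨C, hC, hyC⟩ := mem_iUnion₂.mp (hcov (frontier_subset_closure hy.1))
    obtain ⟨p, hp, hyp⟩ := mem_iUnion₂.mp (hI3 C hC ⟨hy, hyC⟩)
    exact mem_iUnion₂.mpr ⟨p, mem_iUnion₂.mpr ⟨C, hC, hp⟩, hyp⟩

end IsBoundedBy

end cylinders

/-! ### Traces on the lateral boundary of a prism. -/

section lateral

variable {d : ℕ} {n : Space d} {L : Space (d - 1) →ₗᵢ[ℝ] Space d}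

/-- Linear coordinates `((y, t), s) ↦ (L y + s v, t)` on space--time. -/
def lateralCoord (hL : IsNormalFrame n L) {v : Space d} (hv : inner ℝ n v ≠ 0) :
    (SpaceTime (d - 1) × ℝ) ≃L[ℝ] SpaceTime d :=
  (LinearEquiv.ofBijective
    (((IsNormalFrame.spaceCoord L v).comp
      ((LinearMap.fst ℝ (Space (d - 1)) ℝ).prodMap LinearMap.id)).prod
      ((LinearMap.snd ℝ (Space (d - 1)) ℝ).comp (LinearMap.fst ℝ (SpaceTime (d - 1)) ℝ)))
    ⟨by
      rintro ⟨⟨y, t⟩, s⟩ ⟨⟨y', t'⟩, s'⟩ h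
      have h1 := congrArg Prod.fst h
      have h2 := congrArg Prod.snd h
      have h3 := hL.spaceCoord_injective hv h1
      simp only [LinearMap.prodMap_apply, LinearMap.fst_apply, LinearMap.id_apply,
        Prod.mk.injEq] at h3
      have h4 : t = t' := h2
      rw [h3.1, h3.2, h4], by
      rintro ⟨x, t⟩
      obtain ⟨⟨y, s⟩, h⟩ := hL.spaceCoord_surjective hv x
      exact ⟨((y, t), s), Prod.ext h rfl⟩⟩).toContinuousLinearEquiv

theorem lateralCoord_apply (hL : IsNormalFrame n L) {v : Space d} (hv : inner ℝ n v ≠ 0)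
    (q : SpaceTime (d - 1) × ℝ) : lateralCoord hL hv q = (L q.1.1 + q.2 • v, q.1.2) := by
  have : lateralCoord hL hv q = (IsNormalFrame.spaceCoord L v (q.1.1, q.2), q.1.2) := rfl
  rw [this, IsNormalFrame.spaceCoord_apply]

theorem lateralCoord_dir (hL : IsNormalFrame n L) {v : Space d} (hv : inner ℝ n v ≠ 0) :
    lateralCoord hL hv (0, 1) = (v, 0) := by
  rw [lateralCoord_apply]; simp

theorem chart_lateralCoord (hL : IsNormalFrame n L) {v : Space d} (hv : inner ℝ n v ≠ 0) (c : ℝ)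
    (z : SpaceTime (d - 1)) (s : ℝ) :
    chart (lateralCoord hL hv) (c • n, 0) (z, s) = (IsNormalFrame.param n L c z.1 + s • v, z.2) := by
  rw [chart, lateralCoord_apply]
  simp [IsNormalFrame.param, add_assoc]

/-- Near a flat point `U` is a half-space. Moving the base point along the face does not change the
side, so membership depends only on the sign of `s`; the condition on `v` makes positive `s` the
inner side. -/
theorem isRegularPoint_lateral (hL : IsNormalFrame n L) {v : Space d} (hv : inner ℝ n v ≠ 0)
    {c a b : ℝ} {U : Set (Space d)} {z : SpaceTime (d - 1)} {m : Space d}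
    (hm : IsOutwardNormal U (IsNormalFrame.param n L c z.1) m) (hmn : m = n ∨ m = -n)
    (hmv : inner ℝ v m < 0) (hz : z.2 ∈ Ioo a b) :
    IsRegularPoint (lateralCoord hL hv) (c • n, 0) (U ×ˢ Ioo a b) z := by
  obtain ⟨-, r, hr, hU⟩ := hm
  have hLm : ∀ y, inner ℝ (L y) m = 0 := fun y => by
    rcases hmn with rfl | rfl
    · rw [real_inner_comm]; exact hL.inner_eq y
    · rw [inner_neg_right, real_inner_comm, hL.inner_eq, neg_zero]
  -- Half of the radius is spent on the displacement along the face and half on `s • v`.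
  have hpos : 0 < r / 2 / (‖v‖ + 1) := by positivity
  have hside : ∀ y ∈ Metric.ball z.1 (r / 2), ∀ s : ℝ, |s| ≤ r / 2 / (‖v‖ + 1) →
      (IsNormalFrame.param n L c y + s • v ∈ U ↔ 0 < s) := by
    intro y hy s hs
    have e : IsNormalFrame.param n L c y + s • v - IsNormalFrame.param n L c z.1
        = L (y - z.1) + s • v := by
      simp only [IsNormalFrame.param, map_sub]; abel
    rw [hU, e, inner_add_left, hLm, real_inner_smul_left, zero_add]
    · constructor
      · intro h; by_contra hle; nlinarith
      · intro h; nlinarith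
    · rw [Metric.mem_ball, dist_eq_norm, e]
      have h1 : ‖L (y - z.1)‖ < r / 2 := by
        rw [L.norm_map, ← dist_eq_norm]; exact hy
      have h2 : ‖s • v‖ ≤ r / 2 := by
        rw [norm_smul, Real.norm_eq_abs]
        calc |s| * ‖v‖ ≤ r / 2 / (‖v‖ + 1) * (‖v‖ + 1) := by gcongr; linarith
          _ = r / 2 := by field_simp
      exact (norm_add_le _ _).trans_lt (by linarith)
  refine ⟨Metric.ball z.1 (r / 2) ×ˢ Ioo a b,
    prod_mem_nhds (Metric.ball_mem_nhds _ (by positivity)) (Ioo_mem_nhds hz.1 hz.2),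
    r / 2 / (‖v‖ + 1), hpos, fun y hy s hs => ?_, fun y hy s hs => ?_⟩
  · rw [chart_lateralCoord]
    exact ⟨(hside y.1 hy.1 s (by rw [abs_of_pos hs.1]; exact hs.2.le)).mpr hs.1, hy.2⟩
  · rw [chart_lateralCoord]
    intro hmem
    have := (hside y.1 hy.1 s (by rw [abs_of_nonpos hs.2]; linarith [hs.1])).mp hmem.1
    exact hs.2.not_gt this

end lateral

theorem memLp_two_biUnion {X ι : Type*} [MeasurableSpace X] {μ : Measure X} {f : X → ℂ}
    {I : Set ι} (hI : I.Finite) {s : ι → Set X} (h : ∀ i ∈ I, MemLp f 2 (μ.restrict (s i))) :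
    MemLp f 2 (μ.restrict (⋃ i ∈ I, s i)) := by
  have hm : AEStronglyMeasurable f (μ.restrict (⋃ i ∈ I, s i)) := by
    have : Countable I := hI.countable.to_subtype
    rw [biUnion_eq_iUnion]
    exact AEStronglyMeasurable.iUnion fun i => (h i i.2).aestronglyMeasurable
  refine (memLp_two_iff_integrable_sq_norm hm).mpr ?_
  exact (integrableOn_finite_biUnion hI).mpr fun i hi =>
    (memLp_two_iff_integrable_sq_norm (h i hi).aestronglyMeasurable).mp (h i hi)

/-- The cylinders have oblique directions, while the local space provides derivatives only along the
coordinate axes. -/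
theorem IsWeakDeriv.sum_dir {d : ℕ} {K : Set (SpaceTime d)} {u : SpaceTime d → ℂ}
    {g : Fin d → SpaceTime d → ℂ} (hg : ∀ j, IntegrableOn (g j) K) (hu : IntegrableOn u K)
    (h : ∀ j, IsWeakDeriv K (spaceDir j) u (g j)) (v : Space d) :
    IsWeakDeriv K (v, 0) u (fun p => ∑ j, (v j : ℂ) * g j p) := by
  intro φ h1 h2 h3
  have hv : ((v, 0) : SpaceTime d) = ∑ j, v j • spaceDir j := by
    refine Prod.ext ?_ ?_
    · rw [Prod.fst_sum]
      ext i
      simp [spaceDir, Finset.sum_apply, Pi.single_apply]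
    · rw [Prod.snd_sum]; simp [spaceDir]
  obtain ⟨C, hC⟩ := h1.continuous.bounded_above_of_compact_support h2
  have hbd : ∀ {f : SpaceTime d → ℂ} {ψ : SpaceTime d → ℝ}, IntegrableOn f K → Continuous ψ →
      HasCompactSupport ψ → IntegrableOn (fun p => f p * ((ψ p : ℝ) : ℂ)) K := by
    intro f ψ hf hψ hψc
    obtain ⟨C, hC⟩ := hψ.bounded_above_of_compact_support hψc
    exact hf.mul_bdd (c := C) (Complex.continuous_ofReal.comp hψ).aestronglyMeasurable
      (.of_forall fun x => by rw [Complex.norm_real]; exact hC x)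
  have e1 : ∀ p, u p * ((fderiv ℝ φ p (v, 0) : ℝ) : ℂ)
      = ∑ j, (v j : ℂ) * (u p * ((fderiv ℝ φ p (spaceDir j) : ℝ) : ℂ)) := by
    intro p
    rw [hv, map_sum, Complex.ofReal_sum, Finset.mul_sum]
    refine Finset.sum_congr rfl fun j _ => ?_
    rw [map_smul, smul_eq_mul, Complex.ofReal_mul]; ring
  have e2 : ∀ p, (∑ j, (v j : ℂ) * g j p) * ((φ p : ℝ) : ℂ)
      = ∑ j, (v j : ℂ) * (g j p * ((φ p : ℝ) : ℂ)) := by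
    intro p
    rw [Finset.sum_mul]
    exact Finset.sum_congr rfl fun j _ => by ring
  simp_rw [e1, e2]
  rw [integral_finsetSum _ fun j _ => ?_, integral_finsetSum _ fun j _ => ?_,
    ← Finset.sum_neg_distrib]
  · refine Finset.sum_congr rfl fun j _ => ?_
    rw [integral_const_mul, integral_const_mul, h j φ h1 h2 h3, mul_neg]
  · exact (hbd (hg j) h1.continuous h2).const_mul _
  · exact (hbd hu ((h1.continuous_fderiv (by simp)).clm_apply continuous_const)
      (h2.fderiv_apply ℝ _)).const_mul _

section lateralTrace

variable {d : ℕ} {U : Set (Space d)} {H : Finset (Space d × ℝ)} {a b : ℝ}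

/-- The surface measure on `∂U × (a, b)`. -/
def lateralSurface (U : Set (Space d)) (a b : ℝ) : Measure (SpaceTime d) :=
  ((μHE[d - 1] : Measure (Space d)).restrict (frontier U)).prod (volume.restrict (Ioo a b))

/-- The parametrization of `hyperplane × ℝ`. -/
def lateralParam (n : Space d) (L : Space (d - 1) →ₗᵢ[ℝ] Space d) (c : ℝ) :
    SpaceTime (d - 1) → SpaceTime d := Prod.map (IsNormalFrame.param n L c) id

theorem measurableEmbedding_lateralParam (n : Space d) (L : Space (d - 1) →ₗᵢ[ℝ] Space d) (c : ℝ) :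
    MeasurableEmbedding (lateralParam n L c) :=
  ((IsNormalFrame.isometry_param (n := n) (L := L) c).isClosedEmbedding.prodMap
    Topology.IsClosedEmbedding.id).measurableEmbedding

theorem IsBoundedBy.isFiniteMeasure_surface (hU : IsBoundedBy U H) (hd : 0 < d) :
    IsFiniteMeasure ((μHE[d - 1] : Measure (Space d)).restrict (frontier U)) :=
  ⟨by rw [Measure.restrict_apply_univ]; exact hU.surface_frontier_lt_top hd⟩

theorem IsBoundedBy.volume_lt_top (hU : IsBoundedBy U H) (a b : ℝ) :
    volume (U ×ˢ Ioo a b : Set (SpaceTime d)) < ⊤ :=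
  (hU.isBounded.prod (Metric.isBounded_Ioo a b)).measure_lt_top

theorem lateralSurface_restrict_hyperplane (hU : IsBoundedBy U H) {n : Space d}
    {L : Space (d - 1) →ₗᵢ[ℝ] Space d} (hL : IsNormalFrame n L) (c : ℝ) :
    (lateralSurface U a b).restrict (hyperplane n c ×ˢ univ) = Measure.map (lateralParam n L c)
      (volume.restrict (lateralParam n L c ⁻¹' (frontier U ×ˢ Ioo a b))) := by
  have := hU.isFiniteMeasure_surface hL.pos
  have hm := (IsNormalFrame.isometry_param (n := n) (L := L) c).continuous.measurable
  have hmF : MeasurableSet (frontier U) := isClosed_frontier.measurableSet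
  rw [lateralSurface, ← Measure.prod_restrict, Measure.restrict_univ,
    Measure.restrict_restrict (isClosed_hyperplane n c).measurableSet, inter_comm,
    ← Measure.restrict_restrict hmF, ← hL.map_param, Measure.restrict_map hm hmF]
  have e : lateralParam n L c ⁻¹' (frontier U ×ˢ Ioo a b)
      = (IsNormalFrame.param n L c ⁻¹' frontier U) ×ˢ Ioo a b := rfl
  rw [e, Measure.volume_eq_prod, ← Measure.prod_restrict, lateralParam,
    ← Measure.map_prod_map _ _ hm measurable_id, Measure.map_id]

theorem lateralSurface_eq_restrict (hU : IsBoundedBy U H) (hd : 0 < d) :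
    (lateralSurface U a b).restrict (⋃ h ∈ (H : Set (Space d × ℝ)), hyperplane h.1 h.2 ×ˢ univ)
      = lateralSurface U a b := by
  have := hU.isFiniteMeasure_surface hd
  refine Measure.restrict_eq_self_of_ae_mem ?_
  have h1 : ∀ᵐ y ∂(μHE[d - 1] : Measure (Space d)).restrict (frontier U), y ∈ frontier U :=
    ae_restrict_mem isClosed_frontier.measurableSet
  have hq : Measure.QuasiMeasurePreserving Prod.fst (lateralSurface U a b)
    ((μHE[d - 1] : Measure (Space d)).restrict (frontier U)) :=
    Measure.quasiMeasurePreserving_fst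
  filter_upwards [hq.ae h1] with p hp
  obtain ⟨h, hh, hyh⟩ := mem_iUnion₂.mp (hU.subset hp)
  exact mem_iUnion₂.mpr ⟨h, hh, hyh, mem_univ _⟩

/-- Each hyperplane is parametrized isometrically, so an almost-everywhere statement on the lateral
surface splits into one Lebesgue statement for each face. -/
theorem ae_lateralSurface (hU : IsBoundedBy U H) (hd : 0 < d) {P : SpaceTime d → Prop}
    (h : ∀ h ∈ H, ∀ L, IsNormalFrame h.1 L → ∀ᵐ z : SpaceTime (d - 1),
      lateralParam h.1 L h.2 z ∈ frontier U ×ˢ Ioo a b → P (lateralParam h.1 L h.2 z)) :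
    ∀ᵐ p ∂(lateralSurface U a b), P p := by
  rw [← lateralSurface_eq_restrict hU hd, ae_restrict_biUnion_iff _ H.countable_toSet]
  intro h' hh'
  obtain ⟨L, hL⟩ := exists_isNormalFrame hd (hU.unit h' hh')
  rw [lateralSurface_restrict_hyperplane hU hL,
    (measurableEmbedding_lateralParam _ _ _).ae_map_iff, ae_restrict_iff'
      ((measurableEmbedding_lateralParam _ _ _).measurable
        (isClosed_frontier.measurableSet.prod measurableSet_Ioo))]
  exact h h' hh' L hL

/-- In the coordinates of a face, almost every boundary point is flat. -/
theorem IsBoundedBy.ae_isOutwardNormal_param (hU : IsBoundedBy U H) (hd : 0 < d)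
    {h : Space d × ℝ} (hh : h ∈ H) {L : Space (d - 1) →ₗᵢ[ℝ] Space d} (hL : IsNormalFrame h.1 L) :
    ∀ᵐ y, IsNormalFrame.param h.1 L h.2 y ∈ frontier U → ∃ m, (m = h.1 ∨ m = -h.1) ∧
      IsOutwardNormal U (IsNormalFrame.param h.1 L h.2 y) m := by
  have h1 := ae_restrict_of_ae (s := hyperplane h.1 h.2) (hU.ae_generic hd)
  rw [← hL.map_param] at h1
  have hm := (IsNormalFrame.isometry_param (n := h.1) (L := L) h.2).continuous.measurable
  filter_upwards [ae_of_ae_map hm.aemeasurable h1] with y hy hyF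
  have hyh := hL.inner_param h.2 y
  rcases hU.exists_isOutwardNormal hh hyF hyh (hy h hh hyh) with h2 | h2
  · exact ⟨_, Or.inl rfl, h2⟩
  · exact ⟨_, Or.inr rfl, h2⟩

theorem ae_spaceTime_of_ae_fst {e : ℕ} {P : Space e → Prop} (h : ∀ᵐ y, P y) :
    ∀ᵐ z : SpaceTime e, P z.1 :=
  (Measure.quasiMeasurePreserving_fst (μ := (volume : Measure (Space e)))
    (ν := (volume : Measure ℝ))).ae h

/-- If `U` contains the beginning of the ray from the flat point `y` in the direction `v`, then `v`
points inwards. -/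
theorem IsOutwardNormal.inner_neg_of_ray {y m v : Space d} (h : IsOutwardNormal U y m)
    (hray : ∀ s ∈ Ioc (0 : ℝ) 1, y + s • v ∈ U) : inner ℝ v m < 0 := by
  obtain ⟨-, r, hr, hU⟩ := h
  have hcont : Continuous fun s : ℝ => y + s • v := by fun_prop
  have h1 : ∀ᶠ s in 𝓝[>] (0 : ℝ), y + s • v ∈ Metric.ball y r :=
    (hcont.tendsto 0).mono_left nhdsWithin_le_nhds (Metric.isOpen_ball.mem_nhds (by simpa using hr))
  have h2 : ∀ᶠ s in 𝓝[>] (0 : ℝ), s ∈ Ioc (0 : ℝ) 1 := Ioc_mem_nhdsGT one_pos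
  obtain ⟨s, hs1, hs2⟩ := (h1.and h2).exists
  have := (hU _ hs1).mp (hray s hs2)
  rw [add_sub_cancel_left, real_inner_smul_left] at this
  by_contra hle
  nlinarith [hs2.1]

variable {u : SpaceTime d → ℂ} {g : Fin d → SpaceTime d → ℂ}

/-- The traces of a function with square integrable weak derivatives in space. -/
theorem IsBoundedBy.hasL2Trace_lateral (hU : IsBoundedBy U H) (hd : 0 < d)
    (hu : MemLp u 2 (volume.restrict (U ×ˢ Ioo a b)))
    (hg : ∀ j, MemLp (g j) 2 (volume.restrict (U ×ˢ Ioo a b)))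
    (h : ∀ j, IsWeakDeriv (U ×ˢ Ioo a b) (spaceDir j) u (g j)) :
    HasL2Trace (U ×ˢ Ioo a b) u (lateralSurface U a b) := by
  have hKo : IsOpen (U ×ˢ Ioo a b : Set (SpaceTime d)) := hU.isOpen.prod isOpen_Ioo
  have hKf := (hU.volume_lt_top a b).ne
  have : IsFiniteMeasure ((volume : Measure (SpaceTime d)).restrict (U ×ˢ Ioo a b)) :=
    ⟨by simpa using (hU.volume_lt_top a b)⟩
  have hgv : ∀ v : Space d, MemLp (fun p => ∑ j, (v j : ℂ) * g j p) 2
      (volume.restrict (U ×ˢ Ioo a b)) := fun v =>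
    memLp_finsetSum _ fun j _ => (hg j).const_mul _
  have hw : ∀ v : Space d, IsWeakDeriv (U ×ˢ Ioo a b) (v, 0) u (fun p => ∑ j, (v j : ℂ) * g j p) :=
    IsWeakDeriv.sum_dir (fun j => (hg j).integrable one_le_two) (hu.integrable one_le_two) h
  -- the analysis on one face
  have face : ∀ h ∈ H, ∀ L, IsNormalFrame h.1 L →
      (∀ᵐ z, lateralParam h.1 L h.2 z ∈ frontier U ×ˢ Ioo a b → Tendsto
        (ballMean (U ×ˢ Ioo a b) u (lateralParam h.1 L h.2 z)) (𝓝[>] 0)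
        (𝓝 (trace (U ×ˢ Ioo a b) u (lateralParam h.1 L h.2 z)))) ∧
      MemLp (fun z => trace (U ×ˢ Ioo a b) u (lateralParam h.1 L h.2 z)) 2
        (volume.restrict (lateralParam h.1 L h.2 ⁻¹' (frontier U ×ˢ Ioo a b))) := by
    intro h hh L hL
    obtain ⟨I, hIfin, hI, hcov⟩ := hU.exists_cylinders hd hh
    set D : Space d × Set (Space d) → Set (SpaceTime (d - 1)) := fun p =>
      lateralParam h.1 L h.2 ⁻¹' ((p.2 ∩ frontier U) ×ˢ Ioo a b) with hD
    have hcov' : lateralParam h.1 L h.2 ⁻¹' (frontier U ×ˢ Ioo a b) ⊆ ⋃ p ∈ I, D p := by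
      intro z hz
      obtain ⟨p, hp, hzp⟩ := mem_iUnion₂.mp (hcov ⟨hz.1, hL.inner_param h.2 z.1⟩)
      exact mem_iUnion₂.mpr ⟨p, hp, ⟨hzp, hz.1⟩, hz.2⟩
    have hcp : ∀ {v : Space d} (hv : inner ℝ h.1 v ≠ 0) (z : SpaceTime (d - 1)),
        chart (lateralCoord hL hv) (h.2 • h.1, 0) (z, 0) = lateralParam h.1 L h.2 z := by
      intro v hv z
      rw [chart_lateralCoord, zero_smul, add_zero]; rfl
    -- Almost every point of the face is flat, and the cylinder direction points inwards there
    -- because the ray runs inside `U`.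
    have hreg : ∀ p (hp : p ∈ I), ∀ᵐ z, z ∈ D p → IsRegularPoint (lateralCoord hL (hI p hp).1)
        (h.2 • h.1, 0) (U ×ˢ Ioo a b) z := by
      intro p hp
      filter_upwards [ae_spaceTime_of_ae_fst (hU.ae_isOutwardNormal_param hd hh hL)] with z hz hzD
      obtain ⟨m, hmn, hm⟩ := hz hzD.1.2
      exact isRegularPoint_lateral hL _ hm hmn
        (hm.inner_neg_of_ray ((hI p hp).2.2 _ hzD.1.1)) hzD.2
    have hdir : ∀ p (hp : p ∈ I), IsWeakDeriv (U ×ˢ Ioo a b) (lateralCoord hL (hI p hp).1 (0, 1)) u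
        (fun q => ∑ j, (p.1 j : ℂ) * g j q) := by
      intro p hp
      rw [lateralCoord_dir]; exact hw p.1
    constructor
    · have : ∀ p ∈ I, ∀ᵐ z, z ∈ D p → Tendsto
          (ballMean (U ×ˢ Ioo a b) u (lateralParam h.1 L h.2 z)) (𝓝[>] 0)
          (𝓝 (trace (U ×ˢ Ioo a b) u (lateralParam h.1 L h.2 z))) := by
        intro p hp
        filter_upwards [hreg p hp, (hdir p hp).ae_hasLineTrace _ (h.2 • h.1, 0) hKo
          (hu.integrable one_le_two) ((hgv p.1).integrable one_le_two)] with z hz1 hz2 hzD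
        have := (hz2 (hz1 hzD)).1
        rwa [hcp] at this
      filter_upwards [(ae_ball_iff hIfin.countable).mpr this] with z hz hzF
      obtain ⟨p, hp, hzp⟩ := mem_iUnion₂.mp (hcov' hzF)
      exact hz p hp hzp
    · refine MemLp.mono_measure (Measure.restrict_mono_set _ hcov') (memLp_two_biUnion hIfin ?_)
      intro p hp
      have hDm : MeasurableSet (D p) := (measurableEmbedding_lateralParam _ _ _).measurable
        (((hI p hp).2.1.inter isClosed_frontier.measurableSet).prod measurableSet_Ioo)
      have := (hdir p hp).memLp_trace_comp_chart _ (h.2 • h.1, 0) hKo hKf hu (hgv p.1) hDm one_pos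
        ?_ (hreg p hp)
      · simp_rw [hcp] at this
        exact this
      · intro z hz s hs
        rw [chart_lateralCoord]
        exact ⟨(hI p hp).2.2 _ hz.1.1 s ⟨hs.1, hs.2.le⟩, hz.2⟩
  constructor
  · refine ae_lateralSurface hU hd fun h hh L hL => ?_
    filter_upwards [(face h hh L hL).1] with z hz hzF
    exact ⟨_, hz hzF⟩
  · rw [← lateralSurface_eq_restrict hU hd]
    refine memLp_two_biUnion H.finite_toSet fun h hh => ?_
    obtain ⟨L, hL⟩ := exists_isNormalFrame hd (hU.unit h hh)
    rw [lateralSurface_restrict_hyperplane hU hL,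
      (measurableEmbedding_lateralParam _ _ _).memLp_map_measure_iff]
    exact (face h hh L hL).2

end lateralTrace

theorem memLp_two_integrable_mul_conj {X : Type*} [MeasurableSpace X] {μ : Measure X} {f g : X → ℂ}
    (hf : MemLp f 2 μ) (hg : MemLp g 2 μ) : Integrable (fun x => f x * conj (g x)) μ := by
  have hg' : MemLp (fun x => conj (g x)) 2 μ :=
    hg.of_le (Complex.continuous_conj.comp_aestronglyMeasurable hg.aestronglyMeasurable)
      (.of_forall fun x => by simp)
  exact hf.integrable_mul hg'

/-! ### Traces on horizontal faces and integration by parts in time. -/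

section time

variable {d : ℕ} {U : Set (Space d)} {a b : ℝ} {u g h k : SpaceTime d → ℂ}

/-- The coordinates `(x, s) ↦ (x, -s)`. -/
def timeReversal (d : ℕ) : (Space d × ℝ) ≃L[ℝ] SpaceTime d :=
  (ContinuousLinearEquiv.refl ℝ (Space d)).prodCongr (ContinuousLinearEquiv.neg ℝ)

theorem chart_refl (x : Space d) (s : ℝ) :
    chart (ContinuousLinearEquiv.refl ℝ (Space d × ℝ)) (0, a) (x, s) = (x, a + s) := by
  simp [chart]

theorem chart_timeReversal (x : Space d) (s : ℝ) :
    chart (timeReversal d) (0, b) (x, s) = (x, b - s) := by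
  simp [chart, timeReversal, sub_eq_add_neg]

/-- The bottom face needs no oblique direction: every point of it is regular, and the vertical
cylinder over all of `U` has the full height `b - a`. -/
theorem IsWeakDeriv.bottom (hU : IsOpen U) (hfin : volume (U ×ˢ Ioo a b : Set (SpaceTime d)) ≠ ⊤)
    (hab : a < b) (hu : MemLp u 2 (volume.restrict (U ×ˢ Ioo a b)))
    (hg : MemLp g 2 (volume.restrict (U ×ˢ Ioo a b)))
    (h : IsWeakDeriv (U ×ˢ Ioo a b) (timeDir d) u g) :
    (∀ᵐ x, x ∈ U → Tendsto (ballMean (U ×ˢ Ioo a b) u (x, a)) (𝓝[>] 0)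
      (𝓝 (trace (U ×ˢ Ioo a b) u (x, a))) ∧
      HasRightValue (Ioo a b) (fun t => u (x, t)) (fun t => g (x, t)) a
        (trace (U ×ˢ Ioo a b) u (x, a))) ∧
    MemLp (fun x => trace (U ×ˢ Ioo a b) u (x, a)) 2 (volume.restrict U) := by
  have : IsFiniteMeasure ((volume : Measure (SpaceTime d)).restrict (U ×ˢ Ioo a b)) :=
    ⟨by simpa using hfin.lt_top⟩
  set A := ContinuousLinearEquiv.refl ℝ (Space d × ℝ)
  have hK : IsOpen (U ×ˢ Ioo a b : Set (SpaceTime d)) := hU.prod isOpen_Ioo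
  have hreg : ∀ x ∈ U, IsRegularPoint A (0, a) (U ×ˢ Ioo a b) x := by
    refine fun x hx => ⟨U, hU.mem_nhds hx, b - a, by linarith, ?_, ?_⟩
    · intro y hy s hs
      rw [chart_refl]
      exact ⟨hy, by simp only [mem_Ioo] at *; constructor <;> linarith⟩
    · intro y _ s hs hmem
      rw [chart_refl] at hmem
      have h1 := hmem.2.1
      simp only at h1
      linarith [hs.2]
  constructor
  · filter_upwards [IsWeakDeriv.ae_hasLineTrace A (0, a) hK (hu.integrable one_le_two)
      (hg.integrable one_le_two) h] with x hx hxU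
    obtain ⟨h1, h2⟩ := hx (hreg x hxU)
    simp only [HasLineTrace, A, chart_refl, add_zero] at h1 h2
    exact ⟨h1, fun β hβ hs => h2 β hβ fun s hs' => ⟨hxU, hs s hs'⟩⟩
  · have := IsWeakDeriv.memLp_trace_comp_chart A (0, a) hK hfin hu hg h hU.measurableSet
      (sub_pos.mpr hab) (fun y hy s hs => ?_) (.of_forall hreg)
    · simpa only [A, chart_refl, add_zero] using this
    · rw [chart_refl]
      exact ⟨hy, by simp only [mem_Ioo] at *; constructor <;> linarith⟩

/-- Reversing time reduces the top face to the situation at the bottom, with the derivative `-g`. -/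
theorem IsWeakDeriv.top (hU : IsOpen U) (hfin : volume (U ×ˢ Ioo a b : Set (SpaceTime d)) ≠ ⊤)
    (hab : a < b) (hu : MemLp u 2 (volume.restrict (U ×ˢ Ioo a b)))
    (hg : MemLp g 2 (volume.restrict (U ×ˢ Ioo a b)))
    (h : IsWeakDeriv (U ×ˢ Ioo a b) (timeDir d) u g) :
    (∀ᵐ x, x ∈ U → Tendsto (ballMean (U ×ˢ Ioo a b) u (x, b)) (𝓝[>] 0)
      (𝓝 (trace (U ×ˢ Ioo a b) u (x, b))) ∧
      HasLeftValue (Ioo a b) (fun t => u (x, t)) (fun t => g (x, t)) b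
        (trace (U ×ˢ Ioo a b) u (x, b))) ∧
    MemLp (fun x => trace (U ×ˢ Ioo a b) u (x, b)) 2 (volume.restrict U) := by
  have : IsFiniteMeasure ((volume : Measure (SpaceTime d)).restrict (U ×ˢ Ioo a b)) :=
    ⟨by simpa using hfin.lt_top⟩
  set A := timeReversal d
  have hK : IsOpen (U ×ˢ Ioo a b : Set (SpaceTime d)) := hU.prod isOpen_Ioo
  have hreg : ∀ x ∈ U, IsRegularPoint A (0, b) (U ×ˢ Ioo a b) x := by
    refine fun x hx => ⟨U, hU.mem_nhds hx, b - a, by linarith, ?_, ?_⟩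
    · intro y hy s hs
      rw [chart_timeReversal]
      exact ⟨hy, by simp only [mem_Ioo] at *; constructor <;> linarith⟩
    · intro y _ s hs hmem
      rw [chart_timeReversal] at hmem
      have h1 := hmem.2.2
      simp only at h1
      linarith [hs.2]
  have h' : IsWeakDeriv (U ×ˢ Ioo a b) (A (0, 1)) u (fun p => -g p) := by
    have e : A (0, 1) = (-1 : ℝ) • timeDir d := by simp [A, timeReversal, timeDir]
    rw [e]
    have := h.const_smul_dir (-1)
    simpa using this
  have hg' : MemLp (fun p => -g p) 2 (volume.restrict (U ×ˢ Ioo a b)) := hg.neg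
  constructor
  · filter_upwards [IsWeakDeriv.ae_hasLineTrace A (0, b) hK (hu.integrable one_le_two)
      (hg'.integrable one_le_two) h'] with x hx hxU
    obtain ⟨h1, h2⟩ := hx (hreg x hxU)
    simp only [HasLineTrace, A, chart_timeReversal, sub_zero] at h1 h2
    exact ⟨h1, fun β hβ hs => h2 β hβ fun s hs' => ⟨hxU, hs s hs'⟩⟩
  · have := IsWeakDeriv.memLp_trace_comp_chart A (0, b) hK hfin hu hg' h' hU.measurableSet
      (sub_pos.mpr hab) (fun y hy s hs => ?_) (.of_forall hreg)
    · simpa only [A, chart_timeReversal, sub_zero] using this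
    · rw [chart_timeReversal]
      exact ⟨hy, by simp only [mem_Ioo] at *; constructor <;> linarith⟩

theorem measurableEmbedding_prodMk_right {X : Type*} [TopologicalSpace X] [T2Space X]
    [MeasurableSpace X] [BorelSpace X] (t : ℝ) [BorelSpace (X × ℝ)] :
    MeasurableEmbedding fun x : X => (x, t) :=
  (Topology.IsClosedEmbedding.of_continuous_injective_isClosedMap (by fun_prop)
    (fun x y hxy => congrArg Prod.fst hxy) fun s hs => by
      have : (fun x : X => (x, t)) '' s = s ×ˢ {t} := by
        ext ⟨x, r⟩; simp [eq_comm]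
      rw [this]; exact hs.prod isClosed_singleton).measurableEmbedding

theorem hasL2Trace_slice (hU : IsOpen U) {K : Set (SpaceTime d)} {t : ℝ}
    (h1 : ∀ᵐ x, x ∈ U → Tendsto (ballMean K u (x, t)) (𝓝[>] 0) (𝓝 (trace K u (x, t))))
    (h2 : MemLp (fun x => trace K u (x, t)) 2 (volume.restrict U)) :
    HasL2Trace K u (Measure.map (fun x : Space d => (x, t)) (volume.restrict U)) := by
  have hm : MeasurableEmbedding fun x : Space d => ((x, t) : SpaceTime d) :=
    measurableEmbedding_prodMk_right t
  refine ⟨?_, hm.memLp_map_measure_iff.mpr h2⟩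
  rw [hm.ae_map_iff, ae_restrict_iff' hU.measurableSet]
  filter_upwards [h1] with x hx hxU using ⟨_, hx hxU⟩

/-- Integration by parts in time on a prism. -/
theorem IsWeakDeriv.setIntegral_time (hU : IsOpen U)
    (hfin : volume (U ×ˢ Ioo a b : Set (SpaceTime d)) ≠ ⊤) (hab : a < b)
    (hu : MemLp u 2 (volume.restrict (U ×ˢ Ioo a b)))
    (hg : MemLp g 2 (volume.restrict (U ×ˢ Ioo a b)))
    (hw : IsWeakDeriv (U ×ˢ Ioo a b) (timeDir d) u g)
    (hh : MemLp h 2 (volume.restrict (U ×ˢ Ioo a b)))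
    (hk : MemLp k 2 (volume.restrict (U ×ˢ Ioo a b)))
    (hw' : IsWeakDeriv (U ×ˢ Ioo a b) (timeDir d) h k) :
    ∫ p in U ×ˢ Ioo a b, (u p * conj (k p) + g p * conj (h p))
      = (∫ x in U, trace (U ×ˢ Ioo a b) u (x, b) * conj (trace (U ×ˢ Ioo a b) h (x, b)))
        - ∫ x in U, trace (U ×ˢ Ioo a b) u (x, a) * conj (trace (U ×ˢ Ioo a b) h (x, a)) := by
  have : IsFiniteMeasure ((volume : Measure (SpaceTime d)).restrict (U ×ˢ Ioo a b)) :=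
    ⟨by simpa using hfin.lt_top⟩
  have hI : IntegrableOn (fun p => u p * conj (k p) + g p * conj (h p)) (U ×ˢ Ioo a b) :=
    (memLp_two_integrable_mul_conj hu hk).add (memLp_two_integrable_mul_conj hg hh)
  have hprod : (volume : Measure (SpaceTime d)).restrict (U ×ˢ Ioo a b)
      = ((volume : Measure (Space d)).restrict U).prod (volume.restrict (Ioo a b)) := by
    rw [Measure.volume_eq_prod, Measure.prod_restrict]
  have hgi := hg.integrable one_le_two
  have hki := hk.integrable one_le_two
  rw [IntegrableOn, hprod] at hI
  rw [hprod] at hgi hki ⊢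
  rw [integral_prod _ hI, ← integral_sub
    (memLp_two_integrable_mul_conj (hw.top hU hfin hab hu hg).2 (hw'.top hU hfin hab hh hk).2)
    (memLp_two_integrable_mul_conj (hw.bottom hU hfin hab hu hg).2
      (hw'.bottom hU hfin hab hh hk).2)]
  refine integral_congr_ae ?_
  filter_upwards [hgi.prod_right_ae, hki.prod_right_ae, ae_restrict_mem hU.measurableSet,
    ae_restrict_of_ae (hw.top hU hfin hab hu hg).1,
    ae_restrict_of_ae (hw.bottom hU hfin hab hu hg).1,
    ae_restrict_of_ae (hw'.top hU hfin hab hh hk).1,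
    ae_restrict_of_ae (hw'.bottom hU hfin hab hh hk).1] with x h1 h2 hx h3 h4 h5 h6
  exact setIntegral_Ioo_by_parts hab subset_rfl h1 h2 (h4 hx).2 (h3 hx).2 (h6 hx).2 (h5 hx).2

end time

/-! ### Measurability of the outward normal. -/

section normalMeasurable

variable {d : ℕ} {U : Set (Space d)} {H : Finset (Space d × ℝ)}

theorem norm_outwardNormal_le (U : Set (Space d)) (x : Space d) : ‖outwardNormal U x‖ ≤ 1 := by
  by_cases h : ∃ n, IsOutwardNormal U x n
  · obtain ⟨n, hn⟩ := h
    rw [hn.outwardNormal_eq, hn.1]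
  · rw [outwardNormal, dif_neg h]; simp

/-- The normal is locally constant on the set of flat points, which is relatively open in the
frontier and carries all of its surface measure. -/
theorem IsBoundedBy.aestronglyMeasurable_outwardNormal (hU : IsBoundedBy U H) (hd : 0 < d) :
    AEStronglyMeasurable (outwardNormal U)
      ((μHE[d - 1] : Measure (Space d)).restrict (frontier U)) := by
  set R : Set (Space d) := {x | ∃ m, IsOutwardNormal U x m} with hR
  have hRo : ∃ O, IsOpen O ∧ frontier U ∩ O = R := by
    have : ∀ x : R, ∃ r > 0, ∀ y ∈ Metric.ball (x : Space d) r, y ∈ frontier U → y ∈ R := by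
      rintro ⟨x, m, hm⟩
      obtain ⟨r, hr, h⟩ := hm.eventually
      exact ⟨r, hr, fun y hy hyF => ⟨m, h y hy hyF⟩⟩
    choose r hr hball using this
    refine ⟨⋃ x : R, Metric.ball (x : Space d) (r x), isOpen_iUnion fun _ => Metric.isOpen_ball, ?_⟩
    ext y
    constructor
    · rintro ⟨hyF, hy⟩
      obtain ⟨x, hx⟩ := mem_iUnion.mp hy
      exact hball x y hx hyF
    · intro hy
      obtain ⟨m, hm⟩ := hy
      exact ⟨hm.mem_frontier, mem_iUnion.mpr ⟨⟨y, m, hm⟩, Metric.mem_ball_self (hr _)⟩⟩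
  obtain ⟨O, hO, hOR⟩ := hRo
  have hRm : MeasurableSet R := hOR ▸ isClosed_frontier.measurableSet.inter hO.measurableSet
  have hcont : ContinuousOn (outwardNormal U) R := by
    rintro x ⟨m, hm⟩
    obtain ⟨r, hr, h⟩ := hm.eventually
    refine ContinuousWithinAt.congr_of_eventuallyEq (f := fun _ => m) continuousWithinAt_const ?_
      hm.outwardNormal_eq
    filter_upwards [inter_mem_nhdsWithin R (Metric.ball_mem_nhds x hr)] with y hy
    obtain ⟨⟨m', hm'⟩, hyb⟩ := hy
    exact (h y hyb hm'.mem_frontier).outwardNormal_eq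
  have e : (μHE[d - 1] : Measure (Space d)).restrict (frontier U)
      = (μHE[d - 1] : Measure (Space d)).restrict R := by
    refine Measure.restrict_congr_set ?_
    filter_upwards [hU.ae_exists_isOutwardNormal hd] with y hy
    exact propext ⟨fun h => hy h, fun ⟨m, hm⟩ => hm.mem_frontier⟩
  rw [e]
  exact hcont.aestronglyMeasurable hRm

theorem IsBoundedBy.aestronglyMeasurable_outwardNormal_lateral (hU : IsBoundedBy U H) (hd : 0 < d)
    (a b : ℝ) : AEStronglyMeasurable (fun p => outwardNormal U p.1) (lateralSurface U a b) := by
  have := hU.isFiniteMeasure_surface hd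
  exact (hU.aestronglyMeasurable_outwardNormal hd).comp_quasiMeasurePreserving
    Measure.quasiMeasurePreserving_fst

end normalMeasurable

/-! ### Projection of the faces along a direction. -/

section projection

variable {d : ℕ} {n v : Space d} {L L' : Space (d - 1) →ₗᵢ[ℝ] Space d}

/-- The surface measure on `hyperplane × ℝ`. -/
def planeMeasure (n : Space d) (c : ℝ) : Measure (SpaceTime d) :=
  ((μHE[d - 1] : Measure (Space d)).restrict (hyperplane n c)).prod volume

theorem IsNormalFrame.sigmaFinite_surface (hL : IsNormalFrame n L) (c : ℝ) :
    SigmaFinite ((μHE[d - 1] : Measure (Space d)).restrict (hyperplane n c)) := by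
  rw [← hL.map_param]
  have : MeasurableEmbedding (IsNormalFrame.param n L c) :=
    (IsNormalFrame.isometry_param c).isClosedEmbedding.measurableEmbedding
  exact this.sigmaFinite_map

theorem IsNormalFrame.map_lateralParam (hL : IsNormalFrame n L) (c : ℝ) :
    Measure.map (lateralParam n L c) volume = planeMeasure n c := by
  have hm := (IsNormalFrame.isometry_param (n := n) (L := L) c).continuous.measurable
  rw [planeMeasure, ← hL.map_param, lateralParam, Measure.volume_eq_prod,
    ← Measure.map_prod_map _ _ hm measurable_id, Measure.map_id]

/-- The projection along `v` from `v^⟂ × ℝ` to `hyperplane × ℝ`. -/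
def lateralProj (n : Space d) (c : ℝ) (v : Space d) (L' : Space (d - 1) →ₗᵢ[ℝ] Space d) :
    SpaceTime (d - 1) → SpaceTime d :=
  Prod.map (fun y => IsNormalFrame.proj n c v (L' y)) id

theorem measurableEmbedding_lateralProj (c : ℝ) (hL' : IsNormalFrame v L') :
    MeasurableEmbedding (lateralProj n c v L') := by
  have hcont : Continuous (lateralProj n c v L') :=
    ((IsNormalFrame.continuous_proj c v).comp L'.continuous).prodMap continuous_id
  refine hcont.measurableEmbedding ?_
  refine Function.Injective.prodMap (fun y y' h => ?_) Function.injective_id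
  simp only [IsNormalFrame.proj] at h
  have h0 : v ≠ 0 := by rintro rfl; simpa using hL'.norm_eq
  have h1 := congrArg (fun x => inner ℝ v x) h
  simp only [inner_add_right, hL'.inner_eq, inner_smul_right, hL'.inner_self, mul_one,
    zero_add] at h1
  rw [h1] at h
  exact L'.injective (add_right_cancel h)

theorem IsNormalFrame.map_lateralProj (hL : IsNormalFrame n L) (c : ℝ) (hL' : IsNormalFrame v L')
    (hv : inner ℝ n v ≠ 0) : Measure.map (lateralProj n c v L') volume
      = ENNReal.ofReal |inner ℝ n v| • planeMeasure n c := by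
  have hm : Measurable fun y => IsNormalFrame.proj n c v (L' y) :=
    ((IsNormalFrame.continuous_proj c v).comp L'.continuous).measurable
  have := hL.sigmaFinite_surface c
  have hs : SFinite (Measure.map (fun y => IsNormalFrame.proj n c v (L' y)) volume) :=
    inferInstance
  rw [planeMeasure, ← Measure.prod_smul_left, ← hL.map_proj c hL' hv, lateralProj,
    Measure.volume_eq_prod, ← Measure.map_prod_map _ _ hm measurable_id, Measure.map_id]

/-- Properties that hold almost everywhere on a face become properties of the crossing points of
almost every line, since the image of Lebesgue measure is a multiple of the surface measure. -/
theorem IsNormalFrame.ae_lateralProj (hL : IsNormalFrame n L) (c : ℝ) (hL' : IsNormalFrame v L')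
    (hv : inner ℝ n v ≠ 0) {P : SpaceTime d → Prop} (h : ∀ᵐ p ∂planeMeasure n c, P p) :
    ∀ᵐ z, P (lateralProj n c v L' z) := by
  have h' : ∀ᵐ p ∂(Measure.map (lateralProj n c v L') volume), P p := by
    rw [hL.map_lateralProj c hL' hv]
    exact Measure.ae_smul_measure h _
  exact ((measurableEmbedding_lateralProj c hL').ae_map_iff).mp h'

/-- Fubini's theorem along the lines of direction `v`. -/
theorem IsNormalFrame.measurePreserving_lateralCoord (hL' : IsNormalFrame v L')
    (hv : inner ℝ v v ≠ 0) :
    MeasurePreserving (lateralCoord hL' hv) (volume.prod volume) volume := by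
  have hcont : Continuous (IsNormalFrame.spaceCoord L' v) :=
    LinearMap.continuous_of_finiteDimensional _
  have h1 : MeasurePreserving (IsNormalFrame.spaceCoord L' v)
      ((volume : Measure (Space (d - 1))).prod (volume : Measure ℝ)) volume :=
    ⟨hcont.measurable, hL'.map_spaceCoord_self⟩
  have h2 : MeasurePreserving (Prod.map (IsNormalFrame.spaceCoord L' v) (id : ℝ → ℝ))
      (((volume : Measure (Space (d - 1))).prod (volume : Measure ℝ)).prod volume)
      (volume.prod volume) := h1.prod (MeasurePreserving.id _)
  have h3 := (measurePreserving_prodAssoc (volume : Measure (Space (d - 1))) (volume : Measure ℝ)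
    (volume : Measure ℝ))
  have h4 := ((MeasurePreserving.id (volume : Measure (Space (d - 1)))).prod
    (Measure.measurePreserving_swap (μ := (volume : Measure ℝ)) (ν := (volume : Measure ℝ))))
  have := h2.comp ((h3.symm).comp (h4.comp h3))
  exact this

/-- Almost no line of direction `v` meets a given hyperplane parallel to `v`. -/
theorem IsNormalFrame.ae_notMem_hyperplane (hL : IsNormalFrame n L) (c : ℝ)
    (hL' : IsNormalFrame v L') (hv : inner ℝ n v = 0) :
    ∀ᵐ y, ∀ s : ℝ, L' y + s • v ∉ hyperplane n c := by
  have hcont : Continuous (IsNormalFrame.spaceCoord L' v) :=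
    LinearMap.continuous_of_finiteDimensional _
  have h1 : ∀ᵐ x : Space d, x ∉ hyperplane n c := by
    rw [ae_iff]; simpa using hL.volume_hyperplane c
  rw [← hL'.map_spaceCoord_self] at h1
  have h2 := Measure.ae_ae_of_ae_prod (ae_of_ae_map hcont.measurable.aemeasurable h1)
  -- A line parallel to the hyperplane that meets it once lies in it entirely, so a single point of
  -- the line off the hyperplane excludes every intersection.
  filter_upwards [h2] with y hy s
  obtain ⟨s', hs'⟩ := hy.exists
  intro hs
  apply hs'
  rw [IsNormalFrame.spaceCoord_apply]
  simp only [hyperplane, mem_ofPred_eq, inner_add_right, inner_smul_right, hv, mul_zero,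
    add_zero] at hs ⊢
  exact hs

end projection

/-! ### Green's formula on a prism. -/

section green

variable {d : ℕ} {U : Set (Space d)} {H : Finset (Space d × ℝ)} {a b : ℝ}
  {u g h k : SpaceTime d → ℂ} {v : Space d}

/-- On the ray from `p` in the direction `v`, inside `U`, the function `u` is the primitive of `g`
that starts from the value `c`. -/
def HasRayValue (U : Set (Space d)) (v : Space d) (u g : SpaceTime d → ℂ) (p : SpaceTime d)
    (c : ℂ) : Prop :=
  ∀ β > 0, (∀ s ∈ Ioo (0 : ℝ) β, p.1 + s • v ∈ U) → ∀ᵐ s, s ∈ Ioo (0 : ℝ) β →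
    u (p.1 + s • v, p.2) = c + ∫ σ in (0 : ℝ)..s, g (p.1 + σ • v, p.2)

theorem HasRayValue.hasRightValue {y : Space d} {q t : ℝ} {c : ℂ}
    (hr : HasRayValue U v u g (y + q • v, t) c) :
    HasRightValue {s : ℝ | y + s • v ∈ U} (fun s => u (y + s • v, t)) (fun s => g (y + s • v, t)) q
      c := by
  intro β hβ hs
  have e : ∀ s : ℝ, y + (q + s) • v = y + q • v + s • v := fun s => by rw [add_smul, add_assoc]
  simp only [mem_ofPred_eq, e] at hs ⊢
  exact hr β hβ hs

theorem HasRayValue.hasLeftValue {y : Space d} {q t : ℝ} {c : ℂ}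
    (hr : HasRayValue U (-v) u (fun p => -g p) (y + q • v, t) c) :
    HasLeftValue {s : ℝ | y + s • v ∈ U} (fun s => u (y + s • v, t)) (fun s => g (y + s • v, t)) q
      c := by
  intro β hβ hs
  have e : ∀ s : ℝ, y + (q - s) • v = y + q • v + s • -v := fun s => by
    rw [sub_smul, smul_neg]; abel
  simp only [mem_ofPred_eq, e] at hs ⊢
  exact hr β hβ hs

/-- The traces are the boundary values along almost every line of direction `v`. -/
theorem IsBoundedBy.ae_hasRayValue (hU : IsBoundedBy U H) (hd : 0 < d)
    (hu : IntegrableOn u (U ×ˢ Ioo a b)) (hg : IntegrableOn g (U ×ˢ Ioo a b))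
    (hw : IsWeakDeriv (U ×ˢ Ioo a b) (v, 0) u g) {f : Space d × ℝ} (hf : f ∈ H)
    (hv : inner ℝ f.1 v ≠ 0) :
    ∀ᵐ p ∂planeMeasure f.1 f.2, p.1 ∈ frontier U → p.2 ∈ Ioo a b → ∃ m, (m = f.1 ∨ m = -f.1) ∧
      IsOutwardNormal U p.1 m ∧
      (inner ℝ v m < 0 → HasRayValue U v u g p (trace (U ×ˢ Ioo a b) u p)) := by
  obtain ⟨L, hL⟩ := exists_isNormalFrame hd (hU.unit f hf)
  rw [← hL.map_lateralParam, (measurableEmbedding_lateralParam _ _ _).ae_map_iff]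
  filter_upwards [ae_spaceTime_of_ae_fst (hU.ae_isOutwardNormal_param hd hf hL),
    IsWeakDeriv.ae_hasLineTrace (lateralCoord hL hv) (f.2 • f.1, 0) (hU.isOpen.prod isOpen_Ioo)
      hu hg (by rw [lateralCoord_dir]; exact hw)] with z hz1 hz2 hzF hzt
  obtain ⟨m, hmn, hm⟩ := hz1 hzF
  refine ⟨m, hmn, hm, fun hvm β hβ hs => ?_⟩
  have h2 := (hz2 (isRegularPoint_lateral hL hv hm hmn hvm hzt)).2
  simp only [HasLineTrace, chart_lateralCoord, zero_smul, add_zero] at h2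
  exact h2 β hβ fun s hs' => ⟨hs s hs', hzt⟩

/-- Close to a flat point, membership of `y + s • v` is decided by the sign of `s * ⟪v, m⟫`. -/
theorem IsOutwardNormal.exists_ray {y m : Space d} (hm : IsOutwardNormal U y m)
    (hv : inner ℝ v m < 0) : ∃ ε > 0, (∀ s ∈ Ioo (0 : ℝ) ε, y + s • v ∈ U) ∧
      ∀ s ∈ Ioo (-ε) 0, y + s • v ∉ U := by
  obtain ⟨-, r, hr, hU⟩ := hm
  have hcont : Continuous fun s : ℝ => y + s • v := by fun_prop
  have h1 : ∀ᶠ s in 𝓝 (0 : ℝ), y + s • v ∈ Metric.ball y r :=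
    (hcont.tendsto 0) (Metric.isOpen_ball.mem_nhds (by simpa using hr))
  obtain ⟨ε, hε, hball⟩ := Metric.eventually_nhds_iff_ball.mp h1
  have hb : ∀ s : ℝ, |s| < ε → (y + s • v ∈ U ↔ s * inner ℝ v m < 0) := fun s hs => by
    rw [hU _ (hball s (by simpa using hs)), add_sub_cancel_left, real_inner_smul_left]
  refine ⟨ε, hε, fun s hs => ?_, fun s hs => ?_⟩
  · rw [hb s (by rw [abs_of_pos hs.1]; exact hs.2)]
    exact mul_neg_of_pos_of_neg hs.1 hv
  · rw [hb s (by rw [abs_of_neg hs.2]; linarith [hs.1]), not_lt]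
    exact (mul_pos_of_neg_of_neg hs.2 hv).le

/-- Integration by parts along a line. -/
theorem IsBoundedBy.setIntegral_line (hU : IsBoundedBy U H) (hv1 : ‖v‖ = 1) {y : Space d} {t : ℝ}
    (hgen : ∀ f ∈ H, inner ℝ f.1 v ≠ 0 → IsNormalFrame.proj f.1 f.2 v y ∈ frontier U →
      ∀ f' ∈ H, f' ≠ f → IsNormalFrame.proj f.1 f.2 v y ∉ hyperplane f'.1 f'.2)
    (hpar : ∀ f ∈ H, inner ℝ f.1 v = 0 → ∀ s : ℝ, y + s • v ∉ hyperplane f.1 f.2)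
    {τ τ' : SpaceTime d → ℂ}
    (hend : ∀ f ∈ H, inner ℝ f.1 v ≠ 0 → IsNormalFrame.proj f.1 f.2 v y ∈ frontier U →
      ∃ m, (m = f.1 ∨ m = -f.1) ∧ IsOutwardNormal U (IsNormalFrame.proj f.1 f.2 v y) m ∧
      (inner ℝ v m < 0 →
        HasRayValue U v u g (IsNormalFrame.proj f.1 f.2 v y, t)
          (τ (IsNormalFrame.proj f.1 f.2 v y, t)) ∧
        HasRayValue U v h k (IsNormalFrame.proj f.1 f.2 v y, t)
          (τ' (IsNormalFrame.proj f.1 f.2 v y, t))) ∧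
      (inner ℝ (-v) m < 0 →
        HasRayValue U (-v) u (fun p => -g p) (IsNormalFrame.proj f.1 f.2 v y, t)
          (τ (IsNormalFrame.proj f.1 f.2 v y, t)) ∧
        HasRayValue U (-v) h (fun p => -k p) (IsNormalFrame.proj f.1 f.2 v y, t)
          (τ' (IsNormalFrame.proj f.1 f.2 v y, t))))
    (hg : IntegrableOn (fun s => g (y + s • v, t)) {s : ℝ | y + s • v ∈ U})
    (hk : IntegrableOn (fun s => k (y + s • v, t)) {s : ℝ | y + s • v ∈ U})
    (hI : IntegrableOn (fun s => u (y + s • v, t) * conj (k (y + s • v, t))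
      + g (y + s • v, t) * conj (h (y + s • v, t))) {s : ℝ | y + s • v ∈ U}) :
    ∫ s in {s : ℝ | y + s • v ∈ U}, (u (y + s • v, t) * conj (k (y + s • v, t))
      + g (y + s • v, t) * conj (h (y + s • v, t)))
    = ∑ f ∈ H with inner ℝ f.1 v ≠ 0, (frontier U ×ˢ univ).indicator (fun p =>
        ((inner ℝ (outwardNormal U p.1) v / |inner ℝ f.1 v| : ℝ) : ℂ) * (τ p * conj (τ' p)))
          (IsNormalFrame.proj f.1 f.2 v y, t) := by
  classical
  set O : Set ℝ := {s : ℝ | y + s • v ∈ U} with hO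
  have hcont : Continuous fun s : ℝ => y + s • v := by fun_prop
  have hOo : IsOpen O := hU.isOpen.preimage hcont
  have hOb : Bornology.IsBounded O := by
    obtain ⟨R, hR⟩ := hU.isBounded.subset_closedBall 0
    refine (Metric.isBounded_closedBall (x := (0 : ℝ)) (r := R + ‖y‖)).subset fun s hs => ?_
    have h1 : ‖y + s • v‖ ≤ R := by simpa using hR hs
    have h2 : ‖s • v‖ ≤ ‖y + s • v‖ + ‖y‖ := by
      have := norm_sub_le (y + s • v) y
      rwa [add_sub_cancel_left] at this
    rw [norm_smul, hv1, mul_one] at h2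
    rw [mem_closedBall_zero_iff]
    linarith
  set F : Finset (Space d × ℝ) := {f ∈ H | inner ℝ f.1 v ≠ 0} with hF
  set F' : Finset (Space d × ℝ) := {f ∈ F | IsNormalFrame.proj f.1 f.2 v y ∈ frontier U} with hF'
  set S : Space d × ℝ → ℝ := fun f => (f.2 - inner ℝ f.1 y) / inner ℝ f.1 v with hS
  have hproj : ∀ f : Space d × ℝ, IsNormalFrame.proj f.1 f.2 v y = y + S f • v := fun f => rfl
  have hF'm : ∀ f ∈ F', f ∈ H ∧ inner ℝ f.1 v ≠ 0 ∧ y + S f • v ∈ frontier U := by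
    intro f hf
    simp only [hF', hF, Finset.mem_filter, hproj] at hf
    exact ⟨hf.1.1, hf.1.2, hf.2⟩
  -- Two faces crossed at the same parameter would share the crossing point, which genericity
  -- forbids. Thus the sum over end points is a sum over faces.
  have hinj : Set.InjOn S F' := by
    intro f hf f' hf' hff
    obtain ⟨h1, h2, h3⟩ := hF'm f hf
    obtain ⟨h1', h2', h3'⟩ := hF'm f' hf'
    by_contra hne
    refine hgen f h1 h2 h3 f' h1' (Ne.symm hne) ?_
    rw [hproj, hff, ← hproj]
    exact IsNormalFrame.inner_proj h2' y
  have hQ : frontier O ⊆ F'.image S := by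
    intro s hs
    have hsF : y + s • v ∈ frontier U := hcont.frontier_preimage_subset U hs
    obtain ⟨f, hf, hsf⟩ := mem_iUnion₂.mp (hU.subset hsF)
    have hfv : inner ℝ f.1 v ≠ 0 := fun h0 => hpar f hf h0 s hsf
    have hsS : s = S f := by
      simp only [hyperplane, mem_ofPred_eq, inner_add_right, inner_smul_right] at hsf
      rw [hS]
      simp only
      rw [← hsf]; field_simp; ring
    rw [Finset.mem_coe, Finset.mem_image]
    refine ⟨f, ?_, hsS.symm⟩
    simp only [hF', hF, Finset.mem_filter, hproj, ← hsS]
    exact ⟨⟨hf, hfv⟩, hsF⟩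
  -- The line leaves `U` where `⟪n, v⟫ > 0` and enters where it is negative, which matches the sign
  -- convention for right and left ends.
  set sg : ℝ → ℝ := fun s => SignType.sign (inner ℝ (outwardNormal U (y + s • v)) v : ℝ) with hsg
  have key := setIntegral_by_parts_of_finite_frontier (sg := sg)
    (c := fun s => τ (y + s • v, t)) (e := fun s => τ' (y + s • v, t))
    (F'.image S).card (F'.image S) O rfl hOo hOb hg hk hI hQ (by
      intro q hq
      obtain ⟨f, hf, rfl⟩ := Finset.mem_image.mp hq
      obtain ⟨h1, h2, h3⟩ := hF'm f hf
      obtain ⟨m, hmf, hm, hin, hout⟩ := hend f h1 h2 h3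
      simp only [hproj] at hm hin hout
      have hvm : inner ℝ v m ≠ 0 := by
        rcases hmf with rfl | rfl
        · rwa [real_inner_comm]
        · rwa [inner_neg_right, neg_ne_zero, real_inner_comm]
      have hsgq : sg (S f) = SignType.sign (inner ℝ v m : ℝ) := by
        simp only [hsg, hm.outwardNormal_eq, real_inner_comm]
      have hsm : ∀ s, y + (S f + s) • v = y + S f • v + s • v := fun s => by
        rw [add_smul, add_assoc]
      rcases lt_or_gt_of_ne hvm with hneg | hpos
      · obtain ⟨ε, hε, hε1, hε2⟩ := hm.exists_ray hneg
        refine Or.inl ⟨by rw [hsgq, sign_neg hneg]; simp, ⟨ε, hε, ?_, ?_⟩, ?_, ?_⟩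
        · intro s hs
          have := hε1 (s - S f) ⟨by linarith [hs.1], by linarith [hs.2]⟩
          rwa [← hsm, add_sub_cancel] at this
        · refine disjoint_left.mpr fun s hs hsO => ?_
          have := hε2 (s - S f) ⟨by linarith [hs.1], by linarith [hs.2]⟩
          rw [← hsm, add_sub_cancel] at this
          exact this hsO
        · exact (hin hneg).1.hasRightValue
        · exact (hin hneg).2.hasRightValue
      · have hneg : inner ℝ (-v) m < 0 := by rw [inner_neg_left]; linarith
        obtain ⟨ε, hε, hε1, hε2⟩ := hm.exists_ray hneg
        have hsm' : ∀ s, y + (S f - s) • v = y + S f • v + s • -v := fun s => by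
          rw [sub_smul, smul_neg]; abel
        refine Or.inr ⟨by rw [hsgq, sign_pos hpos]; simp, ⟨ε, hε, ?_, ?_⟩, ?_, ?_⟩
        · intro s hs
          have := hε1 (S f - s) ⟨by linarith [hs.2], by linarith [hs.1]⟩
          rwa [← hsm', sub_sub_cancel] at this
        · refine disjoint_left.mpr fun s hs hsO => ?_
          have := hε2 (S f - s) ⟨by linarith [hs.2], by linarith [hs.1]⟩
          rw [← hsm', sub_sub_cancel] at this
          exact this hsO
        · exact (hout hneg).1.hasLeftValue
        · exact (hout hneg).2.hasLeftValue)
  rw [key, Finset.sum_image hinj]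
  have hsum : ∀ f ∈ F, f ∉ F' → (frontier U ×ˢ (univ : Set ℝ)).indicator (fun p =>
        ((inner ℝ (outwardNormal U p.1) v / |inner ℝ f.1 v| : ℝ) : ℂ) * (τ p * conj (τ' p)))
          (IsNormalFrame.proj f.1 f.2 v y, t) = 0 := by
    intro f hf hf'
    refine indicator_of_notMem (fun hmem => hf' ?_) _
    exact Finset.mem_filter.mpr ⟨hf, hmem.1⟩
  rw [← Finset.sum_subset (Finset.filter_subset _ F) hsum]
  refine Finset.sum_congr rfl fun f hf => ?_
  obtain ⟨h1, h2, h3⟩ := hF'm f hf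
  obtain ⟨m, hmf, hm, -⟩ := hend f h1 h2 h3
  rw [hproj, indicator_of_mem (show (y + S f • v, t) ∈ frontier U ×ˢ (univ : Set ℝ) from
    ⟨h3, mem_univ _⟩)]
  congr 2
  rw [hproj] at hm
  simp only [hsg, hm.outwardNormal_eq]
  -- The sign is written as `⟪n, v⟫ / |⟪n, v⟫|`, so that the denominator later cancels the Jacobian
  -- of the projection onto the face.
  have habs : |inner ℝ f.1 v| = |inner ℝ m v| := by
    rcases hmf with rfl | rfl
    · rfl
    · rw [inner_neg_left, abs_neg]
  have hmv : inner ℝ m v ≠ 0 := by rwa [← abs_ne_zero, ← habs, abs_ne_zero]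
  rw [habs]
  rw [eq_div_iff (abs_ne_zero.mpr hmv), sign_mul_abs]

theorem IsBoundedBy.planeMeasure_restrict (hU : IsBoundedBy U H) {n : Space d}
    {L : Space (d - 1) →ₗᵢ[ℝ] Space d} (hL : IsNormalFrame n L) (c : ℝ) :
    (planeMeasure n c).restrict (frontier U ×ˢ Ioo a b)
      = (lateralSurface U a b).restrict (hyperplane n c ×ˢ univ) := by
  have := hU.isFiniteMeasure_surface hL.pos
  have := hL.sigmaFinite_surface c
  rw [planeMeasure, lateralSurface, ← Measure.prod_restrict, ← Measure.prod_restrict,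
    Measure.restrict_univ, Measure.restrict_restrict isClosed_frontier.measurableSet,
    Measure.restrict_restrict (isClosed_hyperplane n c).measurableSet, inter_comm]

/-- Almost every lateral point lies on exactly one of the hyperplanes. -/
theorem IsBoundedBy.integral_lateralSurface (hU : IsBoundedBy U H) (hd : 0 < d)
    {G : SpaceTime d → ℂ} (hG : Integrable G (lateralSurface U a b)) :
    ∫ p, G p ∂(lateralSurface U a b)
      = ∑ f ∈ H, ∫ p in hyperplane f.1 f.2 ×ˢ univ, G p ∂(lateralSurface U a b) := by
  classical
  have := hU.isFiniteMeasure_surface hd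
  have hm : ∀ f : Space d × ℝ, MeasurableSet (hyperplane f.1 f.2 ×ˢ (univ : Set ℝ)) := fun f =>
    (isClosed_hyperplane _ _).measurableSet.prod MeasurableSet.univ
  have hq : Measure.QuasiMeasurePreserving Prod.fst (lateralSurface U a b)
    ((μHE[d - 1] : Measure (Space d)).restrict (frontier U)) := Measure.quasiMeasurePreserving_fst
  calc ∫ p, G p ∂(lateralSurface U a b)
      = ∫ p, ∑ f ∈ H, (hyperplane f.1 f.2 ×ˢ (univ : Set ℝ)).indicator G p
          ∂(lateralSurface U a b) := by
        refine integral_congr_ae ?_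
        filter_upwards [hq.ae (ae_restrict_of_ae (hU.ae_generic hd)),
          hq.ae (ae_restrict_mem isClosed_frontier.measurableSet)] with p hp hpF
        obtain ⟨f, hf, hpf⟩ := mem_iUnion₂.mp (hU.subset hpF)
        rw [Finset.sum_eq_single f]
        · rw [indicator_of_mem (show p ∈ hyperplane f.1 f.2 ×ˢ (univ : Set ℝ) from
            ⟨hpf, mem_univ _⟩)]
        · intro f' hf' hne
          exact indicator_of_notMem (fun hmem => hp f hf hpf f' hf' hne hmem.1) _
        · exact fun hf' => absurd hf hf'
    _ = _ := by
        rw [integral_finsetSum _ fun f _ => hG.indicator (hm f)]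
        exact Finset.sum_congr rfl fun f _ => integral_indicator (hm f)

/-- Almost every point of a hyperplane of the family lies on no other one. -/
theorem IsBoundedBy.ae_generic_planeMeasure (hU : IsBoundedBy U H) (hd : 0 < d)
    {f : Space d × ℝ} (hf : f ∈ H) : ∀ᵐ p ∂planeMeasure f.1 f.2,
      ∀ f' ∈ H, f' ≠ f → p.1 ∉ hyperplane f'.1 f'.2 := by
  obtain ⟨L, hL⟩ := exists_isNormalFrame hd (hU.unit f hf)
  have := hL.sigmaFinite_surface f.2
  have hq : Measure.QuasiMeasurePreserving Prod.fst (planeMeasure f.1 f.2)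
    ((μHE[d - 1] : Measure (Space d)).restrict (hyperplane f.1 f.2)) :=
    Measure.quasiMeasurePreserving_fst
  filter_upwards [hq.ae (ae_restrict_of_ae (hU.ae_generic hd)),
    hq.ae (ae_restrict_mem (isClosed_hyperplane _ _).measurableSet)] with p hp hpf f' hf' hne
  exact hp f hf hpf f' hf' hne

/-- Green's formula in the direction `v` on a prism. -/
theorem IsBoundedBy.setIntegral_space (hU : IsBoundedBy U H) (hd : 0 < d) (hv1 : ‖v‖ = 1)
    (hu : MemLp u 2 (volume.restrict (U ×ˢ Ioo a b)))
    (hg : MemLp g 2 (volume.restrict (U ×ˢ Ioo a b)))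
    (hw : IsWeakDeriv (U ×ˢ Ioo a b) (v, 0) u g)
    (hh : MemLp h 2 (volume.restrict (U ×ˢ Ioo a b)))
    (hk : MemLp k 2 (volume.restrict (U ×ˢ Ioo a b)))
    (hw' : IsWeakDeriv (U ×ˢ Ioo a b) (v, 0) h k)
    (hτ : MemLp (trace (U ×ˢ Ioo a b) u) 2 (lateralSurface U a b))
    (hτ' : MemLp (trace (U ×ˢ Ioo a b) h) 2 (lateralSurface U a b)) :
    ∫ p in U ×ˢ Ioo a b, (u p * conj (k p) + g p * conj (h p))
      = ∫ p, ((inner ℝ (outwardNormal U p.1) v : ℝ) : ℂ) *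
          (trace (U ×ˢ Ioo a b) u p * conj (trace (U ×ˢ Ioo a b) h p)) ∂(lateralSurface U a b) := by
  classical
  have : IsFiniteMeasure ((volume : Measure (SpaceTime d)).restrict (U ×ˢ Ioo a b)) :=
    ⟨by simpa using hU.volume_lt_top a b⟩
  obtain ⟨L', hL'⟩ := exists_isNormalFrame hd hv1
  have hvv : inner ℝ v v ≠ 0 := by rw [hL'.inner_self]; norm_num
  set K : Set (SpaceTime d) := U ×ˢ Ioo a b with hK
  have hKm : MeasurableSet K := (hU.isOpen.prod isOpen_Ioo).measurableSet
  set τ := trace K u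
  set τ' := trace K h
  set A := lateralCoord hL' hvv with hA
  have hAe : MeasurableEmbedding A := A.toHomeomorph.measurableEmbedding
  have hAp : MeasurePreserving A (volume.prod volume) volume :=
    hL'.measurePreserving_lateralCoord hvv
  have hAa : ∀ z s, A (z, s) = (L' z.1 + s • v, z.2) := fun z s => lateralCoord_apply hL' hvv _
  have hAK : ∀ (z : SpaceTime (d - 1)), z.2 ∈ Ioo a b → ∀ (W : SpaceTime d → ℂ) s,
      K.indicator W (A (z, s)) = {s : ℝ | L' z.1 + s • v ∈ U}.indicator
        (fun s => W (L' z.1 + s • v, z.2)) s := by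
    intro z hz W s
    simp only [indicator, hAa, hK, mem_prod, mem_ofPred_eq, hz, and_true]
  have hOm : ∀ z : SpaceTime (d - 1), MeasurableSet {s : ℝ | L' z.1 + s • v ∈ U} := fun z =>
    (hU.isOpen.preimage (f := fun s : ℝ => L' z.1 + s • v) (by fun_prop)).measurableSet
  have hAi : ∀ {W : SpaceTime d → ℂ}, IntegrableOn W K →
      Integrable (fun q => K.indicator W (A q)) (volume.prod volume) := fun hW =>
    (hAp.integrable_comp_emb hAe).mpr ((integrable_indicator_iff hKm).mpr hW)
  have hAl : ∀ {W : SpaceTime d → ℂ}, IntegrableOn W K → ∀ᵐ z : SpaceTime (d - 1), z.2 ∈ Ioo a b →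
      IntegrableOn (fun s => W (L' z.1 + s • v, z.2)) {s : ℝ | L' z.1 + s • v ∈ U} := by
    intro W hW
    filter_upwards [(hAi hW).prod_right_ae] with z hz hzt
    rw [← integrable_indicator_iff (hOm z)]
    exact hz.congr (.of_forall fun s => hAK z hzt W s)
  set W : SpaceTime d → ℂ := fun p => u p * conj (k p) + g p * conj (h p) with hW
  have hWi : IntegrableOn W K :=
    (memLp_two_integrable_mul_conj hu hk).add (memLp_two_integrable_mul_conj hg hh)
  have hui := hu.integrable one_le_two
  have hgi := hg.integrable one_le_two
  have hhi := hh.integrable one_le_two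
  have hki := hk.integrable one_le_two
  set F : Finset (Space d × ℝ) := {f ∈ H | inner ℝ f.1 v ≠ 0} with hF
  have hFm : ∀ f ∈ F, f ∈ H ∧ inner ℝ f.1 v ≠ 0 := fun f hf => by
    simpa [hF] using hf
  set Φ : Space d × ℝ → SpaceTime d → ℂ := fun f p =>
    ((inner ℝ (outwardNormal U p.1) v / |inner ℝ f.1 v| : ℝ) : ℂ) * (τ p * conj (τ' p)) with hΦ
  set G : SpaceTime d → ℂ := fun p =>
    ((inner ℝ (outwardNormal U p.1) v : ℝ) : ℂ) * (τ p * conj (τ' p)) with hG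
  have hGi : Integrable G (lateralSurface U a b) := by
    refine (memLp_two_integrable_mul_conj hτ hτ').bdd_mul (c := 1) ?_ (.of_forall fun p => ?_)
    · exact Complex.continuous_ofReal.comp_aestronglyMeasurable
        ((hU.aestronglyMeasurable_outwardNormal_lateral hd a b).inner aestronglyMeasurable_const)
    · rw [Complex.norm_real]
      refine (norm_inner_le_norm _ _).trans ?_
      rw [hv1, mul_one]; exact norm_outwardNormal_le U _
  have hΦG : ∀ f ∈ F, ∀ p, Φ f p = ((|inner ℝ f.1 v|⁻¹ : ℝ) : ℂ) * G p := fun f _ p => by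
    simp only [hΦ, hG]; push_cast; ring
  have hFr : MeasurableSet (frontier U ×ˢ Ioo a b : Set (SpaceTime d)) :=
    isClosed_frontier.measurableSet.prod measurableSet_Ioo
  have hwn : IsWeakDeriv K (-v, 0) u (fun p => -g p) := by
    simpa using hw.const_smul_dir (-1)
  have hwn' : IsWeakDeriv K (-v, 0) h (fun p => -k p) := by
    simpa using hw'.const_smul_dir (-1)
  -- the formula on almost every line
  have hline : ∀ᵐ z : SpaceTime (d - 1), ∫ s, K.indicator W (A (z, s))
      = ∑ f ∈ F, (frontier U ×ˢ Ioo a b).indicator (Φ f) (lateralProj f.1 f.2 v L' z) := by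
    have e1 : ∀ᵐ z : SpaceTime (d - 1), ∀ f ∈ H, inner ℝ f.1 v ≠ 0 →
        ∀ f' ∈ H, f' ≠ f → (lateralProj f.1 f.2 v L' z).1 ∉ hyperplane f'.1 f'.2 := by
      refine (eventually_all_finset H).mpr fun f hf => ?_
      by_cases hfv : inner ℝ f.1 v = 0
      · exact .of_forall fun z h0 => absurd hfv h0
      · obtain ⟨L, hL⟩ := exists_isNormalFrame hd (hU.unit f hf)
        filter_upwards [hL.ae_lateralProj f.2 hL' hfv (hU.ae_generic_planeMeasure hd hf)]
          with z hz _ using hz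
    have e2 : ∀ᵐ z : SpaceTime (d - 1), ∀ f ∈ H, inner ℝ f.1 v = 0 →
        ∀ s : ℝ, L' z.1 + s • v ∉ hyperplane f.1 f.2 := by
      refine (eventually_all_finset H).mpr fun f hf => ?_
      by_cases hfv : inner ℝ f.1 v = 0
      · obtain ⟨L, hL⟩ := exists_isNormalFrame hd (hU.unit f hf)
        filter_upwards [ae_spaceTime_of_ae_fst (hL.ae_notMem_hyperplane f.2 hL' hfv)]
          with z hz _ using hz
      · exact .of_forall fun z h0 => absurd h0 hfv
    have e3 : ∀ {w w' : SpaceTime d → ℂ} {v' : Space d}, IntegrableOn w K → IntegrableOn w' K →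
        IsWeakDeriv K (v', 0) w w' → (v' = v ∨ v' = -v) →
        ∀ᵐ z : SpaceTime (d - 1), ∀ f ∈ H, inner ℝ f.1 v ≠ 0 →
          (lateralProj f.1 f.2 v L' z).1 ∈ frontier U → z.2 ∈ Ioo a b →
          ∃ m, (m = f.1 ∨ m = -f.1) ∧ IsOutwardNormal U (lateralProj f.1 f.2 v L' z).1 m ∧
          (inner ℝ v' m < 0 → HasRayValue U v' w w' (lateralProj f.1 f.2 v L' z)
            (trace K w (lateralProj f.1 f.2 v L' z))) := by
      intro w w' v' hwi hwi' hww hvv'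
      refine (eventually_all_finset H).mpr fun f hf => ?_
      by_cases hfv : inner ℝ f.1 v = 0
      · exact .of_forall fun z h0 => absurd hfv h0
      · obtain ⟨L, hL⟩ := exists_isNormalFrame hd (hU.unit f hf)
        have hfv' : inner ℝ f.1 v' ≠ 0 := by
          rcases hvv' with rfl | rfl
          · exact hfv
          · rwa [inner_neg_right, neg_ne_zero]
        filter_upwards [hL.ae_lateralProj f.2 hL' hfv
          (hU.ae_hasRayValue hd hwi hwi' hww hf hfv')] with z hz _ using hz
    filter_upwards [e1, e2, e3 hui hgi hw (Or.inl rfl), e3 hhi hki hw' (Or.inl rfl),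
      e3 hui hgi.neg hwn (Or.inr rfl), e3 hhi hki.neg hwn' (Or.inr rfl), hAl hgi, hAl hki,
      hAl hWi] with z h1 h2 h3 h4 h5 h6 h7 h8 h9
    by_cases hzt : z.2 ∈ Ioo a b
    · simp only [hAK z hzt W]
      rw [integral_indicator (hOm z)]
      have := hU.setIntegral_line (u := u) (g := g) (h := h) (k := k) (τ := τ) (τ' := τ') hv1
        (y := L' z.1) (t := z.2) (fun f hf hfv _ => h1 f hf hfv) h2 (by
          intro f hf hfv hfr
          obtain ⟨m, hmf, hm, i1⟩ := h3 f hf hfv hfr hzt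
          obtain ⟨m2, -, hm2, i2⟩ := h4 f hf hfv hfr hzt
          obtain ⟨m3, -, hm3, i3⟩ := h5 f hf hfv hfr hzt
          obtain ⟨m4, -, hm4, i4⟩ := h6 f hf hfv hfr hzt
          -- The four boundary-value statements each supply a normal at the same point; uniqueness
          -- identifies them.
          rw [hm2.unique hm] at i2
          rw [hm3.unique hm] at i3
          rw [hm4.unique hm] at i4
          exact ⟨m, hmf, hm, fun hn => ⟨i1 hn, i2 hn⟩, fun hn => ⟨i3 hn, i4 hn⟩⟩)
        (h7 hzt) (h8 hzt) (h9 hzt)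
      refine this.trans (Finset.sum_congr rfl fun f hf => ?_)
      have e : lateralProj f.1 f.2 v L' z = (IsNormalFrame.proj f.1 f.2 v (L' z.1), z.2) := rfl
      rw [e]
      simp only [indicator, mem_prod, mem_univ, hzt]
      rfl
    · have e4 : ∀ s, K.indicator W (A (z, s)) = 0 := fun s =>
        indicator_of_notMem (fun hm => hzt (by rw [hAa] at hm; exact hm.2)) _
      simp only [e4, integral_zero]
      exact (Finset.sum_eq_zero fun f _ => indicator_of_notMem (fun hm => hzt hm.2) _).symm
  -- the contribution of one face
  have hface : ∀ f ∈ F, Integrable (fun z => (frontier U ×ˢ Ioo a b).indicator (Φ f)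
        (lateralProj f.1 f.2 v L' z)) ∧
      ∫ z, (frontier U ×ˢ Ioo a b).indicator (Φ f) (lateralProj f.1 f.2 v L' z)
        = ∫ p in hyperplane f.1 f.2 ×ˢ univ, G p ∂(lateralSurface U a b) := by
    intro f hf
    obtain ⟨hfH, hfv⟩ := hFm f hf
    obtain ⟨L, hL⟩ := exists_isNormalFrame hd (hU.unit f hfH)
    have hemb := measurableEmbedding_lateralProj (n := f.1) f.2 hL'
    have hΦi : IntegrableOn (Φ f) (frontier U ×ˢ Ioo a b) (planeMeasure f.1 f.2) := by
      rw [IntegrableOn, hU.planeMeasure_restrict hL]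
      exact (hGi.restrict.const_mul _).congr (.of_forall fun p => (hΦG f hf p).symm)
    have habs : 0 < |inner ℝ f.1 v| := abs_pos.mpr hfv
    constructor
    · have : Integrable ((frontier U ×ˢ Ioo a b).indicator (Φ f))
          (Measure.map (lateralProj f.1 f.2 v L') volume) := by
        rw [hL.map_lateralProj f.2 hL' hfv]
        exact ((integrable_indicator_iff hFr).mpr hΦi).smul_measure ENNReal.ofReal_ne_top
      exact hemb.integrable_map_iff.mp this
    -- The Jacobian `|⟪f.1, v⟫|` of the change of variables cancels the denominator in `Φ f`.
    · rw [← hemb.integral_map, hL.map_lateralProj f.2 hL' hfv, integral_smul_measure,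
        integral_indicator hFr, hU.planeMeasure_restrict hL, ENNReal.toReal_ofReal habs.le]
      simp only [hΦG f hf]
      rw [integral_const_mul, Complex.real_smul, ← mul_assoc, ← Complex.ofReal_mul,
        mul_inv_cancel₀ habs.ne', Complex.ofReal_one, one_mul]
  -- Faces parallel to `v` are missed by almost every line, and they also contribute nothing to the
  -- surface integral because `⟪n, v⟫ = 0` on them.
  have hpar : ∀ f ∈ H, f ∉ F → ∫ p in hyperplane f.1 f.2 ×ˢ univ, G p ∂(lateralSurface U a b)
      = 0 := by
    intro f hfH hf
    have hfv : inner ℝ f.1 v = 0 := by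
      by_contra h0; exact hf (by simp only [hF, Finset.mem_filter]; exact ⟨hfH, h0⟩)
    obtain ⟨L, hL⟩ := exists_isNormalFrame hd (hU.unit f hfH)
    rw [← hU.planeMeasure_restrict hL]
    refine integral_eq_zero_of_ae ?_
    have := hL.sigmaFinite_surface f.2
    have hq : Measure.QuasiMeasurePreserving Prod.fst (planeMeasure f.1 f.2)
      ((μHE[d - 1] : Measure (Space d)).restrict (hyperplane f.1 f.2)) :=
      Measure.quasiMeasurePreserving_fst
    filter_upwards [ae_restrict_mem hFr, ae_restrict_of_ae
      (hU.ae_generic_planeMeasure hd hfH), ae_restrict_of_ae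
      (hq.ae (ae_restrict_mem (isClosed_hyperplane _ _).measurableSet))] with p hp hp2 hp3
    have : inner ℝ (outwardNormal U p.1) v = (0 : ℝ) := by
      rcases hU.exists_isOutwardNormal hfH hp.1 hp3 hp2 with h1 | h1
      · rw [h1.outwardNormal_eq, hfv]
      · rw [h1.outwardNormal_eq, inner_neg_left, hfv, neg_zero]
    simp only [hG, this, Complex.ofReal_zero, zero_mul, Pi.zero_apply]
  calc ∫ p in K, W p = ∫ q, K.indicator W (A q) ∂(volume.prod volume) := by
        rw [← integral_indicator hKm, hAp.integral_comp hAe]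
    _ = ∫ z, ∫ s, K.indicator W (A (z, s)) := integral_prod _ (hAi hWi)
    _ = ∫ z, ∑ f ∈ F, (frontier U ×ˢ Ioo a b).indicator (Φ f) (lateralProj f.1 f.2 v L' z) :=
        integral_congr_ae hline
    _ = ∑ f ∈ F, ∫ p in hyperplane f.1 f.2 ×ˢ univ, G p ∂(lateralSurface U a b) := by
        rw [integral_finsetSum _ fun f hf => (hface f hf).1]
        exact Finset.sum_congr rfl fun f hf => (hface f hf).2
    _ = ∑ f ∈ H, ∫ p in hyperplane f.1 f.2 ×ˢ univ, G p ∂(lateralSurface U a b) :=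
        Finset.sum_subset (Finset.filter_subset _ _) hpar
    _ = ∫ p, G p ∂(lateralSurface U a b) := (hU.integral_lateralSurface hd hGi).symm

end green

/-! ### The energy identity on one element. -/

section element

variable {d : ℕ}

theorem HasL2WeakDeriv.memLp_weakDeriv {K : Set (SpaceTime d)} {v : SpaceTime d}
    {u : SpaceTime d → ℂ} (h : HasL2WeakDeriv K v u) :
    MemLp (weakDeriv K v u) 2 (volume.restrict K) := by
  rw [weakDeriv, dif_pos h]; exact h.choose_spec.1

theorem HasL2WeakDeriv.isWeakDeriv {K : Set (SpaceTime d)} {v : SpaceTime d}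
    {u : SpaceTime d → ℂ} (h : HasL2WeakDeriv K v u) : IsWeakDeriv K v u (weakDeriv K v u) := by
  rw [weakDeriv, dif_pos h]; exact h.choose_spec.2

variable {U : Set (Space d)} {H : Finset (Space d × ℝ)} {a b : ℝ} {u : SpaceTime d → ℂ}
  {V : SpaceTime d → ℝ}

theorem MemLocalSpace.hasL2Trace_lateral (hu : MemLocalSpace (U ×ˢ Ioo a b) u)
    (hU : IsBoundedBy U H) (hd : 0 < d) :
    HasL2Trace (U ×ˢ Ioo a b) u (lateralSurface U a b) :=
  hU.hasL2Trace_lateral hd hu.1 (fun j => (hu.2.2.1 j).memLp_weakDeriv)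
    fun j => (hu.2.2.1 j).isWeakDeriv

theorem MemLocalSpace.hasL2Trace_lateral_grad (hu : MemLocalSpace (U ×ˢ Ioo a b) u)
    (hU : IsBoundedBy U H) (hd : 0 < d) (j : Fin d) :
    HasL2Trace (U ×ˢ Ioo a b) (weakDeriv (U ×ˢ Ioo a b) (spaceDir j) u) (lateralSurface U a b) :=
  hU.hasL2Trace_lateral hd (hu.2.2.1 j).memLp_weakDeriv
    (fun k => (hu.2.2.2 j k).memLp_weakDeriv) fun k => (hu.2.2.2 j k).isWeakDeriv

theorem MemLocalSpace.memLp_top (hu : MemLocalSpace (U ×ˢ Ioo a b) u)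
    (hU : IsBoundedBy U H) (hab : a < b) :
    MemLp (fun x => trace (U ×ˢ Ioo a b) u (x, b)) 2 (volume.restrict U) :=
  (hu.2.1.isWeakDeriv.top hU.isOpen (hU.volume_lt_top a b).ne hab hu.1 hu.2.1.memLp_weakDeriv).2

theorem MemLocalSpace.memLp_bottom (hu : MemLocalSpace (U ×ˢ Ioo a b) u)
    (hU : IsBoundedBy U H) (hab : a < b) :
    MemLp (fun x => trace (U ×ˢ Ioo a b) u (x, a)) 2 (volume.restrict U) :=
  (hu.2.1.isWeakDeriv.bottom hU.isOpen (hU.volume_lt_top a b).ne hab hu.1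
    hu.2.1.memLp_weakDeriv).2

theorem MemLocalSpace.hasL2Trace_top (hu : MemLocalSpace (U ×ˢ Ioo a b) u)
    (hU : IsBoundedBy U H) (hab : a < b) :
    HasL2Trace (U ×ˢ Ioo a b) u (Measure.map (fun x : Space d => (x, b)) (volume.restrict U)) := by
  refine hasL2Trace_slice hU.isOpen ?_ (hu.memLp_top hU hab)
  filter_upwards [(hu.2.1.isWeakDeriv.top hU.isOpen (hU.volume_lt_top a b).ne hab hu.1
    hu.2.1.memLp_weakDeriv).1] with x hx hxU using (hx hxU).1

theorem MemLocalSpace.hasL2Trace_bottom (hu : MemLocalSpace (U ×ˢ Ioo a b) u)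
    (hU : IsBoundedBy U H) (hab : a < b) :
    HasL2Trace (U ×ˢ Ioo a b) u (Measure.map (fun x : Space d => (x, a)) (volume.restrict U)) := by
  refine hasL2Trace_slice hU.isOpen ?_ (hu.memLp_bottom hU hab)
  filter_upwards [(hu.2.1.isWeakDeriv.bottom hU.isOpen (hU.volume_lt_top a b).ne hab hu.1
    hu.2.1.memLp_weakDeriv).1] with x hx hxU using (hx hxU).1

theorem integral_mul_conj_self {X : Type*} [MeasurableSpace X] {μ : Measure X} (f : X → ℂ) :
    ∫ x, f x * conj (f x) ∂μ = ((∫ x, ‖f x‖ ^ 2 ∂μ : ℝ) : ℂ) := by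
  rw [← integral_complex_ofReal]
  exact integral_congr_ae (.of_forall fun x => by simp [Complex.mul_conj'])

/-- The energy identity on one element. -/
theorem MemLocalSpace.im_setIntegral_mul_conj_schrodinger (hu : MemLocalSpace (U ×ˢ Ioo a b) u)
    (hU : IsBoundedBy U H) (hd : 0 < d) (hab : a < b)
    (hV : MemLp (fun p => (V p : ℂ) * u p) 2 (volume.restrict (U ×ˢ Ioo a b))) :
    (∫ p in U ×ˢ Ioo a b, u p * conj (schrodinger V (U ×ˢ Ioo a b) u p)).im
      = -(1 / 2) * ((∫ x in U, ‖trace (U ×ˢ Ioo a b) u (x, b)‖ ^ 2)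
          - ∫ x in U, ‖trace (U ×ˢ Ioo a b) u (x, a)‖ ^ 2)
        + (1 / 2) * ∫ p, (trace (U ×ˢ Ioo a b) u p * conj (∑ j,
            trace (U ×ˢ Ioo a b) (weakDeriv (U ×ˢ Ioo a b) (spaceDir j) u) p *
              ((outwardNormal U p.1 j : ℝ) : ℂ))).im ∂(lateralSurface U a b) := by
  set K : Set (SpaceTime d) := U ×ˢ Ioo a b with hK
  set ut := weakDeriv K (timeDir d) u with hut
  set ux : Fin d → SpaceTime d → ℂ := fun j => weakDeriv K (spaceDir j) u with hux
  set uxx : Fin d → SpaceTime d → ℂ := fun j => weakDeriv K (spaceDir j) (ux j) with huxx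
  set τ := trace K u
  set τx : Fin d → SpaceTime d → ℂ := fun j => trace K (ux j) with hτx
  have mt : MemLp ut 2 (volume.restrict K) := hu.2.1.memLp_weakDeriv
  have mx : ∀ j, MemLp (ux j) 2 (volume.restrict K) := fun j => (hu.2.2.1 j).memLp_weakDeriv
  have mxx : ∀ j, MemLp (uxx j) 2 (volume.restrict K) := fun j => (hu.2.2.2 j j).memLp_weakDeriv
  have mτ : MemLp τ 2 (lateralSurface U a b) := (hu.hasL2Trace_lateral hU hd).2
  have mτx : ∀ j, MemLp (τx j) 2 (lateralSurface U a b) := fun j =>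
    (hu.hasL2Trace_lateral_grad hU hd j).2
  have it := memLp_two_integrable_mul_conj hu.1 mt
  have it' := memLp_two_integrable_mul_conj mt hu.1
  have ixx := fun j => memLp_two_integrable_mul_conj hu.1 (mxx j)
  have ixx' := fun j => memLp_two_integrable_mul_conj (mx j) (mx j)
  have iV := memLp_two_integrable_mul_conj hu.1 hV
  have e0 : ∫ p in K, u p * conj (schrodinger V K u p)
      = -Complex.I * (∫ p in K, u p * conj (ut p))
        + (1 / 2) * ∑ j, (∫ p in K, u p * conj (uxx j p))
        - ∫ p in K, u p * conj ((V p : ℂ) * u p) := by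
    have i1 : IntegrableOn (fun p => -Complex.I * (u p * conj (ut p))
        + (1 / 2) * ∑ j, u p * conj (uxx j p)) K :=
      (it.const_mul _).add ((integrable_finsetSum _ fun j _ => ixx j).const_mul _)
    rw [← integral_const_mul, ← integral_finsetSum _ fun j _ => ixx j, ← integral_const_mul,
      ← integral_add (it.const_mul _) ((integrable_finsetSum _ fun j _ => ixx j).const_mul _),
      ← integral_sub i1 iV]
    refine integral_congr_ae (.of_forall fun p => ?_)
    have e : schrodinger V K u p = Complex.I * ut p + (1 / 2) * ∑ j, uxx j p - V p * u p := rfl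
    simp only [e, map_add, map_sub, map_mul, map_sum, Complex.conj_I, map_div₀, map_one, map_ofNat,
      ← Finset.mul_sum]
    ring
  have eV : (∫ p in K, u p * conj ((V p : ℂ) * u p)).im = 0 := by
    have : ∫ p in K, u p * conj ((V p : ℂ) * u p)
        = ((∫ p in K, V p * ‖u p‖ ^ 2 : ℝ) : ℂ) := by
      rw [← integral_complex_ofReal]
      refine integral_congr_ae (.of_forall fun p => ?_)
      simp only [map_mul, Complex.conj_ofReal, Complex.ofReal_mul, Complex.ofReal_pow]
      rw [← Complex.mul_conj']; ring
    rw [this, Complex.ofReal_im]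
  -- Integrating `u * conj u` by parts in time gives the integral plus its conjugate, hence twice
  -- its real part.
  have et : (∫ p in K, u p * conj (ut p)).re
      = (1 / 2) * ((∫ x in U, ‖τ (x, b)‖ ^ 2) - ∫ x in U, ‖τ (x, a)‖ ^ 2) := by
    have h1 := hu.2.1.isWeakDeriv.setIntegral_time hU.isOpen (hU.volume_lt_top a b).ne hab hu.1 mt
      hu.1 mt hu.2.1.isWeakDeriv
    rw [integral_mul_conj_self, integral_mul_conj_self, integral_add it it'] at h1
    have h2 : ∫ p in K, ut p * conj (u p) = conj (∫ p in K, u p * conj (ut p)) := by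
      rw [← integral_conj]
      refine integral_congr_ae (.of_forall fun p => ?_)
      simp only [map_mul, Complex.conj_conj]; ring
    have h3 := congrArg Complex.re h1
    rw [h2, Complex.add_re, Complex.conj_re, Complex.sub_re, Complex.ofReal_re,
      Complex.ofReal_re] at h3
    linarith
  have iτ : ∀ j, Integrable (fun p => ((outwardNormal U p.1 j : ℝ) : ℂ) * (τ p * conj (τx j p)))
      (lateralSurface U a b) := fun j => by
    refine (memLp_two_integrable_mul_conj mτ (mτx j)).bdd_mul (c := 1) ?_
      (.of_forall fun p => ?_)
    · exact Complex.continuous_ofReal.comp_aestronglyMeasurable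
        ((EuclideanSpace.proj (𝕜 := ℝ) j).continuous.comp_aestronglyMeasurable
          (hU.aestronglyMeasurable_outwardNormal_lateral hd a b))
    · rw [Complex.norm_real]
      exact (PiLp.norm_apply_le _ j).trans (norm_outwardNormal_le U _)
  -- In Green's formula for `u` and its `j`-th derivative, the volume term `|∂_j u|²` is real and
  -- disappears from the imaginary part.
  have exx : ∀ j, (∫ p in K, u p * conj (uxx j p)).im
      = (∫ p, ((outwardNormal U p.1 j : ℝ) : ℂ) * (τ p * conj (τx j p))
          ∂(lateralSurface U a b)).im := fun j => by
    have h1 := hU.setIntegral_space hd (v := EuclideanSpace.single j 1) (by simp)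
      hu.1 (mx j) (hu.2.2.1 j).isWeakDeriv (mx j) (mxx j) (hu.2.2.2 j j).isWeakDeriv mτ (mτx j)
    rw [integral_add (ixx j) (ixx' j), integral_mul_conj_self] at h1
    have h3 := congrArg Complex.im h1
    rw [Complex.add_im, Complex.ofReal_im, add_zero] at h3
    rw [h3]
    congr 1
    refine integral_congr_ae (.of_forall fun p => ?_)
    have e : inner ℝ (outwardNormal U p.1) (EuclideanSpace.single j 1) = outwardNormal U p.1 j := by
      simp [EuclideanSpace.inner_single_right]
    simp only [e]
    rfl
  have elat : ∫ p, (τ p * conj (∑ j, τx j p * ((outwardNormal U p.1 j : ℝ) : ℂ))).im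
      ∂(lateralSurface U a b) = ∑ j, (∫ p, ((outwardNormal U p.1 j : ℝ) : ℂ) *
        (τ p * conj (τx j p)) ∂(lateralSurface U a b)).im := by
    rw [← Complex.im_sum, ← integral_finsetSum _ fun j _ => iτ j]
    have := integral_im (𝕜 := ℂ) (integrable_finsetSum Finset.univ fun j _ => iτ j)
    simp only [RCLike.im_to_complex] at this
    rw [← this]
    refine integral_congr_ae (.of_forall fun p => ?_)
    simp only
    congr 1
    rw [map_sum, Finset.mul_sum]
    refine Finset.sum_congr rfl fun j _ => ?_
    rw [map_mul, Complex.conj_ofReal]; ring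
  rw [e0, Complex.sub_im, Complex.add_im, eV, elat]
  have h1 : (-Complex.I * ∫ p in K, u p * conj (ut p)).im
      = -(∫ p in K, u p * conj (ut p)).re := by simp
  have h2 : ((1 / 2 : ℂ) * ∑ j, (∫ p in K, u p * conj (uxx j p))).im
      = (1 / 2) * ∑ j, (∫ p in K, u p * conj (uxx j p)).im := by
    have : (1 / 2 : ℂ) = ((1 / 2 : ℝ) : ℂ) := by push_cast; rfl
    rw [this, Complex.im_ofReal_mul, Complex.im_sum]
  rw [h1, h2, et, Finset.sum_congr rfl fun j _ => exx j]
  ring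

end element

/-! ### Normals of touching and nested sets. -/

section normals

variable {d : ℕ} {U U' : Set (Space d)} {x m m' : Space d}

/-- Unless the normals are opposite, the direction `-(m + m')` enters both half-spaces, and the two
sets overlap. -/
theorem IsOutwardNormal.eq_neg_of_disjoint (h : IsOutwardNormal U x m) (h' : IsOutwardNormal U' x m')
    (hd : Disjoint U U') : m' = -m := by
  by_contra hne
  have h1 : inner ℝ m (-m') < 1 := by
    refine (inner_lt_one_iff_real_of_norm_eq_one h.1 (by rw [norm_neg, h'.1])).mpr fun e => hne ?_
    rw [e, neg_neg]
  rw [inner_neg_right] at h1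
  have hm : inner ℝ m m = 1 := by rw [real_inner_self_eq_norm_sq, h.1, one_pow]
  have hm' : inner ℝ m' m' = 1 := by rw [real_inner_self_eq_norm_sq, h'.1, one_pow]
  obtain ⟨ε, hε, hin, -⟩ := h.exists_ray (v := -(m + m')) (by
    rw [inner_neg_left, inner_add_left, hm, real_inner_comm]; linarith)
  obtain ⟨ε', hε', hin', -⟩ := h'.exists_ray (v := -(m + m')) (by
    rw [inner_neg_left, inner_add_left, hm']; linarith)
  have hpos : 0 < min ε ε' := lt_min hε hε'
  exact disjoint_left.mp hd
    (hin (min ε ε' / 2) ⟨by linarith, by linarith [min_le_left ε ε']⟩)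
    (hin' (min ε ε' / 2) ⟨by linarith, by linarith [min_le_right ε ε']⟩)

/-- If the normals differ, the direction `m' - m` enters `U` while leaving `U'`. -/
theorem IsOutwardNormal.eq_of_subset (h : IsOutwardNormal U x m) (h' : IsOutwardNormal U' x m')
    (hs : U ⊆ U') : m = m' := by
  by_contra hne
  have h1 : inner ℝ m m' < 1 := (inner_lt_one_iff_real_of_norm_eq_one h.1 h'.1).mpr hne
  have hm : inner ℝ m m = 1 := by rw [real_inner_self_eq_norm_sq, h.1, one_pow]
  have hm' : inner ℝ m' m' = 1 := by rw [real_inner_self_eq_norm_sq, h'.1, one_pow]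
  obtain ⟨ε, hε, hin, -⟩ := h.exists_ray (v := m' - m) (by
    rw [inner_sub_left, hm, real_inner_comm]; linarith)
  obtain ⟨ε', hε', -, hout⟩ := h'.exists_ray (v := m - m') (by
    rw [inner_sub_left, hm']; linarith)
  have hpos : 0 < min ε ε' := lt_min hε hε'
  have h2 := hs (hin (min ε ε' / 2) ⟨by linarith, by linarith [min_le_left ε ε']⟩)
  have h3 := hout (-(min ε ε' / 2)) ⟨by linarith [min_le_right ε ε'], by linarith⟩
  rw [neg_smul, ← smul_neg, neg_sub] at h3
  exact h3 h2

theorem IsOutwardNormal.ne_neg (h : IsOutwardNormal U x m) : m ≠ -m := by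
  intro e
  have h1 : inner ℝ m m = inner ℝ m (-m) := congrArg (inner ℝ m) e
  rw [inner_neg_right, real_inner_self_eq_norm_sq, h.1] at h1
  norm_num at h1

end normals

/-! ### Geometry of the mesh. -/

namespace PrismaticMesh

variable {d : ℕ} {Ω : Set (Space d)} {T : ℝ} {ι : Type*} (M : PrismaticMesh Ω T ι)

theorem measurableSet_lateral (i : ι) : MeasurableSet (M.lateral i) :=
  isClosed_frontier.measurableSet.prod measurableSet_Ioo

theorem measurableSet_top (i : ι) : MeasurableSet (M.top i) :=
  (M.polytope i).2.1.measurableSet.prod (measurableSet_singleton _)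

theorem measurableSet_bottom (i : ι) : MeasurableSet (M.bottom i) :=
  (M.polytope i).2.1.measurableSet.prod (measurableSet_singleton _)

variable [Fintype ι]

theorem measurableSet_Ftime (hΩ : IsOpen Ω) : MeasurableSet M.Ftime := by
  have : M.Ftime = Ω ×ˢ Ioo 0 T ∩ ⋃ i, ⋃ j, ⋃ (_ : i ≠ j), M.lateral i ∩ M.lateral j := by
    ext p; simp only [Ftime, mem_ofPred_eq, mem_inter_iff, mem_iUnion, exists_prop]
  rw [this]
  exact (hΩ.measurableSet.prod measurableSet_Ioo).inter (.iUnion fun i => .iUnion fun j =>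
    .iUnion fun _ => (M.measurableSet_lateral i).inter (M.measurableSet_lateral j))

/-- The union of the space boundaries of `Ω` and of all elements. -/
def skeleton : Set (Space d) := frontier Ω ∪ ⋃ i, frontier (M.Kx i)

theorem isFiniteMeasure_skeleton (hd : 0 < d) (hΩ : IsPolytope Ω) :
    IsFiniteMeasure ((μHE[d - 1] : Measure (Space d)).restrict M.skeleton) := by
  refine ⟨?_⟩
  rw [Measure.restrict_apply_univ, skeleton]
  obtain ⟨H, hH⟩ := hΩ.exists_isBoundedBy
  refine (measure_union_le _ _).trans_lt (ENNReal.add_lt_top.mpr ⟨hH.surface_frontier_lt_top hd, ?_⟩)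
  refine (measure_iUnion_fintype_le _ _).trans_lt (ENNReal.sum_lt_top.mpr fun i _ => ?_)
  obtain ⟨H, hH⟩ := (M.polytope i).exists_isBoundedBy
  exact hH.surface_frontier_lt_top hd

theorem lateralMeasure_eq : M.lateralMeasure
    = ((μHE[d - 1] : Measure (Space d)).restrict M.skeleton).prod volume := rfl

theorem lateralMeasure_restrict_lateral (hd : 0 < d) (hΩ : IsPolytope Ω) (i : ι) :
    M.lateralMeasure.restrict (M.lateral i) = lateralSurface (M.Kx i) (M.a i) (M.b i) := by
  have := M.isFiniteMeasure_skeleton hd hΩ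
  have hsub : frontier (M.Kx i) ⊆ M.skeleton :=
    (subset_iUnion (fun i => frontier (M.Kx i)) i).trans subset_union_right
  rw [lateralMeasure_eq, lateral, ← Measure.prod_restrict,
    Measure.restrict_restrict isClosed_frontier.measurableSet, lateralSurface,
    inter_eq_left.mpr hsub]

/-- The set of all time levels. -/
def levels : Set ℝ := {0, T} ∪ range M.a ∪ range M.b

theorem finite_levels : M.levels.Finite :=
  (((finite_singleton T).insert 0).union (finite_range _)).union (finite_range _)

theorem isFiniteMeasure_levels : IsFiniteMeasure ((Measure.count : Measure ℝ).restrict M.levels) :=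
  ⟨by
    rw [Measure.restrict_apply_univ]
    exact Measure.count_apply_lt_top.mpr M.finite_levels⟩

/-- Counting measure on the finite set of levels gives each level mass one, also when it arises
several times as an end point of elements. -/
theorem horizontalMeasure_restrict {t : ℝ} (ht : t ∈ M.levels) (U : Set (Space d)) :
    M.horizontalMeasure.restrict (U ×ˢ {t})
      = Measure.map (fun x : Space d => (x, t)) (volume.restrict U) := by
  have := M.isFiniteMeasure_levels
  have e : M.horizontalMeasure
      = (volume : Measure (Space d)).prod ((Measure.count : Measure ℝ).restrict M.levels) := rfl
  rw [e, ← Measure.prod_restrict, Measure.restrict_restrict (measurableSet_singleton _),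
    inter_eq_left.mpr (singleton_subset_iff.mpr ht), Measure.restrict_singleton,
    Measure.count_singleton, one_smul, Measure.prod_dirac]

theorem b_mem_levels (i : ι) : M.b i ∈ M.levels := Or.inr (mem_range_self i)

theorem a_mem_levels (i : ι) : M.a i ∈ M.levels := Or.inl (Or.inr (mem_range_self i))

theorem tracesWellDefined (hd : 0 < d) (hΩ : IsPolytope Ω) {w : ι → SpaceTime d → ℂ}
    (hw : M.MemBroken w) : M.TracesWellDefined w := by
  intro i
  obtain ⟨H, hH⟩ := (M.polytope i).exists_isBoundedBy
  have hwi : MemLocalSpace (M.Kx i ×ˢ Ioo (M.a i) (M.b i)) (w i) := hw i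
  rw [M.lateralMeasure_restrict_lateral hd hΩ i, top, bottom,
    M.horizontalMeasure_restrict (M.b_mem_levels i),
    M.horizontalMeasure_restrict (M.a_mem_levels i)]
  exact ⟨hwi.hasL2Trace_lateral hH hd, hwi.hasL2Trace_lateral_grad hH hd,
    hwi.hasL2Trace_top hH (M.lt i), hwi.hasL2Trace_bottom hH (M.lt i)⟩

theorem setIntegral_top (i : ι) (f : SpaceTime d → ℝ) :
    ∫ p in M.top i, f p ∂M.horizontalMeasure = ∫ x in M.Kx i, f (x, M.b i) := by
  rw [top, M.horizontalMeasure_restrict (M.b_mem_levels i)]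
  exact (measurableEmbedding_prodMk_right _).integral_map _

theorem setIntegral_bottom (i : ι) (f : SpaceTime d → ℝ) :
    ∫ p in M.bottom i, f p ∂M.horizontalMeasure = ∫ x in M.Kx i, f (x, M.a i) := by
  rw [bottom, M.horizontalMeasure_restrict (M.a_mem_levels i)]
  exact (measurableEmbedding_prodMk_right _).integral_map _

/-! ### The elements around a point -/

theorem disjoint_space {i j : ι} (hij : i ≠ j) {t : ℝ} (hi : t ∈ Ioo (M.a i) (M.b i))
    (hj : t ∈ Ioo (M.a j) (M.b j)) : Disjoint (M.Kx i) (M.Kx j) :=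
  disjoint_left.mpr fun x hx hx' => disjoint_left.mp (M.disjoint i j hij)
    (show (x, t) ∈ M.Kx i ×ˢ Ioo (M.a i) (M.b i) from ⟨hx, hi⟩) ⟨hx', hj⟩

/-- Two different elements with a common point on their top faces would overlap just below it. -/
theorem eq_of_mem_top {i j : ι} {p : SpaceTime d} (hi : p ∈ M.top i) (hj : p ∈ M.top j) :
    i = j := by
  by_contra hne
  have h1 : p.2 = M.b i := hi.2
  have h2 : p.2 = M.b j := hj.2
  have h3 : max (M.a i) (M.a j) < p.2 := max_lt (h1 ▸ M.lt i) (h2 ▸ M.lt j)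
  have h4 := le_max_left (M.a i) (M.a j)
  have h5 := le_max_right (M.a i) (M.a j)
  exact disjoint_left.mp (M.disjoint_space hne (t := (max (M.a i) (M.a j) + p.2) / 2)
    ⟨by linarith, by linarith⟩ ⟨by linarith, by linarith⟩) hi.1 hj.1

theorem eq_of_mem_bottom {i j : ι} {p : SpaceTime d} (hi : p ∈ M.bottom i) (hj : p ∈ M.bottom j) :
    i = j := by
  by_contra hne
  have h1 : p.2 = M.a i := hi.2
  have h2 : p.2 = M.a j := hj.2
  have h3 : p.2 < min (M.b i) (M.b j) := lt_min (h1 ▸ M.lt i) (h2 ▸ M.lt j)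
  have h4 := min_le_left (M.b i) (M.b j)
  have h5 := min_le_right (M.b i) (M.b j)
  exact disjoint_left.mp (M.disjoint_space hne (t := (min (M.b i) (M.b j) + p.2) / 2)
    ⟨by linarith, by linarith⟩ ⟨by linarith, by linarith⟩) hi.1 hj.1

theorem exists_mem_closure {x : Space d} {t : ℝ} (hx : x ∈ closure Ω) (ht : t ∈ Icc 0 T) :
    ∃ i, x ∈ closure (M.Kx i) ∧ t ∈ Icc (M.a i) (M.b i) := by
  have : (x, t) ∈ ⋃ i, closure (M.Kx i) ×ˢ Icc (M.a i) (M.b i) := by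
    rw [M.cover]; exact ⟨hx, ht⟩
  obtain ⟨i, hi⟩ := mem_iUnion.mp this
  exact ⟨i, hi.1, hi.2⟩

theorem mem_of_notMem_frontier {x : Space d} {i : ι} (hx : x ∈ closure (M.Kx i))
    (hf : x ∉ frontier (M.Kx i)) : x ∈ M.Kx i := by
  by_contra h
  exact hf (by rw [(M.polytope i).2.1.frontier_eq]; exact ⟨hx, h⟩)

theorem ae_notMem_frontier (hd : 0 < d) : ∀ᵐ p ∂M.horizontalMeasure, ∀ i, p.1 ∉ frontier (M.Kx i) := by
  have := M.isFiniteMeasure_levels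
  have hq : Measure.QuasiMeasurePreserving Prod.fst M.horizontalMeasure
    (volume : Measure (Space d)) := Measure.quasiMeasurePreserving_fst
  refine hq.ae (p := fun x => ∀ i, x ∉ frontier (M.Kx i)) (ae_all_iff.mpr fun i => ?_)
  obtain ⟨H, hH⟩ := (M.polytope i).exists_isBoundedBy
  rw [ae_iff]
  simp only [not_not]
  refine measure_mono_null hH.subset ((measure_biUnion_null_iff H.countable_toSet).mpr
    fun h hh => ?_)
  obtain ⟨L, hL⟩ := exists_isNormalFrame hd (hH.unit h hh)
  exact hL.volume_hyperplane h.2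

theorem mem_Fspace_of_mem_top {p : SpaceTime d} (hp : ∀ i, p.1 ∉ frontier (M.Kx i)) {i : ι}
    (hi : p ∈ M.top i) (hT : p.2 ≠ T) : p ∈ M.Fspace := by
  obtain ⟨x, t⟩ := p
  have hx : x ∈ M.Kx i := hi.1
  have htb : t = M.b i := hi.2
  have ht : t < T := lt_of_le_of_ne (htb ▸ M.le i) hT
  have h0 : 0 < t := htb ▸ (M.nonneg i).trans_lt (M.lt i)
  have hxΩ : x ∈ Ω := M.subset_space i hx
  -- A time `s` slightly later than `t`, before `T` and before every level `a j` beyond `t`: the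
  -- element covering `(x, s)` must therefore have started at or before `t`.
  have hev : ∀ᶠ s in 𝓝[>] t, s < T ∧ ∀ j, t < M.a j → s < M.a j := by
    refine (eventually_nhdsWithin_of_eventually_nhds (eventually_lt_nhds ht)).and
      (eventually_all.mpr fun j => ?_)
    by_cases hj : t < M.a j
    · filter_upwards [eventually_nhdsWithin_of_eventually_nhds (eventually_lt_nhds hj)]
        with s hs _ using hs
    · exact .of_forall fun s h => absurd h hj
  obtain ⟨s, ⟨hsT, hsa⟩, hts⟩ := (hev.and self_mem_nhdsWithin).exists
  have hts' : t < s := hts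
  obtain ⟨j, hxj, hsj⟩ := M.exists_mem_closure (subset_closure hxΩ) ⟨(h0.trans hts').le, hsT.le⟩
  have hxj' := M.mem_of_notMem_frontier hxj (hp j)
  have haj : M.a j ≤ t := not_lt.mp fun h => (hsa j h).not_ge hsj.1
  have hbj : t < M.b j := hts'.trans_le hsj.2
  have hne : i ≠ j := by rintro rfl; exact (htb ▸ hbj).false
  -- Had the covering element started strictly before `t`, it would overlap with element `i` just
  -- below `t`.
  have haj' : M.a j = t := by
    by_contra hlt
    have hlt' : M.a j < t := lt_of_le_of_ne haj hlt
    have h3 : max (M.a i) (M.a j) < t := max_lt (htb ▸ M.lt i) hlt'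
    have h4 := le_max_left (M.a i) (M.a j)
    have h5 := le_max_right (M.a i) (M.a j)
    exact disjoint_left.mp (M.disjoint_space hne (t := (max (M.a i) (M.a j) + t) / 2)
      ⟨by linarith, by linarith⟩ ⟨by linarith, by linarith⟩) hx hxj'
  exact ⟨⟨hxΩ, h0, ht⟩, i, j, hi, hxj', haj'.symm⟩

theorem mem_Fspace_of_mem_bottom {p : SpaceTime d} (hp : ∀ i, p.1 ∉ frontier (M.Kx i)) {i : ι}
    (hi : p ∈ M.bottom i) (h0 : p.2 ≠ 0) : p ∈ M.Fspace := by
  obtain ⟨x, t⟩ := p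
  have hx : x ∈ M.Kx i := hi.1
  have hta : t = M.a i := hi.2
  have ht : 0 < t := lt_of_le_of_ne (hta ▸ M.nonneg i) (Ne.symm h0)
  have hT : t < T := hta ▸ (M.lt i).trans_le (M.le i)
  have hxΩ : x ∈ Ω := M.subset_space i hx
  have hev : ∀ᶠ s in 𝓝[<] t, 0 < s ∧ ∀ j, M.b j < t → M.b j < s := by
    refine (eventually_nhdsWithin_of_eventually_nhds (eventually_gt_nhds ht)).and
      (eventually_all.mpr fun j => ?_)
    by_cases hj : M.b j < t
    · filter_upwards [eventually_nhdsWithin_of_eventually_nhds (eventually_gt_nhds hj)]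
        with s hs _ using hs
    · exact .of_forall fun s h => absurd h hj
  obtain ⟨s, ⟨hs0, hsb⟩, hst⟩ := (hev.and self_mem_nhdsWithin).exists
  have hst' : s < t := hst
  obtain ⟨j, hxj, hsj⟩ := M.exists_mem_closure (subset_closure hxΩ) ⟨hs0.le, (hst'.trans hT).le⟩
  have hxj' := M.mem_of_notMem_frontier hxj (hp j)
  have hbj : t ≤ M.b j := not_lt.mp fun h => (hsb j h).not_ge hsj.2
  have haj : M.a j < t := hsj.1.trans_lt hst'
  have hne : i ≠ j := by rintro rfl; exact (hta ▸ haj).false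
  have hbj' : t = M.b j := by
    by_contra hlt
    have hlt' : t < M.b j := lt_of_le_of_ne hbj hlt
    have h3 : t < min (M.b i) (M.b j) := lt_min (hta ▸ M.lt i) hlt'
    have h4 := min_le_left (M.b i) (M.b j)
    have h5 := min_le_right (M.b i) (M.b j)
    exact disjoint_left.mp (M.disjoint_space hne (t := (min (M.b i) (M.b j) + t) / 2)
      ⟨by linarith, by linarith⟩ ⟨by linarith, by linarith⟩) hx hxj'
  exact ⟨⟨hxΩ, ht, hT⟩, j, i, ⟨hxj', hbj'⟩, hi⟩

/-- Across a flat boundary point of an element that is interior to `Ω` there is another element. -/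
theorem exists_neighbour (hΩ : IsOpen Ω) {p : SpaceTime d} (hp : p.1 ∈ Ω) {i : ι}
    (hi : p ∈ M.lateral i) (hlev : p.2 ∉ M.levels) {m : Space d}
    (hm : IsOutwardNormal (M.Kx i) p.1 m) : ∃ j, i ≠ j ∧ p ∈ M.lateral j := by
  obtain ⟨x, t⟩ := p
  have hxi : x ∈ frontier (M.Kx i) := hi.1
  have hti : t ∈ Ioo (M.a i) (M.b i) := hi.2
  have ht : t ∈ Icc 0 T := ⟨(M.nonneg i).trans hti.1.le, hti.2.le.trans (M.le i)⟩
  obtain ⟨-, r, hr, hU⟩ := id hm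
  have hcont : Continuous fun s : ℝ => x + s • m := by fun_prop
  have h0 : x + (0 : ℝ) • m = x := by simp
  -- The point is pushed outwards so little that it stays in `Ω` and enters only closures already
  -- containing `x`; the element covering the new point then has `x` in its closure.
  have hev : ∀ᶠ s in 𝓝[>] (0 : ℝ), x + s • m ∈ Ω ∧ x + s • m ∈ Metric.ball x r ∧
      ∀ j, x ∉ closure (M.Kx j) → x + s • m ∉ closure (M.Kx j) := by
    have hnhds : ∀ {O : Set (Space d)}, IsOpen O → x ∈ O → ∀ᶠ s in 𝓝[>] (0 : ℝ), x + s • m ∈ O :=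
      fun hO hx => eventually_nhdsWithin_of_eventually_nhds
        (hcont.continuousAt.eventually_mem (hO.mem_nhds (by rwa [h0])))
    refine (hnhds hΩ hp).and ((hnhds Metric.isOpen_ball (Metric.mem_ball_self hr)).and
      (eventually_all.mpr fun j => ?_))
    by_cases hj : x ∈ closure (M.Kx j)
    · exact .of_forall fun s h => absurd hj h
    · filter_upwards [hnhds isClosed_closure.isOpen_compl hj] with s hs _ using hs
  obtain ⟨s, ⟨hsΩ, hsb, hsj⟩, hs⟩ := (hev.and self_mem_nhdsWithin).exists
  have hs0 : 0 < s := hs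
  obtain ⟨j, hj, htj⟩ := M.exists_mem_closure (subset_closure hsΩ) ht
  have hxj : x ∈ closure (M.Kx j) := by
    by_contra h; exact hsj j h hj
  have hne : i ≠ j := by
    rintro rfl
    have hOo : IsOpen (Metric.ball x r ∩ {y | 0 < inner ℝ (y - x) m}) :=
      Metric.isOpen_ball.inter (isOpen_lt continuous_const (by fun_prop))
    obtain ⟨y, hy, hyi⟩ := mem_closure_iff.mp hj _ hOo ⟨hsb, by
      simp only [mem_ofPred_eq, add_sub_cancel_left, real_inner_smul_left,
        real_inner_self_eq_norm_sq, hm.1]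
      linarith⟩
    have h1 := (hU y hy.1).mp hyi
    have h2 : 0 < inner ℝ (y - x) m := hy.2
    linarith
  have htj' : t ∈ Ioo (M.a j) (M.b j) :=
    ⟨lt_of_le_of_ne htj.1 fun e => hlev (e ▸ M.a_mem_levels j),
      lt_of_le_of_ne htj.2 fun e => hlev (e ▸ M.b_mem_levels j)⟩
  refine ⟨j, hne, ?_, htj'⟩
  rw [(M.polytope j).2.1.frontier_eq]
  -- If `x` were interior to the neighbour, points of element `i` near `x` would belong to both
  -- elements.
  refine ⟨hxj, fun hxKj => ?_⟩
  obtain ⟨y, hyj, hyi⟩ := mem_closure_iff.mp (frontier_subset_closure hxi) _ (M.polytope j).2.1 hxKj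
  exact disjoint_left.mp (M.disjoint_space hne hti htj') hyi hyj

/-- The time levels are excluded because at such times an element starting or ending there is met by
the closed cover without having the point on its open lateral boundary. -/
theorem ae_flat (hd : 0 < d) (hΩ : IsPolytope Ω) : ∀ᵐ p ∂M.lateralMeasure, p.2 ∉ M.levels ∧
    (p.1 ∈ frontier Ω → ∃ m, IsOutwardNormal Ω p.1 m) ∧
    ∀ i, p.1 ∈ frontier (M.Kx i) → ∃ m, IsOutwardNormal (M.Kx i) p.1 m := by
  have := M.isFiniteMeasure_skeleton hd hΩ
  have hq1 : Measure.QuasiMeasurePreserving Prod.fst M.lateralMeasure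
    ((μHE[d - 1] : Measure (Space d)).restrict M.skeleton) := Measure.quasiMeasurePreserving_fst
  have hq2 : Measure.QuasiMeasurePreserving Prod.snd M.lateralMeasure
    (volume : Measure ℝ) := Measure.quasiMeasurePreserving_snd
  have h1 : ∀ᵐ t : ℝ, t ∉ M.levels := by
    rw [ae_iff]; simpa using M.finite_levels.measure_zero volume
  obtain ⟨H, hH⟩ := hΩ.exists_isBoundedBy
  have h3 : ∀ᵐ x ∂(μHE[d - 1] : Measure (Space d)), ∀ i, x ∈ frontier (M.Kx i) →
      ∃ m, IsOutwardNormal (M.Kx i) x m := by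
    refine ae_all_iff.mpr fun i => ?_
    obtain ⟨H, hH⟩ := (M.polytope i).exists_isBoundedBy
    exact hH.ae_exists_isOutwardNormal hd
  filter_upwards [hq2.ae h1, hq1.ae (ae_restrict_of_ae (hH.ae_exists_isOutwardNormal hd)),
    hq1.ae (ae_restrict_of_ae h3)] with p hp1 hp2 hp3 using ⟨hp1, hp2, hp3⟩

/-- At almost every point of the lateral skeleton inside `Ω` exactly two elements meet, with
opposite normals. -/
theorem ae_interior (hd : 0 < d) (hΩ : IsPolytope Ω) : ∀ᵐ p ∂M.lateralMeasure, p.1 ∈ Ω →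
    ∀ i, p ∈ M.lateral i → ∃ j, i ≠ j ∧ p ∈ M.lateral j ∧
      outwardNormal (M.Kx j) p.1 = -outwardNormal (M.Kx i) p.1 ∧
      ∀ k, p ∈ M.lateral k → k = i ∨ k = j := by
  filter_upwards [M.ae_flat hd hΩ] with p ⟨hlev, _, hfl⟩ hpΩ i hi
  obtain ⟨m, hm⟩ := hfl i hi.1
  obtain ⟨j, hij, hj⟩ := M.exists_neighbour hΩ.2.1 hpΩ hi hlev hm
  obtain ⟨m', hm'⟩ := hfl j hj.1
  refine ⟨j, hij, hj, ?_, fun k hk => ?_⟩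
  · rw [hm.outwardNormal_eq, hm'.outwardNormal_eq]
    exact hm.eq_neg_of_disjoint hm' (M.disjoint_space hij hi.2 hj.2)
  -- Three pairwise disjoint half-spaces cannot meet at a flat point: their normals would be
  -- pairwise opposite.
  · by_contra hcon
    obtain ⟨hki, hkj⟩ := not_or.mp hcon
    obtain ⟨m'', hm''⟩ := hfl k hk.1
    have h1 := hm.eq_neg_of_disjoint hm' (M.disjoint_space hij hi.2 hj.2)
    have h2 := hm.eq_neg_of_disjoint hm'' (M.disjoint_space (Ne.symm hki) hi.2 hk.2)
    have h3 := hm'.eq_neg_of_disjoint hm'' (M.disjoint_space (Ne.symm hkj) hj.2 hk.2)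
    exact hm'.ne_neg (by rw [← h3, h1, h2])

/-- At almost every point of `∂Ω × (0, T)` at most one element arrives, with the normal of `Ω`. -/
theorem ae_boundary (hd : 0 < d) (hΩ : IsPolytope Ω) : ∀ᵐ p ∂M.lateralMeasure, p.1 ∈ frontier Ω →
    ∀ i, p ∈ M.lateral i → outwardNormal (M.Kx i) p.1 = outwardNormal Ω p.1 ∧
      ∀ k, p ∈ M.lateral k → k = i := by
  filter_upwards [M.ae_flat hd hΩ] with p ⟨_, hflΩ, hfl⟩ hpΩ i hi
  obtain ⟨m, hm⟩ := hfl i hi.1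
  obtain ⟨n, hn⟩ := hflΩ hpΩ
  refine ⟨?_, fun k hk => ?_⟩
  · rw [hm.outwardNormal_eq, hn.outwardNormal_eq]
    exact hm.eq_of_subset hn (M.subset_space i)
  -- Two elements would have opposite normals, being disjoint, and equal normals, being contained in
  -- `Ω`.
  · by_contra hki
    obtain ⟨m', hm'⟩ := hfl k hk.1
    have h1 := hm.eq_neg_of_disjoint hm' (M.disjoint_space (Ne.symm hki) hi.2 hk.2)
    have h2 := hm.eq_of_subset hn (M.subset_space i)
    have h3 := hm'.eq_of_subset hn (M.subset_space k)
    exact hm.ne_neg (by rw [← h1, h3, h2])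

theorem mem_interior_or_boundary {p : SpaceTime d} {i : ι} (hi : p ∈ M.lateral i)
    (hΩ : IsOpen Ω) : p.2 ∈ Ioo 0 T ∧ (p.1 ∈ Ω ∨ p.1 ∈ frontier Ω) := by
  refine ⟨⟨(M.nonneg i).trans_lt hi.2.1, hi.2.2.trans_le (M.le i)⟩, ?_⟩
  by_cases h : p.1 ∈ Ω
  · exact Or.inl h
  · refine Or.inr ?_
    rw [hΩ.frontier_eq]
    exact ⟨closure_mono (M.subset_space i) (frontier_subset_closure hi.1), h⟩

end PrismaticMesh

theorem sum_indicator_eq_zero {ι X E : Type*} [Fintype ι] [AddCommMonoid E] {s : ι → Set X}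
    {f : ι → X → E} {p : X} (h : ∀ k, p ∉ s k) : ∑ k, (s k).indicator (f k) p = 0 :=
  Finset.sum_eq_zero fun k _ => indicator_of_notMem (h k) _

theorem sum_indicator_eq_single {ι X E : Type*} [Fintype ι] [AddCommMonoid E] {s : ι → Set X}
    {f : ι → X → E} {p : X} {i : ι} (hi : p ∈ s i) (h : ∀ k, p ∈ s k → k = i) :
    ∑ k, (s k).indicator (f k) p = f i p := by
  rw [Finset.sum_eq_single i (fun k _ hk => indicator_of_notMem (fun hm => hk (h k hm)) _)
    (fun hi => absurd (Finset.mem_univ i) hi), indicator_of_mem hi]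

theorem sum_indicator_eq_pair {ι X E : Type*} [Fintype ι] [AddCommMonoid E] {s : ι → Set X}
    {f : ι → X → E} {p : X} {i j : ι} (hij : i ≠ j) (hi : p ∈ s i) (hj : p ∈ s j)
    (h : ∀ k, p ∈ s k → k = i ∨ k = j) :
    ∑ k, (s k).indicator (f k) p = f i p + f j p := by
  rw [Fintype.sum_eq_add i j hij, indicator_of_mem hi, indicator_of_mem hj]
  exact fun k hk => indicator_of_notMem (fun hm => by
    rcases h k hm with h | h
    · exact hk.1 h
    · exact hk.2 h) _

theorem integrable_ofReal_mul {X : Type*} [MeasurableSpace X] {μ : Measure X} {c : X → ℝ}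
    {f : X → ℂ} (hc : MemLp c ⊤ μ) (hf : Integrable f μ) :
    Integrable (fun x => (c x : ℂ) * f x) μ :=
  Integrable.mul_of_top_right hf (hc.ofReal (K := ℂ))

theorem integrable_norm_sq {X : Type*} [MeasurableSpace X] {μ : Measure X} {f : X → ℂ}
    (hf : MemLp f 2 μ) : Integrable (fun x => ‖f x‖ ^ 2) μ :=
  (memLp_two_iff_integrable_sq_norm hf.aestronglyMeasurable).mp hf

theorem integrable_im {X : Type*} [MeasurableSpace X] {μ : Measure X} {f : X → ℂ}
    (hf : Integrable f μ) : Integrable (fun x => (f x).im) μ := hf.im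

theorem im_integral_add {X : Type*} [MeasurableSpace X] {μ : Measure X} {A : X → ℂ}
    {φ f g : X → ℝ} (hA : Integrable A μ) (hφ : Integrable φ μ) (hf : Integrable f μ)
    (hg : Integrable g μ) (h : ∀ᵐ x ∂μ, (A x).im + φ x = f x + g x) :
    (∫ x, A x ∂μ).im + ∫ x, φ x ∂μ = (∫ x, f x ∂μ) + ∫ x, g x ∂μ := by
  have h1 := integral_im (𝕜 := ℂ) hA
  simp only [RCLike.im_to_complex] at h1
  rw [← h1, ← integral_add (integrable_im hA) hφ, ← integral_add hf hg]
  exact integral_congr_ae h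

/-! ### Integrability of the facet quantities and summation over the elements. -/

namespace PrismaticMesh

variable {d : ℕ} {Ω : Set (Space d)} {T : ℝ} {ι : Type*} (M : PrismaticMesh Ω T ι) [Fintype ι]

/-- The outward normal derivative on the lateral boundary of the element `i`. -/
def elemNormalDeriv (w : ι → SpaceTime d → ℂ) (i : ι) (p : SpaceTime d) : ℂ :=
  ∑ j, trace (M.elem i) (M.grad w i j) p * ((outwardNormal (M.Kx i) p.1 j : ℝ) : ℂ)

/-- The imaginary part of `w ∂ₙ w̄`, summed over the adjacent elements. -/
def flux (w : ι → SpaceTime d → ℂ) (p : SpaceTime d) : ℝ :=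
  ∑ i, (M.lateral i).indicator
    (fun q => (trace (M.elem i) (w i) q * conj (M.elemNormalDeriv w i q)).im) p

variable {M} {w : ι → SpaceTime d → ℂ}

theorem jumpGrad_eq (p : SpaceTime d) :
    M.jumpGrad w p = ∑ i, (M.lateral i).indicator (M.elemNormalDeriv w i) p := rfl

section measurability

variable (hd : 0 < d) (hΩ : IsPolytope Ω) (hw : M.MemBroken w)
include hd hΩ hw

theorem memLp_mul_normal (i : ι) {f : SpaceTime d → ℂ}
    (hf : MemLp f 2 (M.lateralMeasure.restrict (M.lateral i))) (j : Fin d) :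
    MemLp (fun q => f q * ((outwardNormal (M.Kx i) q.1 j : ℝ) : ℂ)) 2
      (M.lateralMeasure.restrict (M.lateral i)) := by
  rw [M.lateralMeasure_restrict_lateral hd hΩ] at hf ⊢
  obtain ⟨H, hH⟩ := (M.polytope i).exists_isBoundedBy
  refine hf.of_le (hf.aestronglyMeasurable.mul
    (Complex.continuous_ofReal.comp_aestronglyMeasurable
      ((EuclideanSpace.proj (𝕜 := ℝ) j).continuous.comp_aestronglyMeasurable
        (hH.aestronglyMeasurable_outwardNormal_lateral hd _ _)))) (.of_forall fun p => ?_)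
  rw [norm_mul, Complex.norm_real]
  exact mul_le_of_le_one_right (norm_nonneg _)
    ((PiLp.norm_apply_le _ j).trans (norm_outwardNormal_le _ _))

theorem memLp_elemNormalDeriv (i : ι) :
    MemLp (M.elemNormalDeriv w i) 2 (M.lateralMeasure.restrict (M.lateral i)) :=
  memLp_finsetSum _ fun j _ => memLp_mul_normal hd hΩ hw i
    ((M.tracesWellDefined hd hΩ hw i).2.1 j).2 j

theorem memLp_sum_indicator {f : ι → SpaceTime d → ℂ}
    (hf : ∀ i, MemLp (f i) 2 (M.lateralMeasure.restrict (M.lateral i))) :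
    MemLp (fun p => ∑ i, (M.lateral i).indicator (f i) p) 2 M.lateralMeasure :=
  memLp_finsetSum _ fun i _ =>
    (memLp_indicator_iff_restrict (M.measurableSet_lateral i)).mpr (hf i)

theorem memLp_bdry : MemLp (M.bdry w) 2 M.lateralMeasure :=
  memLp_sum_indicator hd hΩ hw fun i => (M.tracesWellDefined hd hΩ hw i).1.2

theorem memLp_avg : MemLp (M.avg w) 2 M.lateralMeasure :=
  (memLp_bdry hd hΩ hw).const_mul _

theorem memLp_avgGrad (j : Fin d) : MemLp (M.avgGrad w j) 2 M.lateralMeasure :=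
  (memLp_sum_indicator hd hΩ hw fun i => ((M.tracesWellDefined hd hΩ hw i).2.1 j).2).const_mul _

theorem memLp_jump (j : Fin d) : MemLp (M.jump w j) 2 M.lateralMeasure :=
  memLp_sum_indicator hd hΩ hw fun i =>
    memLp_mul_normal hd hΩ hw i (M.tracesWellDefined hd hΩ hw i).1.2 j

theorem memLp_jumpGrad : MemLp (M.jumpGrad w) 2 M.lateralMeasure :=
  memLp_sum_indicator hd hΩ hw fun i => memLp_elemNormalDeriv hd hΩ hw i

theorem integrable_flux : Integrable (M.flux w) M.lateralMeasure := by
  refine integrable_finsetSum _ fun i _ => (integrable_indicator_iff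
    (M.measurableSet_lateral i)).mpr ?_
  exact integrable_im (memLp_two_integrable_mul_conj (M.tracesWellDefined hd hΩ hw i).1.2
    (memLp_elemNormalDeriv hd hΩ hw i))

theorem memLp_before : MemLp (M.before w) 2 M.horizontalMeasure :=
  memLp_finsetSum _ fun i _ => (memLp_indicator_iff_restrict (M.measurableSet_top i)).mpr
    (M.tracesWellDefined hd hΩ hw i).2.2.1.2

theorem memLp_after : MemLp (M.after w) 2 M.horizontalMeasure :=
  memLp_finsetSum _ fun i _ => (memLp_indicator_iff_restrict (M.measurableSet_bottom i)).mpr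
    (M.tracesWellDefined hd hΩ hw i).2.2.2.2

end measurability

/-! ### Horizontal facets -/

/-- At most one term of the sum defining `before` is nonzero, so squaring produces no cross terms.
-/
theorem norm_sq_before (p : SpaceTime d) : ‖M.before w p‖ ^ 2
    = ∑ i, (M.top i).indicator (fun q => ‖trace (M.elem i) (w i) q‖ ^ 2) p := by
  by_cases h : ∃ i, p ∈ M.top i
  · obtain ⟨i, hi⟩ := h
    rw [before, sum_indicator_eq_single hi fun k hk => M.eq_of_mem_top hk hi,
      sum_indicator_eq_single hi fun k hk => M.eq_of_mem_top hk hi]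
  · push Not at h
    rw [before, sum_indicator_eq_zero h, sum_indicator_eq_zero h]; simp

theorem norm_sq_after (p : SpaceTime d) : ‖M.after w p‖ ^ 2
    = ∑ i, (M.bottom i).indicator (fun q => ‖trace (M.elem i) (w i) q‖ ^ 2) p := by
  by_cases h : ∃ i, p ∈ M.bottom i
  · obtain ⟨i, hi⟩ := h
    rw [after, sum_indicator_eq_single hi fun k hk => M.eq_of_mem_bottom hk hi,
      sum_indicator_eq_single hi fun k hk => M.eq_of_mem_bottom hk hi]
  · push Not at h
    rw [after, sum_indicator_eq_zero h, sum_indicator_eq_zero h]; simp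

theorem integral_eq_add_of_ae {X : Type*} [MeasurableSpace X] {μ : Measure X} {f : X → ℝ}
    (hf : Integrable f μ) {s t : Set X} (ht : MeasurableSet t) (hst : Disjoint s t)
    (h : ∀ᵐ x ∂μ, x ∉ s ∪ t → f x = 0) :
    ∫ x, f x ∂μ = (∫ x in s, f x ∂μ) + ∫ x in t, f x ∂μ := by
  rw [← setIntegral_union hst ht hf.integrableOn hf.integrableOn,
    setIntegral_eq_integral_of_ae_compl_eq_zero h]

/-- Away from the vertical lines over element boundaries, a null set, a top face below `T` is met
from above by the bottom face of another element, so it belongs to the internal skeleton. -/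
theorem integral_norm_sq_before (hd : 0 < d) (hΩ : IsPolytope Ω) (hw : M.MemBroken w) :
    ∫ p, ‖M.before w p‖ ^ 2 ∂M.horizontalMeasure
      = (∫ p in M.Fspace, ‖M.before w p‖ ^ 2 ∂M.horizontalMeasure)
        + ∫ p in Ω ×ˢ {T}, ‖M.before w p‖ ^ 2 ∂M.horizontalMeasure := by
  refine integral_eq_add_of_ae (integrable_norm_sq (memLp_before hd hΩ hw))
    (hΩ.2.1.measurableSet.prod (measurableSet_singleton T))
    (disjoint_left.mpr fun p hp hp' => (hp.1.2.2.ne hp'.2)) ?_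
  filter_upwards [M.ae_notMem_frontier hd] with p hp hpn
  have : ∀ i, p ∉ M.top i := fun i hi => by
    by_cases hT : p.2 = T
    · exact hpn (Or.inr ⟨M.subset_space i hi.1, hT⟩)
    · exact hpn (Or.inl (M.mem_Fspace_of_mem_top hp hi hT))
  rw [before, sum_indicator_eq_zero this]; simp

theorem integral_norm_sq_after (hd : 0 < d) (hΩ : IsPolytope Ω) (hw : M.MemBroken w) :
    ∫ p, ‖M.after w p‖ ^ 2 ∂M.horizontalMeasure
      = (∫ p in M.Fspace, ‖M.after w p‖ ^ 2 ∂M.horizontalMeasure)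
        + ∫ p in Ω ×ˢ {0}, ‖M.after w p‖ ^ 2 ∂M.horizontalMeasure := by
  refine integral_eq_add_of_ae (integrable_norm_sq (memLp_after hd hΩ hw))
    (hΩ.2.1.measurableSet.prod (measurableSet_singleton 0))
    (disjoint_left.mpr fun p hp hp' => (hp.1.2.1.ne' hp'.2)) ?_
  filter_upwards [M.ae_notMem_frontier hd] with p hp hpn
  have : ∀ i, p ∉ M.bottom i := fun i hi => by
    by_cases h0 : p.2 = 0
    · exact hpn (Or.inr ⟨M.subset_space i hi.1, h0⟩)
    · exact hpn (Or.inl (M.mem_Fspace_of_mem_bottom hp hi h0))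
  rw [after, sum_indicator_eq_zero this]; simp

/-- The contribution of the internal space-like facets. -/
theorem re_setIntegral_Fspace (hd : 0 < d) (hΩ : IsPolytope Ω) (hw : M.MemBroken w) :
    (∫ p in M.Fspace, M.before w p * conj (M.jumpTime w p) ∂M.horizontalMeasure).re
      = (1 / 2) * (∫ p in M.Fspace, ‖M.jumpTime w p‖ ^ 2 ∂M.horizontalMeasure)
        + (1 / 2) * (∫ p in M.Fspace, ‖M.before w p‖ ^ 2 ∂M.horizontalMeasure)
        - (1 / 2) * ∫ p in M.Fspace, ‖M.after w p‖ ^ 2 ∂M.horizontalMeasure := by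
  have hb := (memLp_before hd hΩ hw).restrict M.Fspace
  have ha := (memLp_after hd hΩ hw).restrict M.Fspace
  have hj : MemLp (M.jumpTime w) 2 (M.horizontalMeasure.restrict M.Fspace) := hb.sub ha
  have h1 := integral_re (𝕜 := ℂ) (memLp_two_integrable_mul_conj hb hj)
  simp only [RCLike.re_to_complex] at h1
  have i1 := (integrable_norm_sq hj).const_mul (1 / 2)
  have i2 := (integrable_norm_sq hb).const_mul (1 / 2)
  have i3 := (integrable_norm_sq ha).const_mul (1 / 2)
  have i12 : IntegrableOn (fun p => 1 / 2 * ‖M.jumpTime w p‖ ^ 2 + 1 / 2 * ‖M.before w p‖ ^ 2)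
      M.Fspace M.horizontalMeasure := i1.add i2
  rw [← h1, ← integral_const_mul, ← integral_const_mul, ← integral_const_mul,
    ← integral_add i1 i2, ← integral_sub i12 i3]
  refine integral_congr_ae (.of_forall fun p => ?_)
  simp only [jumpTime, Complex.sq_norm, Complex.normSq_apply, Complex.mul_re, Complex.conj_re,
    Complex.conj_im, Complex.sub_re, Complex.sub_im]
  ring

/-! ### The energy identity -/

theorem sum_integral_indicator {μ : Measure (SpaceTime d)} {s : ι → Set (SpaceTime d)}
    (hs : ∀ i, MeasurableSet (s i)) {f : ι → SpaceTime d → ℝ}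
    (hf : ∀ i, IntegrableOn (f i) (s i) μ) :
    ∑ i, ∫ p in s i, f i p ∂μ = ∫ p, ∑ i, (s i).indicator (f i) p ∂μ := by
  rw [integral_finsetSum _ fun i _ => (integrable_indicator_iff (hs i)).mpr (hf i)]
  exact Finset.sum_congr rfl fun i _ => (integral_indicator (hs i)).symm

/-- The local identities are summed, and the sums over elements are rewritten as integrals over the
whole skeleton, to be split by type of facet afterwards. -/
theorem im_sum_setIntegral_schr (hd : 0 < d) (hΩ : IsPolytope Ω) (hw : M.MemBroken w)
    {V : SpaceTime d → ℝ}
    (hV : ∀ i, MemLp (fun p => (V p : ℂ) * w i p) 2 (volume.restrict (M.elem i))) :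
    (∑ i, ∫ p in M.elem i, w i p * conj (M.schr V w i p)).im
      = -(1 / 2) * ((∫ p, ‖M.before w p‖ ^ 2 ∂M.horizontalMeasure)
          - ∫ p, ‖M.after w p‖ ^ 2 ∂M.horizontalMeasure)
        + (1 / 2) * ∫ p, M.flux w p ∂M.lateralMeasure := by
  have hi : ∀ i, (∫ p in M.elem i, w i p * conj (M.schr V w i p)).im
      = -(1 / 2) * ((∫ p in M.top i, ‖trace (M.elem i) (w i) p‖ ^ 2 ∂M.horizontalMeasure)
          - ∫ p in M.bottom i, ‖trace (M.elem i) (w i) p‖ ^ 2 ∂M.horizontalMeasure)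
        + (1 / 2) * ∫ p in M.lateral i,
          (trace (M.elem i) (w i) p * conj (M.elemNormalDeriv w i p)).im ∂M.lateralMeasure := by
    intro i
    obtain ⟨H, hH⟩ := (M.polytope i).exists_isBoundedBy
    rw [M.setIntegral_top, M.setIntegral_bottom, M.lateralMeasure_restrict_lateral hd hΩ]
    have hwi : MemLocalSpace (M.Kx i ×ˢ Ioo (M.a i) (M.b i)) (w i) := hw i
    exact hwi.im_setIntegral_mul_conj_schrodinger hH hd (M.lt i) (hV i)
  have htr := M.tracesWellDefined hd hΩ hw
  have e1 : ∑ i, ∫ p in M.top i, ‖trace (M.elem i) (w i) p‖ ^ 2 ∂M.horizontalMeasure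
      = ∫ p, ‖M.before w p‖ ^ 2 ∂M.horizontalMeasure := by
    rw [sum_integral_indicator M.measurableSet_top fun i => integrable_norm_sq (htr i).2.2.1.2]
    simp only [norm_sq_before]
  have e2 : ∑ i, ∫ p in M.bottom i, ‖trace (M.elem i) (w i) p‖ ^ 2 ∂M.horizontalMeasure
      = ∫ p, ‖M.after w p‖ ^ 2 ∂M.horizontalMeasure := by
    rw [sum_integral_indicator M.measurableSet_bottom fun i => integrable_norm_sq (htr i).2.2.2.2]
    simp only [norm_sq_after]
  have e3 : ∑ i, ∫ p in M.lateral i,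
      (trace (M.elem i) (w i) p * conj (M.elemNormalDeriv w i p)).im ∂M.lateralMeasure
      = ∫ p, M.flux w p ∂M.lateralMeasure :=
    sum_integral_indicator M.measurableSet_lateral fun i => integrable_im
      (memLp_two_integrable_mul_conj (htr i).1.2 (memLp_elemNormalDeriv hd hΩ hw i))
  rw [Complex.im_sum, Finset.sum_congr rfl fun i _ => hi i, Finset.sum_add_distrib,
    ← Finset.mul_sum, ← Finset.mul_sum, Finset.sum_sub_distrib, e1, e2, e3]

/-! ### Lateral facets -/

/-- With one normal `n`, and `D1`, `D2` the two derivatives along it, the bracket is `½ (D1 + D2)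
conj (w1 - w2) - ½ (w1 + w2) conj (D1 - D2)`. The products mixing both sides combine into real
parts, and the others give minus the flux; the second element contributes to the flux with normal
`-n`. -/
theorem ae_Ftime_identity (hd : 0 < d) (hΩ : IsPolytope Ω) :
    ∀ᵐ p ∂M.lateralMeasure, p ∈ M.Ftime →
      ((∑ j, M.avgGrad w j p * conj (M.jump w j p)) - M.avg w p * conj (M.jumpGrad w p)).im
        + M.flux w p = 0 := by
  filter_upwards [M.ae_interior hd hΩ] with p hp ⟨hpΩ, i, _, _, hi, _⟩
  obtain ⟨j, hij, hj, hn, hk⟩ := hp hpΩ.1 i hi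
  simp only [avgGrad, jump, avg, jumpGrad_eq, flux, sum_indicator_eq_pair hij hi hj hk]
  set n := outwardNormal (M.Kx i) p.1 with hndef
  set w1 := trace (M.elem i) (w i) p
  set w2 := trace (M.elem j) (w j) p
  have hD2 : M.elemNormalDeriv w j p
      = -∑ l, trace (M.elem j) (M.grad w j l) p * ((n l : ℝ) : ℂ) := by
    rw [elemNormalDeriv, hn, ← Finset.sum_neg_distrib]
    refine Finset.sum_congr rfl fun l _ => ?_
    rw [PiLp.neg_apply, Complex.ofReal_neg, mul_neg]
  have hD1 : M.elemNormalDeriv w i p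
      = ∑ l, trace (M.elem i) (M.grad w i l) p * ((n l : ℝ) : ℂ) := rfl
  set D2 := ∑ l, trace (M.elem j) (M.grad w j l) p * ((n l : ℝ) : ℂ)
  set D1 := ∑ l, trace (M.elem i) (M.grad w i l) p * ((n l : ℝ) : ℂ)
  have hS : ∑ l, 1 / 2 * (trace (M.elem i) (M.grad w i l) p + trace (M.elem j) (M.grad w j l) p) *
      conj (w1 * ((n l : ℝ) : ℂ) + w2 * ((outwardNormal (M.Kx j) p.1 l : ℝ) : ℂ))
      = 1 / 2 * (D1 + D2) * conj (w1 - w2) := by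
    rw [← Finset.sum_add_distrib, Finset.mul_sum, Finset.sum_mul]
    refine Finset.sum_congr rfl fun l _ => ?_
    rw [hn, PiLp.neg_apply]
    simp only [map_add, map_sub, map_mul, map_neg, Complex.conj_ofReal, Complex.ofReal_neg]
    ring
  rw [hS, hD1, hD2]
  simp only [Complex.sub_im, Complex.mul_im, Complex.mul_re, Complex.add_im, Complex.add_re,
    Complex.conj_re, Complex.conj_im, Complex.sub_re, Complex.neg_re, Complex.neg_im, map_add,
    map_neg, map_sub]
  have h2 : (1 / 2 : ℂ).re = 1 / 2 := by norm_num
  have h2' : (1 / 2 : ℂ).im = 0 := by norm_num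
  rw [h2, h2']
  ring

/-- The only element present has the normal of `Ω`, so the normal derivative coincides with
`jumpGrad`, whose integrability is known. Points without any adjacent element are harmless, since
all the quantities vanish there. -/
theorem ae_boundary_identity (hd : 0 < d) (hΩ : IsPolytope Ω) :
    ∀ᵐ p ∂M.lateralMeasure, p.1 ∈ frontier Ω →
      M.normalDeriv w p = M.jumpGrad w p ∧
      M.flux w p = (M.bdry w p * conj (M.normalDeriv w p)).im := by
  filter_upwards [M.ae_boundary hd hΩ] with p hp hpF
  by_cases h : ∃ i, p ∈ M.lateral i
  · obtain ⟨i, hi⟩ := h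
    obtain ⟨hn, hk⟩ := hp hpF i hi
    have e : M.normalDeriv w p = M.elemNormalDeriv w i p := by
      rw [normalDeriv, sum_indicator_eq_single hi hk, elemNormalDeriv, hn]
    rw [e, flux, bdry, jumpGrad_eq, sum_indicator_eq_single hi hk, sum_indicator_eq_single hi hk,
      sum_indicator_eq_single hi hk]
    exact ⟨rfl, rfl⟩
  · push Not at h
    rw [normalDeriv, flux, bdry, jumpGrad_eq, sum_indicator_eq_zero h, sum_indicator_eq_zero h,
      sum_indicator_eq_zero h, sum_indicator_eq_zero h]
    simp

/-- The lateral flux is distributed over the internal facets and the three boundary parts. -/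
theorem integral_flux (hd : 0 < d) (hΩ : IsPolytope Ω) (hw : M.MemBroken w)
    (B : BoundaryPartition Ω) :
    ∫ p, M.flux w p ∂M.lateralMeasure
      = (∫ p in M.Ftime, M.flux w p ∂M.lateralMeasure)
        + (∫ p in B.D ×ˢ Ioo 0 T, M.flux w p ∂M.lateralMeasure)
        + (∫ p in B.N ×ˢ Ioo 0 T, M.flux w p ∂M.lateralMeasure)
        + ∫ p in B.R ×ˢ Ioo 0 T, M.flux w p ∂M.lateralMeasure := by
  classical
  have := M.isFiniteMeasure_skeleton hd hΩ
  have mF := M.measurableSet_Ftime hΩ.2.1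
  have mD : MeasurableSet (B.D ×ˢ Ioo 0 T) := B.measurable_D.prod measurableSet_Ioo
  have mN : MeasurableSet (B.N ×ˢ Ioo 0 T) := B.measurable_N.prod measurableSet_Ioo
  have mR : MeasurableSet (B.R ×ˢ Ioo 0 T) := B.measurable_R.prod measurableSet_Ioo
  have hf := integrable_flux hd hΩ hw
  have i2 : Integrable (fun p => M.Ftime.indicator (M.flux w) p
      + (B.D ×ˢ Ioo 0 T).indicator (M.flux w) p) M.lateralMeasure :=
    (hf.indicator mF).add (hf.indicator mD)
  have i3 : Integrable (fun p => M.Ftime.indicator (M.flux w) p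
      + (B.D ×ˢ Ioo 0 T).indicator (M.flux w) p + (B.N ×ˢ Ioo 0 T).indicator (M.flux w) p)
      M.lateralMeasure := i2.add (hf.indicator mN)
  rw [← integral_indicator mF, ← integral_indicator mD, ← integral_indicator mN,
    ← integral_indicator mR, ← integral_add (hf.indicator mF) (hf.indicator mD),
    ← integral_add i2 (hf.indicator mN), ← integral_add i3 (hf.indicator mR)]
  have hq : Measure.QuasiMeasurePreserving Prod.fst M.lateralMeasure
    ((μHE[d - 1] : Measure (Space d)).restrict M.skeleton) := Measure.quasiMeasurePreserving_fst
  have hnull : ∀ {S : Set (Space d)}, μHE[d - 1] S = 0 → ∀ᵐ p ∂M.lateralMeasure, p.1 ∉ S :=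
    fun {S} hS => hq.ae (p := fun x => x ∉ S)
      (ae_restrict_of_ae (by rw [ae_iff]; simpa using hS))
  refine integral_congr_ae ?_
  -- The flux lives on the lateral boundaries of the elements. Almost every such point is either
  -- internal, hence shared by two elements and in `Ftime`, or on `∂Ω`, hence in exactly one of the
  -- three parts.
  filter_upwards [M.ae_interior hd hΩ, hnull B.null_DN, hnull B.null_DR, hnull B.null_NR,
    hnull B.cover] with p hp h1 h2 h3 h4
  by_cases h : ∃ i, p ∈ M.lateral i
  · obtain ⟨i, hi⟩ := h
    obtain ⟨hT, hΩ' | hF⟩ := M.mem_interior_or_boundary hi hΩ.2.1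
    · obtain ⟨j, hij, hj, -⟩ := hp hΩ' i hi
      have hnF : p.1 ∉ frontier Ω := fun hF => by
        rw [hΩ.2.1.frontier_eq] at hF; exact hF.2 hΩ'
      rw [indicator_of_mem (show p ∈ M.Ftime from ⟨⟨hΩ', hT⟩, i, j, hij, hi, hj⟩),
        indicator_of_notMem (fun hm => hnF (B.subset_D hm.1)),
        indicator_of_notMem (fun hm => hnF (B.subset_N hm.1)),
        indicator_of_notMem (fun hm => hnF (B.subset_R hm.1))]
      simp
    · have hnΩ : p ∉ M.Ftime := fun hm => by
        rw [hΩ.2.1.frontier_eq] at hF; exact hF.2 hm.1.1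
      rw [indicator_of_notMem hnΩ]
      simp only [indicator, mem_prod, hT, and_true]
      by_cases hD : p.1 ∈ B.D
      · have hN : p.1 ∉ B.N := fun hN => h1 ⟨hD, hN⟩
        have hR : p.1 ∉ B.R := fun hR => h2 ⟨hD, hR⟩
        simp [hD, hN, hR]
      · by_cases hN : p.1 ∈ B.N
        · have hR : p.1 ∉ B.R := fun hR => h3 ⟨hN, hR⟩
          simp [hD, hN, hR]
        · have hR : p.1 ∈ B.R := by
            by_contra hR
            exact h4 ⟨hF, fun hm => hm.elim (fun hm => hm.elim hD hN) hR⟩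
          simp [hD, hN, hR]
  · push Not at h
    have e : M.flux w p = 0 := by rw [flux, sum_indicator_eq_zero h]
    simp [indicator, e]

end PrismaticMesh

theorem integrable_mul_norm_sq {X : Type*} [MeasurableSpace X] {μ : Measure X} {c : X → ℝ}
    {f : X → ℂ} (hc : MemLp c ⊤ μ) (hf : MemLp f 2 μ) :
    Integrable (fun x => c x * ‖f x‖ ^ 2) μ :=
  (integrable_norm_sq hf).mul_of_top_right hc

/-! ### Cancellation of the flux on each type of vertical facet, and conclusion. -/

namespace PrismaticMesh

variable {d : ℕ} {Ω : Set (Space d)} {T : ℝ} {ι : Type*} {M : PrismaticMesh Ω T ι} [Fintype ι]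
  {w : ι → SpaceTime d → ℂ} {B : BoundaryPartition Ω} {c : Coefficients d}

theorem memLp_normalDeriv (hd : 0 < d) (hΩ : IsPolytope Ω) (hw : M.MemBroken w) {S : Set (Space d)}
    (hS : MeasurableSet S) (hSF : S ⊆ frontier Ω) :
    MemLp (M.normalDeriv w) 2 (M.lateralMeasure.restrict (S ×ˢ Ioo 0 T)) := by
  refine ((memLp_jumpGrad hd hΩ hw).restrict _).ae_eq ?_
  rw [EventuallyEq, ae_restrict_iff' (hS.prod measurableSet_Ioo)]
  filter_upwards [M.ae_boundary_identity (w := w) hd hΩ] with p hp hpS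
  exact (hp (hSF hpS.1)).1.symm

theorem im_setIntegral_Ftime (hd : 0 < d) (hΩ : IsPolytope Ω) (hc : M.Admissible B c)
    (hw : M.MemBroken w) :
    (∫ p in M.Ftime, ((∑ j, M.avgGrad w j p * conj (M.jump w j p))
        + Complex.I * (c.α p : ℂ) * (∑ j, M.jump w j p * conj (M.jump w j p))
        - M.avg w p * conj (M.jumpGrad w p)
        + Complex.I * (c.β p : ℂ) * (M.jumpGrad w p * conj (M.jumpGrad w p))) ∂M.lateralMeasure).im
      + ∫ p in M.Ftime, M.flux w p ∂M.lateralMeasure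
    = (∫ p in M.Ftime, c.α p * ∑ j, ‖M.jump w j p‖ ^ 2 ∂M.lateralMeasure)
        + ∫ p in M.Ftime, c.β p * ‖M.jumpGrad w p‖ ^ 2 ∂M.lateralMeasure := by
  have hα : MemLp c.α ⊤ (M.lateralMeasure.restrict M.Ftime) :=
    hc.α_bdd.mono_measure (Measure.restrict_mono_set _ subset_union_left)
  have hβ : MemLp c.β ⊤ (M.lateralMeasure.restrict M.Ftime) :=
    hc.β_bdd.mono_measure (Measure.restrict_mono_set _ subset_union_left)
  have hj := fun j => (memLp_jump hd hΩ hw j).restrict M.Ftime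
  have hg := (memLp_jumpGrad hd hΩ hw).restrict M.Ftime
  have i1 := integrable_finsetSum Finset.univ fun j _ =>
    memLp_two_integrable_mul_conj ((memLp_avgGrad hd hΩ hw j).restrict M.Ftime) (hj j)
  have i2 := (integrable_ofReal_mul hα (integrable_finsetSum Finset.univ fun j _ =>
    memLp_two_integrable_mul_conj (hj j) (hj j))).const_mul Complex.I
  have i3 := memLp_two_integrable_mul_conj ((memLp_avg hd hΩ hw).restrict M.Ftime) hg
  have i4 := (integrable_ofReal_mul hβ (memLp_two_integrable_mul_conj hg hg)).const_mul Complex.I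
  refine im_integral_add ?_ (integrable_flux hd hΩ hw).restrict ?_ (integrable_mul_norm_sq hβ hg) ?_
  · simp only [← mul_assoc] at i2 i4 ⊢
    exact ((i1.add i2).sub i3).add i4
  · exact (integrable_finsetSum Finset.univ fun j _ => integrable_norm_sq (hj j)).mul_of_top_right hα
  · rw [ae_restrict_iff' (M.measurableSet_Ftime hΩ.2.1)]
    filter_upwards [M.ae_Ftime_identity (w := w) hd hΩ] with p hp hpF
    have h := hp hpF
    have e : ∑ j, M.jump w j p * conj (M.jump w j p) = ((∑ j, ‖M.jump w j p‖ ^ 2 : ℝ) : ℂ) := by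
      rw [Complex.ofReal_sum]
      exact Finset.sum_congr rfl fun j _ => by rw [Complex.mul_conj', Complex.ofReal_pow]
    rw [e, Complex.mul_conj' (M.jumpGrad w p), ← Complex.ofReal_pow, mul_assoc, mul_assoc,
      ← Complex.ofReal_mul, ← Complex.ofReal_mul]
    simp only [Complex.add_im, Complex.sub_im, Complex.I_mul_im, Complex.ofReal_re] at h ⊢
    linarith

theorem im_setIntegral_D (hd : 0 < d) (hΩ : IsPolytope Ω) (hc : M.Admissible B c)
    (hw : M.MemBroken w) :
    (∫ p in B.D ×ˢ Ioo 0 T,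
      (M.normalDeriv w p + Complex.I * (c.α p : ℂ) * M.bdry w p) * conj (M.bdry w p)
        ∂M.lateralMeasure).im + ∫ p in B.D ×ˢ Ioo 0 T, M.flux w p ∂M.lateralMeasure
    = ∫ p in B.D ×ˢ Ioo 0 T, c.α p * ‖M.bdry w p‖ ^ 2 ∂M.lateralMeasure := by
  have hα : MemLp c.α ⊤ (M.lateralMeasure.restrict (B.D ×ˢ Ioo 0 T)) :=
    hc.α_bdd.mono_measure (Measure.restrict_mono_set _ subset_union_right)
  have hb := (memLp_bdry hd hΩ hw).restrict (B.D ×ˢ Ioo 0 T)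
  have hn := memLp_normalDeriv hd hΩ hw B.measurable_D B.subset_D
  have i1 := memLp_two_integrable_mul_conj hn hb
  have i2 := (integrable_ofReal_mul hα (memLp_two_integrable_mul_conj hb hb)).const_mul Complex.I
  rw [im_integral_add (g := fun _ => 0) ?_ (integrable_flux hd hΩ hw).restrict
    (integrable_mul_norm_sq hα hb) (integrable_zero _ _ _) ?_, integral_zero, add_zero]
  · refine (i1.add i2).congr (.of_forall fun p => ?_)
    simp only [Pi.add_apply]; ring
  · rw [ae_restrict_iff' (B.measurable_D.prod measurableSet_Ioo)]
    filter_upwards [M.ae_boundary_identity (w := w) hd hΩ] with p hp hpS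
    rw [(hp (B.subset_D hpS.1)).2]
    simp only [Complex.sq_norm, Complex.normSq_apply, Complex.mul_im, Complex.mul_re,
      Complex.add_im, Complex.add_re, Complex.conj_re, Complex.conj_im, Complex.I_re, Complex.I_im,
      Complex.ofReal_re, Complex.ofReal_im]
    ring

theorem im_setIntegral_N (hd : 0 < d) (hΩ : IsPolytope Ω) (hc : M.Admissible B c)
    (hw : M.MemBroken w) :
    (∫ p in B.N ×ˢ Ioo 0 T,
      (-(M.bdry w p * conj (M.normalDeriv w p))
        + Complex.I * (c.β p : ℂ) * M.normalDeriv w p * conj (M.normalDeriv w p))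
        ∂M.lateralMeasure).im + ∫ p in B.N ×ˢ Ioo 0 T, M.flux w p ∂M.lateralMeasure
    = ∫ p in B.N ×ˢ Ioo 0 T, c.β p * ‖M.normalDeriv w p‖ ^ 2 ∂M.lateralMeasure := by
  have hβ : MemLp c.β ⊤ (M.lateralMeasure.restrict (B.N ×ˢ Ioo 0 T)) :=
    hc.β_bdd.mono_measure (Measure.restrict_mono_set _ subset_union_right)
  have hb := (memLp_bdry hd hΩ hw).restrict (B.N ×ˢ Ioo 0 T)
  have hn := memLp_normalDeriv hd hΩ hw B.measurable_N B.subset_N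
  have i1 := memLp_two_integrable_mul_conj hb hn
  have i2 := (integrable_ofReal_mul hβ (memLp_two_integrable_mul_conj hn hn)).const_mul Complex.I
  rw [im_integral_add (g := fun _ => 0) ?_ (integrable_flux hd hΩ hw).restrict
    (integrable_mul_norm_sq hβ hn) (integrable_zero _ _ _) ?_, integral_zero, add_zero]
  · refine (i1.neg.add i2).congr (.of_forall fun p => ?_)
    simp only [Pi.add_apply, Pi.neg_apply]; ring
  · rw [ae_restrict_iff' (B.measurable_N.prod measurableSet_Ioo)]
    filter_upwards [M.ae_boundary_identity (w := w) hd hΩ] with p hp hpS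
    rw [(hp (B.subset_N hpS.1)).2]
    simp only [Complex.sq_norm, Complex.normSq_apply, Complex.mul_im, Complex.mul_re,
      Complex.add_im, Complex.neg_im, Complex.conj_re, Complex.conj_im, Complex.I_re, Complex.I_im,
      Complex.ofReal_re, Complex.ofReal_im]
    ring

/-- With `D` the normal derivative and `b` the trace, the product expands to `δ D conj b - (1 - δ) b
conj D + i θ (1 - δ) |b|² + i (δ / θ) |D|²`. The first two terms together have imaginary part `-Im
(b conj D)` whatever `δ` is, which cancels the flux. The bound on `δ / θ` makes the last term
integrable. -/
theorem im_setIntegral_R (hd : 0 < d) (hΩ : IsPolytope Ω) (hc : M.Admissible B c)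
    (hw : M.MemBroken w) :
    (∫ p in B.R ×ˢ Ioo 0 T,
      ((c.δ p : ℂ) * M.normalDeriv w p
          + (1 - (c.δ p : ℂ)) * Complex.I * (c.θ p : ℂ) * M.bdry w p)
        * (conj (M.bdry w p) + Complex.I / (c.θ p : ℂ) * conj (M.normalDeriv w p))
        ∂M.lateralMeasure).im + ∫ p in B.R ×ˢ Ioo 0 T, M.flux w p ∂M.lateralMeasure
    = (∫ p in B.R ×ˢ Ioo 0 T, c.θ p * (1 - c.δ p) * ‖M.bdry w p‖ ^ 2 ∂M.lateralMeasure)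
      + ∫ p in B.R ×ˢ Ioo 0 T, c.δ p / c.θ p * ‖M.normalDeriv w p‖ ^ 2 ∂M.lateralMeasure := by
  have hb := (memLp_bdry hd hΩ hw).restrict (B.R ×ˢ Ioo 0 T)
  have hn := memLp_normalDeriv hd hΩ hw B.measurable_R B.subset_R
  have h1δ : MemLp (fun p => 1 - c.δ p) ⊤ (M.lateralMeasure.restrict (B.R ×ˢ Ioo 0 T)) :=
    (memLp_top_const (1 : ℝ)).sub hc.δ_bdd
  obtain ⟨C, hC⟩ := hc.δ_le
  have hq : MemLp (fun p => c.δ p / c.θ p) ⊤ (M.lateralMeasure.restrict (B.R ×ˢ Ioo 0 T)) := by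
    refine memLp_top_of_bound (hc.δ_bdd.aestronglyMeasurable.aemeasurable.div
      hc.θ_bdd.aestronglyMeasurable.aemeasurable).aestronglyMeasurable C ?_
    filter_upwards [hC, hc.θ_pos, hc.δ_mem] with p h1 h2 h3
    rw [Real.norm_of_nonneg (div_pos h3.1 h2).le]
    exact (div_le_iff₀ h2).mpr h1
  have ibb := memLp_two_integrable_mul_conj hb hb
  have i1 := integrable_ofReal_mul hc.δ_bdd (memLp_two_integrable_mul_conj hn hb)
  have i2 := (integrable_ofReal_mul hc.θ_bdd (integrable_ofReal_mul h1δ ibb)).const_mul Complex.I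
  have i3 := (integrable_ofReal_mul hq (memLp_two_integrable_mul_conj hn hn)).const_mul Complex.I
  have i4 := integrable_ofReal_mul h1δ (memLp_two_integrable_mul_conj hb hn)
  refine im_integral_add ?_ (integrable_flux hd hΩ hw).restrict ?_ (integrable_mul_norm_sq hq hn) ?_
  · refine (((i1.add i2).add i3).sub i4).congr ?_
    filter_upwards [hc.θ_pos] with p hp
    have hθ : (c.θ p : ℂ) ≠ 0 := Complex.ofReal_ne_zero.mpr hp.ne'
    simp only [Pi.add_apply, Pi.sub_apply, Complex.ofReal_div, Complex.ofReal_sub,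
      Complex.ofReal_one]
    field_simp
    ring_nf
    rw [Complex.I_sq]
    ring
  · have := (integrable_mul_norm_sq h1δ hb).mul_of_top_right hc.θ_bdd
    refine this.congr (.of_forall fun p => ?_)
    simp only [Pi.mul_apply]; ring
  · have hmR : MeasurableSet (B.R ×ˢ Ioo 0 T) := B.measurable_R.prod measurableSet_Ioo
    filter_upwards [hc.θ_pos, ae_restrict_mem hmR,
      ae_restrict_of_ae (M.ae_boundary_identity (w := w) hd hΩ)] with p hθ hpS hp
    rw [(hp (B.subset_R hpS.1)).2]
    have e : Complex.I / (c.θ p : ℂ) = ((c.θ p)⁻¹ : ℝ) * Complex.I := by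
      rw [Complex.ofReal_inv]; ring
    have e1 : (1 - (c.δ p : ℂ)) = ((1 - c.δ p : ℝ) : ℂ) := by push_cast; rfl
    rw [e, e1]
    simp only [Complex.sq_norm, Complex.normSq_apply, Complex.mul_im, Complex.mul_re,
      Complex.add_im, Complex.add_re, Complex.conj_re, Complex.conj_im, Complex.I_re, Complex.I_im,
      Complex.ofReal_re, Complex.ofReal_im]
    field_simp
    ring

/-- The square root has to be undone, so each of the integrals is checked to be nonnegative, using
the signs of the coefficients. -/
theorem dgNorm_sq (hc : M.Admissible B c) :
    M.dgNorm B c w ^ 2 =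
    (∑ i, ∫ p in M.elem i, c.μ p * ‖M.schr c.V w i p‖ ^ 2)
    + (1 / 2) *
      ((∫ p in M.Fspace, ‖M.jumpTime w p‖ ^ 2 ∂M.horizontalMeasure)
        + (∫ p in Ω ×ˢ {T}, ‖M.before w p‖ ^ 2 ∂M.horizontalMeasure)
        + ∫ p in Ω ×ˢ {0}, ‖M.after w p‖ ^ 2 ∂M.horizontalMeasure)
    + (1 / 2) *
      ((∫ p in M.Ftime, c.α p * ∑ j, ‖M.jump w j p‖ ^ 2 ∂M.lateralMeasure)
        + (∫ p in M.Ftime, c.β p * ‖M.jumpGrad w p‖ ^ 2 ∂M.lateralMeasure)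
        + (∫ p in B.D ×ˢ Ioo 0 T, c.α p * ‖M.bdry w p‖ ^ 2 ∂M.lateralMeasure)
        + (∫ p in B.N ×ˢ Ioo 0 T, c.β p * ‖M.normalDeriv w p‖ ^ 2 ∂M.lateralMeasure)
        + (∫ p in B.R ×ˢ Ioo 0 T, c.θ p * (1 - c.δ p) * ‖M.bdry w p‖ ^ 2 ∂M.lateralMeasure)
        + ∫ p in B.R ×ˢ Ioo 0 T, c.δ p / c.θ p * ‖M.normalDeriv w p‖ ^ 2 ∂M.lateralMeasure) := by
  obtain ⟨mα, hmα, hα⟩ := hc.α_pos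
  obtain ⟨mβ, hmβ, hβ⟩ := hc.β_pos
  obtain ⟨mμ, hmμ, hμ⟩ := hc.μ_pos
  refine Real.sq_sqrt ?_
  have hmono : ∀ {X : Type _} [MeasurableSpace X] {μ : Measure X} {s t : Set X} {P : X → Prop},
      s ⊆ t → (∀ᵐ x ∂μ.restrict t, P x) → ∀ᵐ x ∂μ.restrict s, P x :=
    fun hst h => ae_restrict_of_ae_restrict_of_subset hst h
  have h0 : 0 ≤ ∑ i, ∫ p in M.elem i, c.μ p * ‖M.schr c.V w i p‖ ^ 2 := by
    refine Finset.sum_nonneg fun i _ => integral_nonneg_of_ae ?_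
    have hsub : M.elem i ⊆ Ω ×ˢ Ioo 0 T := prod_mono (M.subset_space i)
      (Ioo_subset_Ioo (M.nonneg i) (M.le i))
    filter_upwards [hmono hsub hμ] with p hp
    have := hmμ.le.trans hp
    simp only [Pi.zero_apply]; positivity
  have h1 : 0 ≤ ∫ p in M.Fspace, ‖M.jumpTime w p‖ ^ 2 ∂M.horizontalMeasure :=
    integral_nonneg fun p => by positivity
  have h2 : 0 ≤ ∫ p in Ω ×ˢ {T}, ‖M.before w p‖ ^ 2 ∂M.horizontalMeasure :=
    integral_nonneg fun p => by positivity
  have h3 : 0 ≤ ∫ p in Ω ×ˢ {0}, ‖M.after w p‖ ^ 2 ∂M.horizontalMeasure :=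
    integral_nonneg fun p => by positivity
  have h4 : 0 ≤ ∫ p in M.Ftime, c.α p * ∑ j, ‖M.jump w j p‖ ^ 2 ∂M.lateralMeasure := by
    refine integral_nonneg_of_ae ?_
    filter_upwards [hmono subset_union_left hα] with p hp
    have := hmα.le.trans hp
    simp only [Pi.zero_apply]; positivity
  have h5 : 0 ≤ ∫ p in M.Ftime, c.β p * ‖M.jumpGrad w p‖ ^ 2 ∂M.lateralMeasure := by
    refine integral_nonneg_of_ae ?_
    filter_upwards [hmono subset_union_left hβ] with p hp
    have := hmβ.le.trans hp
    simp only [Pi.zero_apply]; positivity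
  have h6 : 0 ≤ ∫ p in B.D ×ˢ Ioo 0 T, c.α p * ‖M.bdry w p‖ ^ 2 ∂M.lateralMeasure := by
    refine integral_nonneg_of_ae ?_
    filter_upwards [hmono subset_union_right hα] with p hp
    have := hmα.le.trans hp
    simp only [Pi.zero_apply]; positivity
  have h7 : 0 ≤ ∫ p in B.N ×ˢ Ioo 0 T, c.β p * ‖M.normalDeriv w p‖ ^ 2 ∂M.lateralMeasure := by
    refine integral_nonneg_of_ae ?_
    filter_upwards [hmono subset_union_right hβ] with p hp
    have := hmβ.le.trans hp
    simp only [Pi.zero_apply]; positivity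
  have h8 : 0 ≤ ∫ p in B.R ×ˢ Ioo 0 T, c.θ p * (1 - c.δ p) * ‖M.bdry w p‖ ^ 2
      ∂M.lateralMeasure := by
    refine integral_nonneg_of_ae ?_
    filter_upwards [hc.θ_pos, hc.δ_mem] with p hp1 hp2
    have : 0 ≤ 1 - c.δ p := by linarith [hp2.2]
    simp only [Pi.zero_apply]; positivity
  have h9 : 0 ≤ ∫ p in B.R ×ˢ Ioo 0 T, c.δ p / c.θ p * ‖M.normalDeriv w p‖ ^ 2
      ∂M.lateralMeasure := by
    refine integral_nonneg_of_ae ?_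
    filter_upwards [hc.θ_pos, hc.δ_mem] with p hp1 hp2
    have := hp2.1
    simp only [Pi.zero_apply]; positivity
  linarith

/-- Coercivity: the imaginary part of the DG form is the square of the DG norm. -/
theorem im_form_self (hd : 0 < d) (hΩ : IsPolytope Ω) (hc : M.Admissible B c)
    (hw : M.MemBroken w) : (M.form B c w w).im = M.dgNorm B c w ^ 2 := by
  have half : ∀ z : ℂ, ((1 / 2 : ℂ) * z).im = (1 / 2) * z.im := fun z => by
    have : (1 / 2 : ℂ) = ((1 / 2 : ℝ) : ℂ) := by push_cast; rfl
    rw [this, Complex.im_ofReal_mul]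
  have hE := im_sum_setIntegral_schr hd hΩ hw (fun i => hc.V_mul w hw i)
  have hμ : (Complex.I * ∑ i, ∫ p in M.elem i,
      (c.μ p : ℂ) * (M.schr c.V w i p * conj (M.schr c.V w i p))).im
      = ∑ i, ∫ p in M.elem i, c.μ p * ‖M.schr c.V w i p‖ ^ 2 := by
    rw [Complex.I_mul_im, Complex.re_sum]
    refine Finset.sum_congr rfl fun i _ => ?_
    rw [← Complex.ofReal_re (∫ p in M.elem i, c.μ p * ‖M.schr c.V w i p‖ ^ 2),
      ← integral_complex_ofReal]
    congr 1
    refine integral_congr_ae (.of_forall fun p => ?_)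
    simp only
    rw [Complex.mul_conj', Complex.ofReal_mul, Complex.ofReal_pow]
  rw [dgNorm_sq hc, form]
  simp only [Complex.add_im, half]
  rw [hE, hμ, Complex.I_mul_im, Complex.add_re, re_setIntegral_Fspace hd hΩ hw,
    integral_mul_conj_self, Complex.ofReal_re, integral_norm_sq_before hd hΩ hw,
    integral_norm_sq_after hd hΩ hw, integral_flux hd hΩ hw B]
  -- What remains is linear. On internal levels `|w⁻|²` and `|w⁺|²` cancel and half of the squared
  -- jump is left. At `T` the coefficient is `1 - ½`, at `0` it is `½`, and the vertical flux
  -- cancels facet by facet.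
  have hF := im_setIntegral_Ftime hd hΩ hc hw
  have hD := im_setIntegral_D hd hΩ hc hw
  have hN := im_setIntegral_N hd hΩ hc hw
  have hR := im_setIntegral_R hd hΩ hc hw
  linarith

end PrismaticMesh

end

theorem proposition3p1 {d : ℕ} (hd : 0 < d) {Ω : Set (Space d)} (hΩ : IsPolytope Ω)
    {T : ℝ} (hT : 0 < T) {ι : Type*} [Fintype ι] (M : PrismaticMesh Ω T ι)
    (B : BoundaryPartition Ω) (c : Coefficients d) (hc : M.Admissible B c)
    (w : ι → SpaceTime d → ℂ) (hw : M.MemBroken w) :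
    M.TracesWellDefined w ∧ (M.form B c w w).im = M.dgNorm B c w ^ 2 := by
  exact ⟨M.tracesWellDefined hd hΩ hw, PrismaticMesh.im_form_self hd hΩ hc hw⟩
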